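/- **Conventions.** Let $\Lambda$ be a $k$-graph: a countable small category with a functor $d:\Lambda\to\mathbb N^k$ such that whenever $d(\lambda)=m+n$ there are unique $\mu,\nu$ with $\lambda=\mu\nu$, $d(\mu)=m$, $d(\nu)=n$. For $v\in\Lambda^0$ and $m\in\mathbb N^k$ let $v\Lambda^m=\{\lambda: r(\lambda)=v,\ d(\lambda)=m\}$; $\Lambda$ is *row-finite* if all $v\Lambda^m$ are finite and has *no sources* if all are non-empty. A *$\Lambda$-module* is a contravariant functor $\mathcal A$ from $\Lambda$ to abelian groups; an abelian group $M$ gives the constant module $M^\Lambda$. *Cohomology of $\Lambda$.* $P^n$ is the $\Lambda$-module with $P^n_v$ free abelian on the composable tuples $[\lambda_0,\dots,\lambda_n]$ with $s(\lambda_n)=v$, and $P^n(\lambda)[\lambda_0,\dots,\lambda_n]=[\lambda_0,\dots,\lambda_n\lambda]$; $d_n[\lambda_0,\dots,\lambda_n]=[\lambda_1,\dots,\lambda_n]+\sum_{i=1}^n(-1)^i[\lambda_0,\dots,\lambda_{i-1}\lambda_i,\dots,\lambda_n]$ for $n\ge1$, and $d_0[\lambda]=1$. $H^n(\Lambda,\mathcal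 A)$ is the cohomology of $\mathrm{Hom}_\Lambda(P^*,\mathcal A)$. *The groupoid.* $\Lambda^\infty$ is the space of infinite paths (degree-preserving functors $x$ from $\Omega_k$ to $\Lambda$), with the topology generated by the sets $Z(\lambda)=\{x:x(0,d(\lambda))=\lambda\}$, and shifts $\sigma^p$. $\mathcal G=\mathcal G_\Lambda$ is the groupoid of triples $(x,j-\ell,y)$ with $\sigma^j x=\sigma^\ell y$ (range $x$, source $y$), with the étale topology generated by $Z(\lambda,\mu)=\{(\lambda z,d(\lambda)-d(\mu),\mu z)\}$, $s(\lambda)=s(\mu)$. A $\mathcal G$-sheaf is a sheaf of abelian groups over $\Lambda^\infty$, viewed as its étale space, with a continuous action of $\mathcal G$; morphisms are continuous equivariant families of homomorphisms of stalks, and exactness is exactness on stalks. For a $\Lambda$-module $\mathcal A$, $\underline{\mathcal A}$ is the $\mathcal G$-sheaf with stalks $\varinjlim_p\mathcal A_{x(p)}$ (canonical maps $\varphi^x_p:\mathcal A_{x(p)}\to\underline{\mathcal A}(x)$), action $(x,p-q,y)\cdot\varphi^y_q(a)=\varphi^x_p(a)$ if $\sigma^px=\sigma^qy$, and the topology in which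 the sections $x\mapsto\varphi^x_{d(\lambda)}(a)$ over $Z(\lambda)$, $a\in\mathcal A_{s(\lambda)}$, are continuous and open. The constant sheaf $\underline{\mathbb Z}$ is identified with $\underline{\mathbb Z^\Lambda}$. *Cohomologies of $\mathcal G$ with values in a $\mathcal G$-sheaf $\mathscr A$.* * For a resolution $\cdots\to\mathscr Q_1\to\mathscr Q_0\to\underline{\mathbb Z}\to0$ by $\mathcal G$-sheaves, $H^n_{\mathscr Q}(\mathcal G,\mathscr A)$ is the cohomology of $\mathrm{Hom}_{\mathcal G}(\mathscr Q_*,\mathscr A)$. This is applied to the resolution $\underline P=(\underline{P^n},\underline{d_n})$ and to $\mathscr P=(\mathscr P_n,\partial_n)$, where $\mathscr P_n=\mathbb Z[\mathcal G^{(n+1)}]$ has as stalk at $x$ the free abelian group on the composable $(\gamma_0,\dots,\gamma_n)$ with $r(\gamma_0)=x$, with action $\gamma[\gamma_0,\dots,\gamma_n]=[\gamma\gamma_0,\gamma_1,\dots,\gamma_n]$, $\partial_n[\gamma_0,\dots,\gamma_n]=(-1)^n[\gamma_0,\dots,\gamma_{n-1}]+\sum_{i=1}^n(-1)^{i-1}[\gamma_0,\dots,\gamma_{i-1}\gamma_i,\dots,\gamma_n]$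 for $n\ge1$, and $\partial_0[\gamma]=1$. * $H^n_c(\mathcal G,\mathscr A)$ is the cohomology of the groups of continuous cochains $f:\mathcal G^{(n)}\to\mathscr A$, $f(\gamma_1,\dots,\gamma_n)\in\mathscr A_{r(\gamma_1)}$ (not necessarily normalized), with the usual coboundary. * $H^n(\mathcal G,\mathscr A)=\mathrm{Ext}^n(\underline{\mathbb Z},\mathscr A)$ is sheaf cohomology: $\mathrm{Hom}_{\mathcal G}(\underline{\mathbb Z},\mathscr A)$ for $n=0$, and for $n\ge1$ the group, under Baer sum, of Yoneda classes of exact sequences $0\to\mathscr A\to\mathscr R_{n-1}\to\cdots\to\mathscr R_0\to\underline{\mathbb Z}\to0$. *Maps.* * $H^n(\Lambda,\mathcal A)\to H^n_{\underline P}(\mathcal G,\underline{\mathcal A})$ is $[c]\mapsto[\underline c]$, where $\underline c(\varphi^x_p(a))=\varphi^x_p(c(a))$. * $\eta^n:H^n_c(\mathcal G,\mathscr A)\to H^n_{\mathscr P}(\mathcal G,\mathscr A)$ is induced by $(\eta^nf)[\gamma_0,\dots,\gamma_n]=\gamma_0\cdot f(\gamma_1,\dots,\gamma_n)$. * $\psi_n^*:H^n_{\mathscr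 P}(\mathcal G,\mathscr A)\to H^n_{\underline P}(\mathcal G,\mathscr A)$ is induced by the chain map $\psi_n:\underline{P^n}\to\mathscr P_n$, $$\psi_n\bigl(\varphi^x_p[\lambda_0,\dots,\lambda_n]\bigr)=(-1)^{\lceil n/2\rceil}[\gamma_0,\dots,\gamma_n],$$ where $y_0=\lambda_n\sigma^p(x)$, $y_i=\lambda_{n-i}y_{i-1}$, $\gamma_0=(x,p-d(\lambda_n),y_0)$ and $\gamma_i=(y_{i-1},-d(\lambda_{n-i}),y_i)$ for $1\le i\le n$. * $\rho^n_{\mathscr Q}:H^n_{\mathscr Q}(\mathcal G,\mathscr A)\to H^n(\mathcal G,\mathscr A)$ sends, for $n=0$, a cocycle to the homomorphism $\underline{\mathbb Z}\to\mathscr A$ through which it factors, and for $n\ge1$ the class of $c$ to the class of $0\to\mathscr A\to\mathscr R_c\to\mathscr Q_{n-2}\to\cdots\to\mathscr Q_0\to\underline{\mathbb Z}\to0$ (where $\mathscr Q_{-1}=\underline{\mathbb Z}$, so that this reads $0\to\mathscr A\to\mathscr R_c\to\underline{\mathbb Z}\to0$ for $n=1$), where $\mathscr R_c$ is the pushout of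 $c:\mathscr Q_n\to\mathscr A$ and $\mathscr Q_n\to\mathscr Q_{n-1}$. * *Kumjian–Pask–Sims maps* $\kappa^n:H^n(\Lambda,M^\Lambda)\to H^n_c(\mathcal G,\underline{M^\Lambda})$, $n\le2$, for an abelian group $M$. For an $n$-cocycle $c$ write $c(v)=c[v]$ if $n=0$ and $c(\lambda_1,\dots,\lambda_n)=c[\lambda_1,\dots,\lambda_n,s(\lambda_n)]$ if $n\ge 1$, and identify the stalks of $\underline{M^\Lambda}$ with $M$. Then $\kappa^n[c]=[\sigma_c]$, where $\sigma_c(x)=c(r(x))$ for $n=0$; $\sigma_c(x,j-\ell,y)=c(x(0,j))-c(y(0,\ell))$ if $\sigma^jx=\sigma^\ell y$, for $n=1$; and for $n=2$, given a set $\mathcal P$ of pairs $(\mu,\nu)$ with $s(\mu)=s(\nu)$ such that every element $g$ of $\mathcal G$ lies in $Z(\mu_g,\nu_g)$ for exactly one $(\mu_g,\nu_g)\in\mathcal P$, $$\sigma_c(g,h)=c(\mu_g,\alpha)-c(\nu_g,\alpha)+c(\mu_h,\beta)-c(\nu_h,\beta)-c(\mu_{gh},\gamma)+c(\nu_{gh},\gamma),$$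 where $\alpha,\beta,\gamma\in\Lambda$ and an infinite path $\omega$ are such that $\nu_g\alpha=\mu_h\beta$, $\mu_g\alpha=\mu_{gh}\gamma$, $\nu_h\beta=\nu_{gh}\gamma$, $g=(\mu_g\alpha\omega,d(\mu_g)-d(\nu_g),\nu_g\alpha\omega)$ and $h=(\mu_h\beta\omega,d(\mu_h)-d(\nu_h),\nu_h\beta\omega)$. **Theorem 4.1.** Let $\Lambda$ be a row-finite $k$-graph with no sources. 1. For every $\Lambda$-module $\mathcal A$ and every $n\ge0$, $\eta^n:H^n_c(\mathcal G_\Lambda,\underline{\mathcal A})\to H^n_{\mathscr P}(\mathcal G_\Lambda,\underline{\mathcal A})$ is an isomorphism, $\rho^n_{\underline P}$ and $\rho^n_{\mathscr P}$ (with coefficients in $\underline{\mathcal A}$) are homomorphisms, and $$\rho^n_{\underline P}\circ\psi_n^*=\rho^n_{\mathscr P}:H^n_{\mathscr P}(\mathcal G_\Lambda,\underline{\mathcal A})\to H^n(\mathcal G_\Lambda,\underline{\mathcal A}).$$ 2. A set $\mathcal P$ as above exists. For every abelian group $M$ and $n\in\{0,1,2\}$ the maps $\kappa^n$ are well-defined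 homomorphisms: every cocycle $c$ has a continuous cocycle $\sigma_c$ given by the formula above (for $n=2$: for every $\mathcal P$, with $\alpha,\beta,\gamma,\omega$ existing for all composable $g,h$ and the formula holding for every choice of them), and $[c]\mapsto[\sigma_c]$ is a well-defined homomorphism (for $n=2$: independent of $\mathcal P$). Moreover $$\psi_n^*\circ\eta^n\circ\kappa^n:H^n(\Lambda,M^\Lambda)\to H^n_{\underline P}(\mathcal G_\Lambda,\underline{M^\Lambda})$$ is the map $[c]\mapsto[\underline c]$. -/

import Mathlib

open CategoryTheory Opposite Topology

universe u

namespace KGraphCoh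

noncomputable section

/-! ### Conventions

In every category below `f : x ⟶ y` has source `s(f) = x` and range `r(f) = y`.  In the
"arrows only" notation the product `λμ` (defined when `s(λ) = r(μ)`) is `μ ≫ λ`. -/

/-- The set of all arrows of a small category. -/
structure Arr (C : Type u) [SmallCategory C] : Type u where
  {src : C}
  {tgt : C}
  hom : src ⟶ tgt

/-- Pairs of arrows `x ⟶ y ⟶ z`. -/
structure CompPair (C : Type u) [SmallCategory C] : Type u where
  {x : C}
  {y : C}
  {z : C}
  fst : x ⟶ y
  snd : y ⟶ z

/-- The total space `⨆ₓ E(x)` of a family of sets. -/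
structure Tot {X : Type u} (E : X → Type u) : Type u where
  base : X
  val : E base

/-- The fibre product of the total space with itself. -/
structure Tot2 {X : Type u} (E : X → Type u) : Type u where
  base : X
  fst : E base
  snd : E base

/-- The set `G * E` of pairs `(γ, e)` with `e` in the fibre over `s(γ)`. -/
structure ActPair {X : Type u} [SmallCategory X] (E : X → Type u) : Type u where
  {src : X}
  {tgt : X}
  hom : src ⟶ tgt
  val : E src

section LocalHomeo

lemma isLocalHomeomorph_of_open {E X : Type*} [TopologicalSpace E] [TopologicalSpace X]
    {f : E → X} (hc : Continuous f) (ho : IsOpenMap f) (hi : IsLocallyInjective f) :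
    IsLocalHomeomorph f := by
  rw [isLocalHomeomorph_iff_isOpenEmbedding_restrict]
  intro e
  obtain ⟨U, hU, he, hinj⟩ := hi e
  exact ⟨U, hU.mem_nhds he, .of_continuous_injective_isOpenMap
    (hc.comp continuous_subtype_val) (Set.injOn_iff_injective.1 hinj) (ho.domRestrict hU)⟩

variable {X : Type u} [TopologicalSpace X]

/-- A local section, over an open set, of a family of sets. -/
structure LocSec (E : X → Type u) : Type u where
  dom : TopologicalSpace.Opens X
  sec : ∀ x, x ∈ dom → E x

variable {E : X → Type u}

/-- The map from the domain to the total space given by a local section. -/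
def LocSec.map (b : LocSec E) (x : b.dom) : Tot E := ⟨x.1, b.sec x.1 x.2⟩

/-- The topology on the total space determined by a family of local sections: the finest one
for which all the sections of the family are continuous. -/
@[reducible] def secTop (B : Set (LocSec E)) : TopologicalSpace (Tot E) where
  IsOpen O := ∀ b ∈ B, IsOpen {x | ∃ h : x ∈ b.dom, (⟨x, b.sec x h⟩ : Tot E) ∈ O}
  isOpen_univ b _ := by
    convert b.dom.isOpen using 1
    ext x
    simp
  isOpen_inter O O' h h' b hb := by
    convert (h b hb).inter (h' b hb) using 1
    ext x
    simp only [Set.mem_inter_iff, Set.mem_ofPred_eq]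
    constructor
    · rintro ⟨hx, h1, h2⟩
      exact ⟨⟨hx, h1⟩, ⟨hx, h2⟩⟩
    · rintro ⟨⟨hx, h1⟩, ⟨_, h2⟩⟩
      exact ⟨hx, h1, h2⟩
  isOpen_sUnion S h b hb := by
    have : {x | ∃ h : x ∈ b.dom, (⟨x, b.sec x h⟩ : Tot E) ∈ ⋃₀ S} =
        ⋃ O ∈ S, {x | ∃ h : x ∈ b.dom, (⟨x, b.sec x h⟩ : Tot E) ∈ O} := by
      ext x
      simp only [Set.mem_sUnion, Set.mem_ofPred_eq, Set.mem_iUnion]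
      constructor
      · rintro ⟨hx, O, hO, h2⟩
        exact ⟨O, hO, hx, h2⟩
      · rintro ⟨O, hO, hx, h2⟩
        exact ⟨hx, O, hO, h2⟩
    rw [this]
    exact isOpen_biUnion fun O hO => h O hO b hb

lemma secTop_isOpen {B : Set (LocSec E)} {O : Set (Tot E)} :
    IsOpen[secTop B] O ↔
      ∀ b ∈ B, IsOpen {x | ∃ h : x ∈ b.dom, (⟨x, b.sec x h⟩ : Tot E) ∈ O} := Iff.rfl

lemma secTop_continuous_map {B : Set (LocSec E)} {b : LocSec E} (hb : b ∈ B) :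
    @Continuous _ _ _ (secTop B) b.map := by
  let := secTop B
  refine ⟨fun O hO => ?_⟩
  have := (secTop_isOpen.1 hO) b hb
  convert this.preimage (continuous_subtype_val (p := fun x => x ∈ b.dom)) using 1
  ext x
  simp only [Set.mem_preimage, Set.mem_ofPred_eq]
  exact ⟨fun h => ⟨x.2, h⟩, fun ⟨_, h⟩ => h⟩

lemma secTop_continuous_iff {B : Set (LocSec E)} {T : Type*} [TopologicalSpace T]
    {f : Tot E → T} :
    @Continuous _ _ (secTop B) _ f ↔ ∀ b ∈ B, Continuous fun x : b.dom => f (b.map x) := by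
  let := secTop B
  refine ⟨fun h b hb => h.comp (secTop_continuous_map hb), fun h => ⟨fun O hO => ?_⟩⟩
  rw [secTop_isOpen]
  intro b hb
  have := (b.dom.isOpen.isOpenMap_subtype_val) _ (hO.preimage (h b hb))
  convert this using 1
  ext x
  simp only [Set.mem_preimage, Set.mem_ofPred_eq, Set.mem_image, Subtype.exists,
    exists_and_right, exists_eq_right]
  rfl

/-- Two sections of the family which agree at a point agree near that point. -/
def Agree (B : Set (LocSec E)) : Prop :=
  ∀ b ∈ B, ∀ b' ∈ B, ∀ x (h : x ∈ b.dom) (h' : x ∈ b'.dom), b.sec x h = b'.sec x h' →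
    ∀ᶠ z in 𝓝 x, ∀ (h : z ∈ b.dom) (h' : z ∈ b'.dom), b.sec z h = b'.sec z h'

/-- The sections of the family go through every point. -/
def Cover (B : Set (LocSec E)) : Prop :=
  ∀ x (e : E x), ∃ b ∈ B, ∃ h : x ∈ b.dom, b.sec x h = e

lemma secTop_isOpen_image {B : Set (LocSec E)} (hB : Agree B) {b : LocSec E} (hb : b ∈ B)
    {V : Set X} (hV : IsOpen V) :
    IsOpen[secTop B] {p | ∃ h : p.base ∈ b.dom, p.base ∈ V ∧ p.val = b.sec p.base h} := by
  rw [secTop_isOpen]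
  intro b' hb'
  rw [isOpen_iff_mem_nhds]
  rintro x ⟨hx', hx, hxV, he⟩
  filter_upwards [hB b' hb' b hb x hx' hx he, hV.mem_nhds hxV, b.dom.isOpen.mem_nhds hx,
    b'.dom.isOpen.mem_nhds hx'] with z hz hzV hz1 hz2
  exact ⟨hz2, hz1, hzV, hz _ _⟩

lemma secTop_isLocalHomeomorph {B : Set (LocSec E)} (hB : Agree B) (hC : Cover B) :
    @IsLocalHomeomorph _ _ (secTop B) _ (Tot.base : Tot E → X) := by
  let := secTop B
  have hc : Continuous (Tot.base : Tot E → X) :=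
    secTop_continuous_iff.2 fun b _ => continuous_subtype_val
  refine isLocalHomeomorph_of_open hc ?_ ?_
  · intro O hO
    rw [isOpen_iff_mem_nhds]
    rintro _ ⟨⟨x, e⟩, he, rfl⟩
    obtain ⟨b, hb, hx, rfl⟩ := hC x e
    refine Filter.mem_of_superset ((secTop_isOpen.1 hO b hb).mem_nhds ⟨hx, he⟩) ?_
    rintro z ⟨hz, h⟩
    exact ⟨_, h, rfl⟩
  · rintro ⟨x, e⟩
    obtain ⟨b, hb, hx, rfl⟩ := hC x e
    refine ⟨_, secTop_isOpen_image hB hb isOpen_univ, ⟨hx, trivial, rfl⟩, ?_⟩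
    rintro ⟨y, e⟩ ⟨h, _, h2⟩ ⟨y', e'⟩ ⟨h', _, h2'⟩ (rfl : y = y')
    simp only at h2 h2'
    rw [h2, h2']

lemma eventually_nhds_dom {U : TopologicalSpace.Opens X} {x : X} {hx : x ∈ U} {P : U → Prop} :
    (∀ᶠ z in 𝓝 (⟨x, hx⟩ : U), P z) ↔ ∀ᶠ z in 𝓝 x, ∀ h : z ∈ U, P ⟨z, h⟩ := by
  rw [nhds_subtype_eq_comap, Filter.eventually_comap]
  refine Filter.eventually_congr (Filter.Eventually.of_forall fun z => ?_)
  exact ⟨fun h hz => h ⟨z, hz⟩ rfl, fun h a ha => by subst ha; exact h a.2⟩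

lemma Tot.mk_cast (p : Tot E) {z : X} (h : p.base = z) : (⟨z, h ▸ p.val⟩ : Tot E) = p := by
  cases p
  cases h
  rfl

section Etale

variable [TopologicalSpace (Tot E)]

lemma exists_section (hπ : IsLocalHomeomorph (Tot.base : Tot E → X)) {x : X} (e : E x) :
    ∃ b : LocSec E, Continuous b.map ∧ ∃ h : x ∈ b.dom, b.sec x h = e := by
  obtain ⟨φ, hφ, hE⟩ := hπ ⟨x, e⟩
  have hinv : ∀ z, z ∈ φ.target → (φ.symm z).base = z := fun z hz => by
    have := φ.right_inv hz
    rwa [← hE] at this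
  have hx : x ∈ φ.target := by
    have := φ.map_source hφ
    rwa [← hE] at this
  let b : LocSec E := ⟨⟨φ.target, φ.open_target⟩, fun z hz => hinv z hz ▸ (φ.symm z).val⟩
  have key : ∀ z (hz : z ∈ φ.target), (⟨z, hinv z hz ▸ (φ.symm z).val⟩ : Tot E) = φ.symm z := by
    intro z hz
    exact Tot.mk_cast _ _
  have keyx : (⟨x, b.sec x hx⟩ : Tot E) = ⟨x, e⟩ := by
    have h1 := φ.left_inv hφ
    rw [← hE] at h1
    exact (key x hx).trans h1
  refine ⟨b, ?_, hx, ?_⟩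
  · have : b.map = φ.target.domRestrict φ.symm := funext fun z => key z.1 z.2
    rw [this]
    exact φ.continuousOn_symm.domRestrict
  · exact eq_of_heq (Tot.mk.inj keyx).2

lemma eventually_eq_of_eq (hπ : IsLocalHomeomorph (Tot.base : Tot E → X)) {Z : Type*}
    [TopologicalSpace Z] {f g : Z → Tot E} {z : Z} (hf : ContinuousAt f z)
    (hg : ContinuousAt g z) (hfg : f z = g z) (hb : ∀ᶠ w in 𝓝 z, (f w).base = (g w).base) :
    ∀ᶠ w in 𝓝 z, f w = g w := by
  obtain ⟨U, hU, hz, hi⟩ := hπ.isLocallyInjective (f z)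
  filter_upwards [hf (hU.mem_nhds hz), hg (hU.mem_nhds (hfg ▸ hz)), hb] with w h1 h2 h3
  exact hi h1 h2 h3

/-- Points near a point of a continuous section lie on the section. -/
lemma eventually_section (hπ : IsLocalHomeomorph (Tot.base : Tot E → X)) {b : LocSec E}
    (hb : Continuous b.map) {x : X} (hx : x ∈ b.dom) :
    ∀ᶠ p in 𝓝 (⟨x, b.sec x hx⟩ : Tot E), ∃ h : p.base ∈ b.dom, p.val = b.sec p.base h := by
  have h1 : IsOpen (Tot.base ⁻¹' (b.dom : Set X) : Set (Tot E)) :=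
    b.dom.isOpen.preimage hπ.continuous
  let D := {p : Tot E // p.base ∈ b.dom}
  let f : D → Tot E := fun p => p.1
  let g : D → Tot E := fun p => b.map ⟨p.1.base, p.2⟩
  have hg : Continuous g := hb.comp
    (Continuous.subtype_mk (hπ.continuous.comp continuous_subtype_val) _)
  have := eventually_eq_of_eq hπ (f := f) (g := g) (z := ⟨⟨x, b.sec x hx⟩, hx⟩)
    continuous_subtype_val.continuousAt hg.continuousAt rfl (Filter.Eventually.of_forall fun _ => rfl)
  rw [nhds_subtype_eq_comap, Filter.eventually_comap] at this
  filter_upwards [this, h1.mem_nhds hx] with p hp hp2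
  have h3 := hp ⟨p, hp2⟩ rfl
  refine ⟨hp2, ?_⟩
  cases p
  exact eq_of_heq (Tot.mk.inj h3).2

/-- A map which near `t` follows a continuous section is continuous at `t`. -/
lemma continuousAt_of_section {b : LocSec E} (hb : Continuous b.map) {T : Type*}
    [TopologicalSpace T] {f : T → Tot E} {t : T} (hx : (f t).base ∈ b.dom)
    (hbase : ContinuousAt (fun t => (f t).base) t)
    (hev : ∀ᶠ t' in 𝓝 t, ∀ h : (f t').base ∈ b.dom, (f t').val = b.sec _ h) :
    ContinuousAt f t := by
  have hval : ∀ t' (h : (f t').base ∈ b.dom), (f t').val = b.sec _ h →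
      f t' = b.map ⟨(f t').base, h⟩ := by
    intro t' h he
    generalize f t' = p at h he
    cases p
    simp only at he
    rw [he]
    rfl
  have hft := hval t hx (hev.self_of_nhds hx)
  refine tendsto_nhds.2 fun O hO htO => ?_
  rw [hft] at htO
  have h1 : b.map ⁻¹' O ∈ 𝓝 (⟨(f t).base, hx⟩ : b.dom) := (hO.preimage hb).mem_nhds htO
  have h2 := eventually_nhds_dom.1 h1
  filter_upwards [hbase h2, hev, hbase (b.dom.isOpen.mem_nhds hx)] with t' h3 h4 h5
  have := h3 h5
  rw [Set.mem_preimage, hval t' h5 (h4 h5)]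
  exact this

end Etale

end LocalHomeo

/-! ### Groupoids and sheaves over them -/

/-- A groupoid with topologies on its unit space and on its set of arrows for which
multiplication and inversion are continuous and the range and source maps are local
homeomorphisms. -/
class EtaleGroupoid (X : Type u) extends Groupoid.{u} X, TopologicalSpace X where
  arrTop : TopologicalSpace (Arr X)
  isLocalHomeomorph_src : IsLocalHomeomorph (Arr.src : Arr X → X)
  isLocalHomeomorph_tgt : IsLocalHomeomorph (Arr.tgt : Arr X → X)
  continuous_inv : Continuous fun g : Arr X => (⟨Groupoid.inv g.hom⟩ : Arr X)
  continuous_comp : @Continuous (CompPair X) (Arr X)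
    (.induced (fun p => ((⟨p.fst⟩, ⟨p.snd⟩) : Arr X × Arr X)) inferInstance) arrTop
    fun p => ⟨p.fst ≫ p.snd⟩

instance (X : Type u) [EtaleGroupoid X] : TopologicalSpace (Arr X) := EtaleGroupoid.arrTop

section

variable {X : Type u} [EtaleGroupoid X]

/-- The fibre product of a total space with itself, as a subspace of the product. -/
instance (E : X → Type u) [TopologicalSpace (Tot E)] : TopologicalSpace (Tot2 E) :=
  .induced (fun p => ((⟨p.base, p.fst⟩, ⟨p.base, p.snd⟩) : Tot E × Tot E)) inferInstance

/-- The domain `G * E` of an action, as a subspace of the product of `G` and `E`. -/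
instance (E : X → Type u) [TopologicalSpace (Tot E)] : TopologicalSpace (ActPair E) :=
  .induced (fun p => ((⟨p.hom⟩, ⟨p.src, p.val⟩) : Arr X × Tot E)) inferInstance

/-- A sheaf of sets over a groupoid: an onto local homeomorphism to the unit space with
a continuous action of the groupoid on its fibres. -/
structure SetSheaf (X : Type u) [EtaleGroupoid X] : Type (u + 1) where
  stalk : X → Type u
  nonempty : ∀ x, Nonempty (stalk x)
  act : ∀ {x y : X}, (x ⟶ y) → stalk x → stalk y
  act_id : ∀ {x : X} (e : stalk x), act (𝟙 x) e = e
  act_comp : ∀ {x y z : X} (γ : x ⟶ y) (γ' : y ⟶ z) (e : stalk x),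
    act (γ ≫ γ') e = act γ' (act γ e)
  top : TopologicalSpace (Tot stalk)
  isLocalHomeomorph : IsLocalHomeomorph (Tot.base : Tot stalk → X)
  continuous_act : Continuous fun p : ActPair stalk => (⟨p.tgt, act p.hom p.val⟩ : Tot stalk)

instance (Y : SetSheaf X) : TopologicalSpace (Tot Y.stalk) := Y.top

/-- A sheaf of abelian groups over a groupoid, in the espace étalé picture.  The stalks and the
action `α_γ : A(s(γ)) → A(r(γ))` form a functor (whose values on arrows are automatically
isomorphisms); the projection of the total space is a local homeomorphism, and the fibrewise group
operations and the action are continuous. -/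
structure GSheaf (X : Type u) [EtaleGroupoid X] : Type (u + 1) where
  act : X ⥤ AddCommGrpCat.{u}
  top : TopologicalSpace (Tot fun x => act.obj x)
  isLocalHomeomorph : IsLocalHomeomorph (Tot.base : (Tot fun x => act.obj x) → X)
  continuous_add : Continuous fun p : Tot2 fun x => act.obj x =>
    (⟨p.base, p.fst + p.snd⟩ : Tot fun x => act.obj x)
  continuous_neg : Continuous fun p : Tot fun x => act.obj x =>
    (⟨p.base, -p.val⟩ : Tot fun x => act.obj x)
  continuous_act : Continuous fun p : ActPair fun x => act.obj x =>
    (⟨p.tgt, act.map p.hom p.val⟩ : Tot fun x => act.obj x)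

/-- The stalks of a sheaf. -/
abbrev GSheaf.stalk (F : GSheaf X) (x : X) : Type u := F.act.obj x

instance (F : GSheaf X) : TopologicalSpace (Tot F.stalk) := F.top

/-- The sheaf determined by a system of stalks with an action and by a family of local sections
through every point which is, locally, closed under subtraction and the action. -/
def GSheaf.ofSections (F : X ⥤ AddCommGrpCat.{u}) (B : Set (LocSec fun x => F.obj x))
    (hcov : Cover B)
    (hzero : ∀ b ∈ B, ∀ x (h : x ∈ b.dom), b.sec x h = 0 →
      ∀ᶠ z in 𝓝 x, ∀ h : z ∈ b.dom, b.sec z h = 0)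
    (hsub : ∀ b ∈ B, ∀ b' ∈ B, ∀ x, x ∈ b.dom → x ∈ b'.dom → ∃ c ∈ B, x ∈ c.dom ∧
      ∀ᶠ z in 𝓝 x, ∀ (h : z ∈ b.dom) (h' : z ∈ b'.dom) (hc : z ∈ c.dom),
        c.sec z hc = b.sec z h - b'.sec z h')
    (hact : ∀ b ∈ B, ∀ γ : Arr X, γ.src ∈ b.dom → ∃ c ∈ B, γ.tgt ∈ c.dom ∧
      ∀ᶠ γ' in 𝓝 γ, ∀ (h : γ'.src ∈ b.dom) (hc : γ'.tgt ∈ c.dom),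
        c.sec _ hc = F.map γ'.hom (b.sec _ h)) : GSheaf X :=
  have hB : Agree B := by
    intro b hb b' hb' x h h' he
    obtain ⟨c, hc, hxc, hev⟩ := hsub b hb b' hb' x h h'
    have h0 : c.sec x hxc = 0 := by rw [hev.self_of_nhds h h' hxc, he, sub_self]
    filter_upwards [hev, hzero c hc x hxc h0, c.dom.isOpen.mem_nhds hxc] with z h1 h2 h3 h4 h5
    have := h1 h4 h5 h3
    rw [h2 h3] at this
    exact (sub_eq_zero.1 this.symm)
  have hneg : ∀ b ∈ B, ∀ x, x ∈ b.dom → ∃ c ∈ B, x ∈ c.dom ∧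
      ∀ᶠ z in 𝓝 x, ∀ (h : z ∈ b.dom) (hc : z ∈ c.dom), c.sec z hc = - b.sec z h := by
    intro b hb x hx
    obtain ⟨c, hc, hxc, hev⟩ := hsub b hb b hb x hx hx
    obtain ⟨e, he, hxe, hev'⟩ := hsub c hc b hb x hxc hx
    refine ⟨e, he, hxe, ?_⟩
    filter_upwards [hev, hev', c.dom.isOpen.mem_nhds hxc] with z h1 h2 h3 h4 h5
    rw [h2 h3 h4 h5, h1 h4 h4 h3, sub_self, zero_sub]
  { act := F
    top := secTop B
    isLocalHomeomorph := secTop_isLocalHomeomorph hB hcov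
    continuous_neg := by
      let := secTop B
      have hπ := secTop_isLocalHomeomorph hB hcov
      rw [continuous_iff_continuousAt]
      rintro ⟨x, a⟩
      obtain ⟨b, hb, hx, rfl⟩ := hcov x a
      obtain ⟨c, hc, hxc, hev⟩ := hneg b hb x hx
      refine continuousAt_of_section (secTop_continuous_map hc) hxc hπ.continuous.continuousAt ?_
      filter_upwards [eventually_section hπ (secTop_continuous_map hb) hx,
        hπ.continuous.continuousAt.eventually hev] with p ⟨h1, h2⟩ h3 h4
      rw [h3 h1 h4, h2]
    continuous_add := by
      let := secTop B
      have hπ := secTop_isLocalHomeomorph hB hcov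
      rw [continuous_iff_continuousAt]
      rintro ⟨x, a, a'⟩
      obtain ⟨b, hb, hx, rfl⟩ := hcov x a
      obtain ⟨b', hb', hx', rfl⟩ := hcov x a'
      obtain ⟨e, he, hxe, hev'⟩ := hneg b' hb' x hx'
      obtain ⟨c, hc, hxc, hev⟩ := hsub b hb e he x hx hxe
      have hi : Continuous fun p : Tot2 (fun x => F.obj x) =>
          (((⟨p.base, p.fst⟩, ⟨p.base, p.snd⟩) : (Tot fun x => F.obj x) × Tot fun x => F.obj x)) :=
        continuous_induced_dom
      have hbase : Continuous fun p : Tot2 (fun x => F.obj x) => p.base :=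
        hπ.continuous.comp (continuous_fst.comp hi)
      refine continuousAt_of_section (secTop_continuous_map hc) hxc hbase.continuousAt ?_
      filter_upwards [(continuous_fst.comp hi).continuousAt.eventually
          (eventually_section hπ (secTop_continuous_map hb) hx),
        (continuous_snd.comp hi).continuousAt.eventually
          (eventually_section hπ (secTop_continuous_map hb') hx'),
        hbase.continuousAt.eventually hev, hbase.continuousAt.eventually hev',
        hbase.continuousAt.eventually (e.dom.isOpen.mem_nhds hxe)] with
        p ⟨h1, h2⟩ ⟨h3, h4⟩ h5 h6 h7 h8
      simp only [Function.comp] at h1 h2 h3 h4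
      rw [h5 h1 h7 h8, h6 h3 h7, h2, h4, sub_neg_eq_add]
    continuous_act := by
      let := secTop B
      have hπ := secTop_isLocalHomeomorph hB hcov
      rw [continuous_iff_continuousAt]
      rintro ⟨γ, a⟩
      obtain ⟨b, hb, hx, rfl⟩ := hcov _ a
      obtain ⟨c, hc, hxc, hev⟩ := hact b hb ⟨γ⟩ hx
      have hi : Continuous fun p : ActPair (fun x => F.obj x) =>
          (((⟨p.hom⟩, ⟨p.src, p.val⟩) : Arr X × Tot fun x => F.obj x)) :=
        continuous_induced_dom
      have hbase : Continuous fun p : ActPair (fun x => F.obj x) => p.tgt :=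
        (EtaleGroupoid.isLocalHomeomorph_tgt (X := X)).continuous.comp (continuous_fst.comp hi)
      refine continuousAt_of_section (secTop_continuous_map hc) hxc hbase.continuousAt ?_
      filter_upwards [(continuous_snd.comp hi).continuousAt.eventually
          (eventually_section hπ (secTop_continuous_map hb) hx),
        (continuous_fst.comp hi).continuousAt.eventually hev] with p ⟨h1, h2⟩ h3 h4
      simp only [Function.comp] at h1 h2 h3
      rw [h3 h1 h4, h2] }

/-- The map of total spaces given by a family of homomorphisms of stalks. -/
def totMap {F F' : X ⥤ AddCommGrpCat.{u}} (η : F ⟶ F') (p : Tot fun x => F.obj x) :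
    Tot fun x => F'.obj x := ⟨p.base, η.app p.base p.val⟩

namespace GSheaf

lemma continuous_base (F : GSheaf X) : Continuous (Tot.base : Tot F.stalk → X) :=
  F.isLocalHomeomorph.continuous

lemma continuous_totMap_zero (F F' : GSheaf X) : Continuous (totMap (0 : F.act ⟶ F'.act)) := by
  have key : Continuous fun x : X => (⟨x, 0⟩ : Tot F'.stalk) := by
    rw [continuous_iff_continuousAt]
    intro x
    obtain ⟨b, hb, hx, h0⟩ := exists_section F'.isLocalHomeomorph (0 : F'.stalk x)
    have hneg : Continuous fun z : b.dom => (⟨z, -b.sec z z.2⟩ : Tot F'.stalk) :=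
      F'.continuous_neg.comp hb
    have hp : Continuous fun z : b.dom => (⟨z, b.sec z z.2, -b.sec z z.2⟩ : Tot2 F'.stalk) :=
      continuous_induced_rng.2 (hb.prodMk hneg)
    have h := F'.continuous_add.comp hp
    let c : LocSec F'.stalk := ⟨b.dom, fun z _ => 0⟩
    have hc : Continuous c.map := by
      refine h.congr fun z => ?_
      simp only [Function.comp, add_neg_cancel]
      rfl
    exact continuousAt_of_section hc hx continuousAt_id
      (Filter.Eventually.of_forall fun z hz => rfl)
  exact key.comp F.continuous_base

/-- The group `Hom_G(F, F')` of morphisms of sheaves: equivariant families of homomorphisms of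
the stalks which are continuous on the total space. -/
def homs (F F' : GSheaf X) : AddSubgroup (F.act ⟶ F'.act) where
  carrier := {η | Continuous (totMap η : Tot F.stalk → Tot F'.stalk)}
  zero_mem' := continuous_totMap_zero F F'
  add_mem' {η θ} hη hθ := by
    have : Continuous fun p : Tot F.stalk =>
        (⟨p.base, η.app p.base p.val, θ.app p.base p.val⟩ : Tot2 F'.stalk) :=
      continuous_induced_rng.2 (hη.prodMk hθ)
    exact F'.continuous_add.comp this
  neg_mem' {η} hη := F'.continuous_neg.comp hη

instance : Category (GSheaf X) where
  Hom F F' := homs F F'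
  id F := ⟨𝟙 F.act, continuous_id⟩
  comp f g := ⟨f.1 ≫ g.1, g.2.comp f.2⟩
  id_comp f := Subtype.ext (Category.id_comp f.1)
  comp_id f := Subtype.ext (Category.comp_id f.1)
  assoc f g h := Subtype.ext (Category.assoc f.1 g.1 h.1)

instance (F F' : GSheaf X) : AddCommGroup (F ⟶ F') :=
  inferInstanceAs (AddCommGroup (homs F F'))

instance : Preadditive (GSheaf X) where
  add_comp _ _ _ f f' g := Subtype.ext (Preadditive.add_comp _ _ _ f.1 f'.1 g.1)
  comp_add _ _ _ f g g' := Subtype.ext (Preadditive.comp_add _ _ _ f.1 g.1 g'.1)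

/-- The homomorphism on stalks given by a morphism of sheaves. -/
def app {F F' : GSheaf X} (f : F ⟶ F') (x : X) : F.stalk x →+ F'.stalk x := (f.1.app x).hom

/-- A continuous natural transformation is a morphism of sheaves. -/
def mkHom {F F' : GSheaf X} (η : F.act ⟶ F'.act)
    (h : Continuous (totMap η : Tot F.stalk → Tot F'.stalk)) : F ⟶ F' := ⟨η, h⟩

lemma hom_ext {F F' : GSheaf X} {f g : F ⟶ F'} (h : ∀ x a, app f x a = app g x a) : f = g := by
  refine Subtype.ext (NatTrans.ext (funext fun x => ?_))
  ext a
  exact h x a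

lemma app_comp {F F' F'' : GSheaf X} (f : F ⟶ F') (g : F' ⟶ F'') (x : X) (a : F.stalk x) :
    app (f ≫ g) x a = app g x (app f x a) := rfl

lemma app_add {F F' : GSheaf X} (f g : F ⟶ F') (x : X) (a : F.stalk x) :
    app (f + g) x a = app f x a + app g x a := rfl

lemma app_zero {F F' : GSheaf X} (x : X) (a : F.stalk x) :
    app (0 : F ⟶ F') x a = 0 := rfl

lemma app_neg {F F' : GSheaf X} (f : F ⟶ F') (x : X) (a : F.stalk x) :
    app (-f) x a = -app f x a := rfl

lemma app_naturality {F F' : GSheaf X} (f : F ⟶ F') {x y : X} (γ : x ⟶ y) (a : F.stalk x) :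
    app f y (F.act.map γ a) = F'.act.map γ (app f x a) :=
  congrArg (fun φ => φ a) (f.1.naturality γ)

lemma continuous_hom {F F' : GSheaf X} (f : F ⟶ F') :
    Continuous fun p : Tot F.stalk => (⟨p.base, app f p.base p.val⟩ : Tot F'.stalk) := f.2

/-- Sums of continuous maps into a sheaf are continuous. -/
lemma continuous_mk_add {F : GSheaf X} {T : Type*} [TopologicalSpace T] {π : T → X}
    {a a' : ∀ t, F.stalk (π t)} (h : Continuous fun t => (⟨π t, a t⟩ : Tot F.stalk))
    (h' : Continuous fun t => (⟨π t, a' t⟩ : Tot F.stalk)) :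
    Continuous fun t => (⟨π t, a t + a' t⟩ : Tot F.stalk) := by
  have : Continuous fun t => (⟨π t, a t, a' t⟩ : Tot2 F.stalk) :=
    continuous_induced_rng.2 (h.prodMk h')
  exact F.continuous_add.comp this

lemma continuous_mk_zero {F : GSheaf X} {T : Type*} [TopologicalSpace T] {π : T → X}
    (h : Continuous π) : Continuous fun t => (⟨π t, 0⟩ : Tot F.stalk) := by
  have h0 : Continuous fun x : X => (⟨x, 0⟩ : Tot F.stalk) := by
    rw [continuous_iff_continuousAt]
    intro x
    obtain ⟨b, hb, hx, h0⟩ := exists_section F.isLocalHomeomorph (0 : F.stalk x)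
    have hz := (continuous_totMap_zero F F).comp hb
    exact continuousAt_of_section (b := ⟨b.dom, fun z _ => 0⟩) hz hx continuousAt_id
      (Filter.Eventually.of_forall fun z hz => rfl)
  exact h0.comp h

lemma continuous_mk_neg {F : GSheaf X} {T : Type*} [TopologicalSpace T] {π : T → X}
    {a : ∀ t, F.stalk (π t)} (h : Continuous fun t => (⟨π t, a t⟩ : Tot F.stalk)) :
    Continuous fun t => (⟨π t, -a t⟩ : Tot F.stalk) :=
  F.continuous_neg.comp h

lemma continuous_mk_act {F : GSheaf X} {T : Type*} [TopologicalSpace T] {γ : T → Arr X}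
    {a : ∀ t, F.stalk (γ t).src} (hγ : Continuous γ)
    (h : Continuous fun t => (⟨(γ t).src, a t⟩ : Tot F.stalk)) :
    Continuous fun t => (⟨(γ t).tgt, F.act.map (γ t).hom (a t)⟩ : Tot F.stalk) := by
  have : Continuous fun t => (⟨(γ t).hom, a t⟩ : ActPair F.stalk) :=
    continuous_induced_rng.2 (hγ.prodMk h)
  exact F.continuous_act.comp this

/-- Two continuous sections which agree at a point agree near that point. -/
lemma eventually_eq_section {F : GSheaf X} {T : Type*} [TopologicalSpace T] {π : T → X}
    {a a' : ∀ t, F.stalk (π t)} (h : Continuous fun t => (⟨π t, a t⟩ : Tot F.stalk))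
    (h' : Continuous fun t => (⟨π t, a' t⟩ : Tot F.stalk)) {t : T} (he : a t = a' t) :
    ∀ᶠ t' in 𝓝 t, a t' = a' t' := by
  have := eventually_eq_of_eq F.isLocalHomeomorph h.continuousAt h'.continuousAt
    (by rw [he]) (Filter.Eventually.of_forall fun _ => rfl)
  filter_upwards [this] with t' h1
  exact eq_of_heq (Tot.mk.inj h1).2

end GSheaf

end

section

variable {X : Type u} [EtaleGroupoid X]

namespace SetSheaf

/-- The stalks `ℤ[Y(x)]` with the linear extension of the action. -/
def freeFunctor (Y : SetSheaf X) : X ⥤ AddCommGrpCat.{u} where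
  obj x := .of (FreeAbelianGroup (Y.stalk x))
  map γ := AddCommGrpCat.ofHom (FreeAbelianGroup.map (Y.act γ))
  map_id x := by
    ext e
    simp [Y.act_id]
  map_comp γ γ' := by
    ext e
    simp [Y.act_comp]

/-- The local sections `z ↦ ∑ᵢ nᵢ [σᵢ(z)]` of `ℤ[Y]` for finitely many continuous local sections
`σᵢ` of `Y`. -/
def freeSections (Y : SetSheaf X) : Set (LocSec fun x => FreeAbelianGroup (Y.stalk x)) :=
  {b | ∃ (ι : Type) (_ : Fintype ι) (n : ι → ℤ) (σ : ι → LocSec Y.stalk)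
    (h : ∀ x ∈ b.dom, ∀ i, x ∈ (σ i).dom), (∀ i, Continuous (σ i).map) ∧
      ∀ x hx, b.sec x hx = ∑ i, n i • FreeAbelianGroup.of ((σ i).sec x (h x hx i))}

lemma freeSections_cover (Y : SetSheaf X) : Cover Y.freeSections := by
  intro x e
  induction e using FreeAbelianGroup.induction_on with
  | zero =>
    exact ⟨⟨⊤, fun z _ => (0 : FreeAbelianGroup (Y.stalk z))⟩, ⟨Empty, inferInstance, Empty.elim, Empty.elim,
      fun _ _ i => i.elim, fun i => i.elim, fun z _ => by simp⟩, trivial, rfl⟩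
  | of e =>
    obtain ⟨b, hb, hx, rfl⟩ := exists_section Y.isLocalHomeomorph e
    exact ⟨⟨b.dom, fun z hz => FreeAbelianGroup.of (b.sec z hz)⟩, ⟨Unit, inferInstance,
      fun _ => 1, fun _ => b, fun _ h _ => h, fun _ => hb, fun z hz => by simp⟩, hx, rfl⟩
  | neg e h =>
    obtain ⟨b, ⟨ι, _, n, σ, h, hσ, hb⟩, hx, he⟩ := h
    refine ⟨⟨b.dom, fun z hz => -b.sec z hz⟩, ⟨ι, inferInstance, fun i => -n i, σ, h, hσ,
      fun z hz => ?_⟩, hx, congrArg Neg.neg he⟩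
    simp only [hb z hz]
    simp
  | add a a' h h' =>
    obtain ⟨b, ⟨ι, _, n, σ, h, hσ, hb⟩, hx, he⟩ := h
    obtain ⟨b', ⟨ι', _, n', σ', h', hσ', hb'⟩, hx', he'⟩ := h'
    refine ⟨⟨b.dom ⊓ b'.dom, fun z hz => b.sec z hz.1 + b'.sec z hz.2⟩, ⟨ι ⊕ ι', inferInstance,
      Sum.elim n n', Sum.elim σ σ', ?_, ?_, fun z hz => ?_⟩, ⟨hx, hx'⟩, congrArg₂ (· + ·) he he'⟩
    · rintro z hz (i | i)
      · exact h z hz.1 i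
      · exact h' z hz.2 i
    · rintro (i | i)
      · exact hσ i
      · exact hσ' i
    · simp only [hb z hz.1, hb' z hz.2, Fintype.sum_sum_type]
      rfl

lemma freeSections_zero (Y : SetSheaf X) (b : LocSec fun x => FreeAbelianGroup (Y.stalk x))
    (hbB : b ∈ Y.freeSections) (x : X) (hx : x ∈ b.dom)
    (h0 : b.sec x hx = 0) : ∀ᶠ z in 𝓝 x, ∀ h : z ∈ b.dom, b.sec z h = 0 := by
  classical
  obtain ⟨ι, _, n, σ, h, hσ, hb⟩ := hbB
  have hag : ∀ i j, ∀ᶠ z in 𝓝 x, ∀ hz : z ∈ b.dom,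
      (σ i).sec x (h x hx i) = (σ j).sec x (h x hx j) →
      (σ i).sec z (h z hz i) = (σ j).sec z (h z hz j) := by
    intro i j
    by_cases he : (σ i).sec x (h x hx i) = (σ j).sec x (h x hx j)
    · have hc : ∀ i, Continuous fun z : b.dom => (σ i).map ⟨z.1, h z.1 z.2 i⟩ := fun i =>
        (hσ i).comp (Continuous.subtype_mk continuous_subtype_val _)
      have := eventually_eq_of_eq Y.isLocalHomeomorph (z := ⟨x, hx⟩) (hc i).continuousAt
        (hc j).continuousAt (by simp only [LocSec.map, he]) (Filter.Eventually.of_forall fun _ => rfl)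
      rw [eventually_nhds_dom] at this
      filter_upwards [this] with z hz hzb _
      exact eq_of_heq (Tot.mk.inj (hz hzb)).2
    · exact Filter.Eventually.of_forall fun _ _ h => absurd h he
  have hall : ∀ᶠ z in 𝓝 x, ∀ i j, ∀ hz : z ∈ b.dom,
      (σ i).sec x (h x hx i) = (σ j).sec x (h x hx j) →
      (σ i).sec z (h z hz i) = (σ j).sec z (h z hz j) :=
    Filter.eventually_all.2 fun i => Filter.eventually_all.2 fun j => hag i j
  filter_upwards [hall] with z hz hzb
  let Θ : FreeAbelianGroup (Y.stalk x) →+ FreeAbelianGroup (Y.stalk z) :=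
    FreeAbelianGroup.lift fun e => if hh : ∃ i, (σ i).sec x (h x hx i) = e then
      FreeAbelianGroup.of ((σ hh.choose).sec z (h z hzb hh.choose)) else 0
  have hΘ : ∀ i, Θ (FreeAbelianGroup.of ((σ i).sec x (h x hx i))) =
      FreeAbelianGroup.of ((σ i).sec z (h z hzb i)) := by
    intro i
    have hh : ∃ j, (σ j).sec x (h x hx j) = (σ i).sec x (h x hx i) := ⟨i, rfl⟩
    simp only [Θ, FreeAbelianGroup.lift_apply_of]
    rw [dif_pos hh, hz _ _ hzb hh.choose_spec]
  have h1 := congrArg Θ ((hb x hx).symm.trans h0)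
  rw [map_sum] at h1
  simp only [map_zsmul, hΘ] at h1
  rw [hb z hzb, h1]
  exact map_zero Θ

lemma freeSections_sub (Y : SetSheaf X) (b : LocSec fun x => FreeAbelianGroup (Y.stalk x))
    (hbB : b ∈ Y.freeSections) (b' : LocSec fun x => FreeAbelianGroup (Y.stalk x))
    (hbB' : b' ∈ Y.freeSections) (x : X) (hx : x ∈ b.dom) (hx' : x ∈ b'.dom) :
    ∃ c ∈ Y.freeSections, x ∈ c.dom ∧
      ∀ᶠ z in 𝓝 x, ∀ (h : z ∈ b.dom) (h' : z ∈ b'.dom) (hc : z ∈ c.dom),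
        c.sec z hc = b.sec z h - b'.sec z h' := by
  obtain ⟨ι, _, n, σ, h, hσ, hb⟩ := hbB
  obtain ⟨ι', _, n', σ', h', hσ', hb'⟩ := hbB'
  refine ⟨⟨b.dom ⊓ b'.dom, fun z hz => b.sec z hz.1 - b'.sec z hz.2⟩, ⟨ι ⊕ ι', inferInstance,
    Sum.elim n (-n'), Sum.elim σ σ', ?_, ?_, fun z hz => ?_⟩, ⟨hx, hx'⟩,
    Filter.Eventually.of_forall fun z h h' hc => rfl⟩
  · rintro z hz (i | i)
    · exact h z hz.1 i
    · exact h' z hz.2 i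
  · rintro (i | i)
    · exact hσ i
    · exact hσ' i
  · simp only [hb z hz.1, hb' z hz.2, Fintype.sum_sum_type, sub_eq_add_neg,
      ← Finset.sum_neg_distrib, ← neg_zsmul]
    rfl

lemma freeSections_act (Y : SetSheaf X) (b : LocSec fun x => FreeAbelianGroup (Y.stalk x))
    (hbB : b ∈ Y.freeSections) (γ : Arr X)
    (hγ : γ.src ∈ b.dom) : ∃ c ∈ Y.freeSections, γ.tgt ∈ c.dom ∧
      ∀ᶠ γ' in 𝓝 γ, ∀ (h : γ'.src ∈ b.dom) (hc : γ'.tgt ∈ c.dom),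
        c.sec _ hc = FreeAbelianGroup.map (Y.act γ'.hom) (b.sec _ h) := by
  obtain ⟨ι, _, n, σ, h, hσ, hb⟩ := hbB
  choose τ hτ hτx hτe using fun i =>
    exists_section Y.isLocalHomeomorph (Y.act γ.hom ((σ i).sec γ.src (h _ hγ i)))
  let U : TopologicalSpace.Opens X := ⟨⋂ i, (τ i).dom, isOpen_iInter_of_finite fun i =>
    (τ i).dom.isOpen⟩
  have hU : ∀ z ∈ U, ∀ i, z ∈ (τ i).dom := fun z hz i => Set.mem_iInter.1 hz i
  refine ⟨⟨U, fun z hz => ∑ i, n i • FreeAbelianGroup.of ((τ i).sec z (hU z hz i))⟩,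
    ⟨ι, inferInstance, n, τ, hU, hτ, fun z hz => rfl⟩, Set.mem_iInter.2 hτx, ?_⟩
  have hag : ∀ i, ∀ᶠ γ' in 𝓝 γ, ∀ (h' : γ'.src ∈ b.dom) (hc : γ'.tgt ∈ (τ i).dom),
      (τ i).sec _ hc = Y.act γ'.hom ((σ i).sec _ (h _ h' i)) := by
    intro i
    let D := {γ' : Arr X // γ'.src ∈ b.dom ∧ γ'.tgt ∈ (τ i).dom}
    have h1 : Continuous fun g : D => (τ i).map ⟨g.1.tgt, g.2.2⟩ := (hτ i).comp
      (Continuous.subtype_mk (EtaleGroupoid.isLocalHomeomorph_tgt.continuous.comp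
        continuous_subtype_val) _)
    have h2 : Continuous fun g : D => (σ i).map ⟨g.1.src, h _ g.2.1 i⟩ := (hσ i).comp
      (Continuous.subtype_mk (EtaleGroupoid.isLocalHomeomorph_src.continuous.comp
        continuous_subtype_val) _)
    have h3 : Continuous fun g : D =>
        (⟨g.1.hom, (σ i).sec _ (h _ g.2.1 i)⟩ : ActPair Y.stalk) :=
      continuous_induced_rng.2 (continuous_subtype_val.prodMk h2)
    have := eventually_eq_of_eq Y.isLocalHomeomorph (z := (⟨γ, hγ, hτx i⟩ : D)) h1.continuousAt
      (Y.continuous_act.comp h3).continuousAt (by simp only [LocSec.map, hτe]; rfl)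
      (Filter.Eventually.of_forall fun _ => rfl)
    rw [nhds_subtype_eq_comap, Filter.eventually_comap] at this
    filter_upwards [this] with γ' h4 h5 h6
    exact eq_of_heq (Tot.mk.inj (h4 ⟨γ', h5, h6⟩ rfl)).2
  filter_upwards [Filter.eventually_all.2 hag] with γ' h1 h2 h3
  rw [hb _ h2, map_sum]
  refine Finset.sum_congr rfl fun i _ => ?_
  rw [map_zsmul, h1 i h2 (hU _ h3 i)]
  congr 1

/-- The sheaf of abelian groups `ℤ[Y]` of a sheaf of sets `Y`. -/
def free (Y : SetSheaf X) : GSheaf X :=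
  .ofSections Y.freeFunctor Y.freeSections Y.freeSections_cover Y.freeSections_zero
    Y.freeSections_sub Y.freeSections_act

lemma continuous_of (Y : SetSheaf X) :
    Continuous fun p : Tot Y.stalk => (⟨p.base, FreeAbelianGroup.of p.val⟩ : Tot Y.free.stalk) := by
  rw [continuous_iff_continuousAt]
  rintro ⟨x, e⟩
  obtain ⟨b, hb, hx, rfl⟩ := exists_section Y.isLocalHomeomorph e
  let c : LocSec Y.free.stalk := ⟨b.dom, fun z hz => FreeAbelianGroup.of (b.sec z hz)⟩
  have hc : Continuous c.map := secTop_continuous_map (B := Y.freeSections) ⟨Unit, inferInstance,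
      fun _ => 1, fun _ => b, fun _ h _ => h, fun _ => hb, fun z hz => by simp [c]⟩
  refine continuousAt_of_section hc hx Y.isLocalHomeomorph.continuous.continuousAt ?_
  filter_upwards [eventually_section Y.isLocalHomeomorph hb hx] with p ⟨h1, h2⟩ h3
  simp only [c, h2]
  rfl

/-- A family of homomorphisms out of the stalks of `ℤ[Y]` is continuous if it is on `Y`. -/
lemma continuous_free {Y : SetSheaf X} {F : GSheaf X}
    (η : ∀ x, FreeAbelianGroup (Y.stalk x) →+ F.stalk x)
    (h : Continuous fun p : Tot Y.stalk =>
      (⟨p.base, η p.base (FreeAbelianGroup.of p.val)⟩ : Tot F.stalk)) :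
    Continuous fun p : Tot Y.free.stalk => (⟨p.base, η p.base p.val⟩ : Tot F.stalk) := by
  refine (secTop_continuous_iff (B := Y.freeSections)).2 ?_
  rintro b ⟨ι, _, n, σ, hd, hσ, hb⟩
  have h1 : ∀ i, Continuous fun z : b.dom => (⟨z.1, η z.1 (FreeAbelianGroup.of
      ((σ i).sec z.1 (hd z.1 z.2 i)))⟩ : Tot F.stalk) := fun i =>
    h.comp ((hσ i).comp (Continuous.subtype_mk continuous_subtype_val _) :
      Continuous fun z : b.dom => (σ i).map ⟨z.1, hd z.1 z.2 i⟩)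
  have hz : ∀ i (m : ℤ), Continuous fun z : b.dom => (⟨z.1, m • η z.1 (FreeAbelianGroup.of
      ((σ i).sec z.1 (hd z.1 z.2 i)))⟩ : Tot F.stalk) := by
    intro i m
    induction m using Int.induction_on with
    | zero =>
      simp only [zero_zsmul]
      exact GSheaf.continuous_mk_zero (F := F) (continuous_subtype_val (p := fun x => x ∈ b.dom))
    | succ m ih =>
      simp only [add_zsmul, one_zsmul]
      exact GSheaf.continuous_mk_add ih (h1 i)
    | pred m ih =>
      have e : ∀ z : b.dom, (-(m : ℤ) - 1) • η z.1 (FreeAbelianGroup.of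
          ((σ i).sec z.1 (hd z.1 z.2 i))) = -(m : ℤ) • η z.1 (FreeAbelianGroup.of
          ((σ i).sec z.1 (hd z.1 z.2 i))) + -η z.1 (FreeAbelianGroup.of
          ((σ i).sec z.1 (hd z.1 z.2 i))) := fun z => by
        rw [sub_zsmul, one_zsmul]
      simp only [e]
      exact GSheaf.continuous_mk_add ih (GSheaf.continuous_mk_neg (h1 i))
  have hs : ∀ s : Finset ι, Continuous fun z : b.dom => (⟨z.1, ∑ i ∈ s, n i • η z.1
      (FreeAbelianGroup.of ((σ i).sec z.1 (hd z.1 z.2 i)))⟩ : Tot F.stalk) := by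
    classical
    intro s
    induction s using Finset.induction_on with
    | empty =>
      simp only [Finset.sum_empty]
      exact GSheaf.continuous_mk_zero (F := F) (continuous_subtype_val (p := fun x => x ∈ b.dom))
    | insert i s hi ih =>
      simp only [Finset.sum_insert hi]
      exact GSheaf.continuous_mk_add (hz i (n i)) ih
  refine (hs Finset.univ).congr fun z => ?_
  simp only [LocSec.map]
  congr 1
  rw [hb z.1 z.2]
  refine Eq.symm ((map_sum (η z.1) _ _).trans ?_)
  exact Finset.sum_congr rfl fun i _ => map_zsmul (η z.1) _ _

end SetSheaf

namespace GSheaf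

/-- The constant sheaf. -/
def const (X : Type u) [EtaleGroupoid X] (M : AddCommGrpCat.{u}) : GSheaf X :=
  .ofSections ((Functor.const X).obj M) {b | ∃ m : M, ∀ x hx, b.sec x hx = m}
    (fun x m => ⟨⟨⊤, fun _ _ => m⟩, ⟨m, fun _ _ => rfl⟩, trivial, rfl⟩)
    (by
      rintro b ⟨m, hm⟩ x hx h0
      have : m = 0 := (hm x hx).symm.trans h0
      exact Filter.Eventually.of_forall fun z hz => (hm z hz).trans this)
    (by
      rintro b ⟨m, hm⟩ b' ⟨m', hm'⟩ x hx hx'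
      refine ⟨⟨⊤, fun _ _ => m - m'⟩, ⟨m - m', fun _ _ => rfl⟩, trivial, ?_⟩
      refine Filter.Eventually.of_forall fun z h h' _ => ?_
      rw [hm z h, hm' z h'])
    (by
      rintro b ⟨m, hm⟩ γ hγ
      refine ⟨⟨⊤, fun _ _ => m⟩, ⟨m, fun _ _ => rfl⟩, trivial, ?_⟩
      refine Filter.Eventually.of_forall fun γ' h _ => ?_
      rw [hm _ h]
      rfl)

lemma continuous_const (M : AddCommGrpCat.{u}) (m : M) :
    Continuous fun x : X => (⟨x, m⟩ : Tot (const X M).stalk) := by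
  let b : LocSec (const X M).stalk := ⟨⊤, fun _ _ => m⟩
  have hb : Continuous b.map := secTop_continuous_map
    (B := {b | ∃ m : M, ∀ x hx, b.sec x hx = m}) ⟨m, fun _ _ => rfl⟩
  exact hb.comp (Continuous.subtype_mk continuous_id fun _ => trivial)

/-- The constant sheaf `ℤ`. -/
def constZ (X : Type u) [EtaleGroupoid X] : GSheaf X := const X (.of (ULift.{u} ℤ))

section Pushout

variable {Q A P : GSheaf X} (c : Q ⟶ A) (θ : Q ⟶ P)

/-- The subgroup `{(c(q), -θ(q))}` of a stalk of `A ⊕ P`. -/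
def pushoutRel (x : X) : AddSubgroup (A.stalk x × P.stalk x) :=
  ((app c x).prod (-app θ x)).range

/-- The stalks `(A ⊕ P) / {(c(q), -θ(q))}` with the diagonal action. -/
def pushoutFunctor : X ⥤ AddCommGrpCat.{u} where
  obj x := .of ((A.stalk x × P.stalk x) ⧸ pushoutRel c θ x)
  map {x y} γ := AddCommGrpCat.ofHom (QuotientAddGroup.map _ _
    ((A.act.map γ).hom.prodMap (P.act.map γ).hom) (by
      rintro _ ⟨q, rfl⟩
      refine ⟨Q.act.map γ q, ?_⟩
      exact Prod.ext (app_naturality c γ q)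
        ((congrArg Neg.neg (app_naturality θ γ q)).trans (map_neg (P.act.map γ).hom _).symm)))
  map_id x := by
    ext e
    simp
  map_comp γ γ' := by
    ext e
    simp
    rfl

/-- The local sections of the pushout represented by pairs of continuous local sections. -/
def pushoutSections : Set (LocSec fun x => (pushoutFunctor c θ).obj x) :=
  {b | ∃ (a : ∀ x ∈ b.dom, A.stalk x) (p : ∀ x ∈ b.dom, P.stalk x),
    (Continuous fun z : b.dom => (⟨z.1, a z.1 z.2⟩ : Tot A.stalk)) ∧
    (Continuous fun z : b.dom => (⟨z.1, p z.1 z.2⟩ : Tot P.stalk)) ∧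
    ∀ x hx, b.sec x hx = QuotientAddGroup.mk (a x hx, p x hx)}

lemma restrict_continuous {F : GSheaf X} {b : LocSec F.stalk} (hb : Continuous b.map)
    {U : TopologicalSpace.Opens X} (h : ∀ x ∈ U, x ∈ b.dom) :
    Continuous fun z : U => (⟨z.1, b.sec z.1 (h z.1 z.2)⟩ : Tot F.stalk) :=
  hb.comp (Continuous.subtype_mk continuous_subtype_val _ :
    Continuous fun z : U => (⟨z.1, h z.1 z.2⟩ : b.dom))

/-- The pushout `(A ⊕ P) / {(c(q), -θ(q))}` of `c : Q ⟶ A` and `θ : Q ⟶ P`. -/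
def pushout : GSheaf X :=
  .ofSections (pushoutFunctor c θ) (pushoutSections c θ)
    (by
      intro x e
      obtain ⟨⟨a, p⟩, rfl⟩ := QuotientAddGroup.mk_surjective e
      obtain ⟨b, hb, hx, rfl⟩ := exists_section (E := A.stalk) A.isLocalHomeomorph a
      obtain ⟨b', hb', hx', rfl⟩ := exists_section (E := P.stalk) P.isLocalHomeomorph p
      exact ⟨⟨b.dom ⊓ b'.dom, fun z hz => QuotientAddGroup.mk (b.sec z hz.1, b'.sec z hz.2)⟩,
        ⟨fun z hz => b.sec z hz.1, fun z hz => b'.sec z hz.2,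
        restrict_continuous (U := b.dom ⊓ b'.dom) hb fun _ h => h.1,
        restrict_continuous (U := b.dom ⊓ b'.dom) hb' fun _ h => h.2,
        fun _ _ => rfl⟩, ⟨hx, hx'⟩, rfl⟩)
    (by
      rintro b ⟨a, p, ha, hp, hb⟩ x hx h0
      rw [hb] at h0
      obtain ⟨q, hq⟩ := (QuotientAddGroup.eq_zero_iff _).1 h0
      obtain ⟨s, hs, hxs, rfl⟩ := exists_section (E := Q.stalk) Q.isLocalHomeomorph q
      let U := b.dom ⊓ s.dom
      have h1 := restrict_continuous hs (U := U) fun _ h => h.2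
      have h2 := (continuous_hom c).comp h1
      have h3 := continuous_mk_neg ((continuous_hom θ).comp h1)
      have h4 : Continuous fun z : U => (⟨z.1, a z.1 z.2.1⟩ : Tot A.stalk) :=
        restrict_continuous (F := A) (U := U) (b := ⟨b.dom, a⟩) ha fun _ h => h.1
      have h5 : Continuous fun z : U => (⟨z.1, p z.1 z.2.1⟩ : Tot P.stalk) :=
        restrict_continuous (F := P) (U := U) (b := ⟨b.dom, p⟩) hp fun _ h => h.1
      have e1 := eventually_eq_section h2 h4 (t := ⟨x, hx, hxs⟩) (congrArg Prod.fst hq)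
      have e2 := eventually_eq_section h3 h5 (t := ⟨x, hx, hxs⟩) (congrArg Prod.snd hq)
      have e1 := eventually_nhds_dom.1 e1
      have e2 := eventually_nhds_dom.1 e2
      filter_upwards [e1, e2, s.dom.isOpen.mem_nhds hxs] with z f1 f2 f3 hz
      rw [hb z hz]
      refine (QuotientAddGroup.eq_zero_iff _).2 ⟨s.sec z f3, ?_⟩
      exact Prod.ext (f1 ⟨hz, f3⟩) (f2 ⟨hz, f3⟩))
    (by
      rintro b ⟨a, p, ha, hp, hb⟩ b' ⟨a', p', ha', hp', hb'⟩ x hx hx'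
      have h4 : Continuous fun z : (b.dom ⊓ b'.dom : TopologicalSpace.Opens X) =>
          (⟨z.1, a z.1 z.2.1⟩ : Tot A.stalk) :=
        restrict_continuous (F := A) (U := b.dom ⊓ b'.dom) (b := ⟨b.dom, a⟩) ha fun _ h => h.1
      have h5 : Continuous fun z : (b.dom ⊓ b'.dom : TopologicalSpace.Opens X) =>
          (⟨z.1, p z.1 z.2.1⟩ : Tot P.stalk) :=
        restrict_continuous (F := P) (U := b.dom ⊓ b'.dom) (b := ⟨b.dom, p⟩) hp fun _ h => h.1
      have h4' : Continuous fun z : (b.dom ⊓ b'.dom : TopologicalSpace.Opens X) =>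
          (⟨z.1, a' z.1 z.2.2⟩ : Tot A.stalk) :=
        restrict_continuous (F := A) (U := b.dom ⊓ b'.dom) (b := ⟨b'.dom, a'⟩) ha' fun _ h => h.2
      have h5' : Continuous fun z : (b.dom ⊓ b'.dom : TopologicalSpace.Opens X) =>
          (⟨z.1, p' z.1 z.2.2⟩ : Tot P.stalk) :=
        restrict_continuous (F := P) (U := b.dom ⊓ b'.dom) (b := ⟨b'.dom, p'⟩) hp' fun _ h => h.2
      refine ⟨⟨b.dom ⊓ b'.dom, fun z hz => b.sec z hz.1 - b'.sec z hz.2⟩,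
        ⟨fun z hz => a z hz.1 + -a' z hz.2, fun z hz => p z hz.1 + -p' z hz.2,
        continuous_mk_add h4 (continuous_mk_neg h4'),
        continuous_mk_add h5 (continuous_mk_neg h5'), fun z hz => ?_⟩, ⟨hx, hx'⟩,
        Filter.Eventually.of_forall fun z h h' hc => rfl⟩
      simp only [hb z hz.1, hb' z hz.2, ← sub_eq_add_neg]
      rfl)
    (by
      rintro b ⟨a, p, ha, hp, hb⟩ γ hγ
      obtain ⟨s, hs, hxs, hse⟩ := exists_section (E := A.stalk) A.isLocalHomeomorph (A.act.map γ.hom (a _ hγ))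
      obtain ⟨t, ht, hxt, hte⟩ := exists_section (E := P.stalk) P.isLocalHomeomorph (P.act.map γ.hom (p _ hγ))
      refine ⟨⟨s.dom ⊓ t.dom, fun z hz => QuotientAddGroup.mk (s.sec z hz.1, t.sec z hz.2)⟩,
        ⟨fun z hz => s.sec z hz.1, fun z hz => t.sec z hz.2,
        restrict_continuous (U := s.dom ⊓ t.dom) hs fun _ h => h.1,
        restrict_continuous (U := s.dom ⊓ t.dom) ht fun _ h => h.2,
        fun _ _ => rfl⟩, ⟨hxs, hxt⟩, ?_⟩
      let D := {γ' : Arr X // γ'.src ∈ b.dom ∧ γ'.tgt ∈ s.dom ∧ γ'.tgt ∈ t.dom}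
      have hv : Continuous (Subtype.val : D → Arr X) := continuous_subtype_val
      have hsrc : Continuous fun g : D => (⟨g.1.src, g.2.1⟩ : b.dom) :=
        Continuous.subtype_mk (EtaleGroupoid.isLocalHomeomorph_src.continuous.comp hv) _
      have hts : Continuous fun g : D => (⟨g.1.tgt, g.2.2.1⟩ : s.dom) :=
        Continuous.subtype_mk (EtaleGroupoid.isLocalHomeomorph_tgt.continuous.comp hv) _
      have htt : Continuous fun g : D => (⟨g.1.tgt, g.2.2.2⟩ : t.dom) :=
        Continuous.subtype_mk (EtaleGroupoid.isLocalHomeomorph_tgt.continuous.comp hv) _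
      have e1 := eventually_eq_section (F := A) (t := (⟨γ, hγ, hxs, hxt⟩ : D)) (hs.comp hts)
        (continuous_mk_act hv (ha.comp hsrc)) hse
      have e2 := eventually_eq_section (F := P) (t := (⟨γ, hγ, hxs, hxt⟩ : D)) (ht.comp htt)
        (continuous_mk_act hv (hp.comp hsrc)) hte
      rw [nhds_subtype_eq_comap, Filter.eventually_comap] at e1 e2
      filter_upwards [e1, e2] with γ' f1 f2 h hc
      have g1 := f1 ⟨γ', h, hc.1, hc.2⟩ rfl
      have g2 := f2 ⟨γ', h, hc.1, hc.2⟩ rfl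
      simp only at g1 g2
      rw [hb _ h, g1, g2]
      rfl)

/-- The class `[a, p]` in a stalk of the pushout. -/
def pushoutMk (x : X) : A.stalk x × P.stalk x →+ (pushout c θ).stalk x :=
  QuotientAddGroup.mk' (pushoutRel c θ x)

lemma pushoutMk_surjective (x : X) : Function.Surjective (pushoutMk c θ x) :=
  QuotientAddGroup.mk_surjective

lemma pushoutMk_eq_zero {x : X} {e : A.stalk x × P.stalk x} :
    pushoutMk c θ x e = 0 ↔ ∃ q, app c x q = e.1 ∧ -app θ x q = e.2 := by
  refine (QuotientAddGroup.eq_zero_iff _).trans ?_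
  constructor
  · rintro ⟨q, rfl⟩
    exact ⟨q, rfl, rfl⟩
  · rintro ⟨q, h, h'⟩
    exact ⟨q, Prod.ext h h'⟩

lemma continuous_pushoutMk {T : Type*} [TopologicalSpace T] {π : T → X}
    {a : ∀ t, A.stalk (π t)} {p : ∀ t, P.stalk (π t)}
    (h : Continuous fun t => (⟨π t, a t⟩ : Tot A.stalk))
    (h' : Continuous fun t => (⟨π t, p t⟩ : Tot P.stalk)) :
    Continuous fun t => (⟨π t, pushoutMk c θ (π t) (a t, p t)⟩ : Tot (pushout c θ).stalk) := by
  rw [continuous_iff_continuousAt]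
  intro t
  obtain ⟨s, hs, hxs, hse⟩ := exists_section (E := A.stalk) A.isLocalHomeomorph (a t)
  obtain ⟨r, hr, hxr, hre⟩ := exists_section (E := P.stalk) P.isLocalHomeomorph (p t)
  let b : LocSec (pushout c θ).stalk :=
    ⟨s.dom ⊓ r.dom, fun z hz => pushoutMk c θ z (s.sec z hz.1, r.sec z hz.2)⟩
  have hb : Continuous b.map := secTop_continuous_map (B := pushoutSections c θ)
    ⟨fun z hz => s.sec z hz.1, fun z hz => r.sec z hz.2,
        restrict_continuous (U := s.dom ⊓ r.dom) hs fun _ h => h.1,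
        restrict_continuous (U := s.dom ⊓ r.dom) hr fun _ h => h.2,
        fun _ _ => rfl⟩
  refine continuousAt_of_section hb ⟨hxs, hxr⟩
    (A.continuous_base.comp h).continuousAt ?_
  have e1 := h.continuousAt.eventually (hse ▸ eventually_section A.isLocalHomeomorph hs hxs)
  have e2 := h'.continuousAt.eventually (hre ▸ eventually_section P.isLocalHomeomorph hr hxr)
  filter_upwards [e1, e2] with t' ⟨f1, f2⟩ ⟨f3, f4⟩ f5
  simp only [b]
  rw [f2, f4]

/-- The map `a ↦ [a, 0]`. -/
def pushoutInl : A ⟶ pushout c θ :=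
  mkHom { app := fun x => AddCommGrpCat.ofHom ((pushoutMk c θ x).comp (AddMonoidHom.inl _ _))
          naturality := fun x y γ => by
            ext a
            exact congrArg (pushoutMk c θ y) (Prod.ext rfl (map_zero (P.act.map γ).hom).symm) }
    (continuous_pushoutMk c θ (π := Tot.base) continuous_id
      (continuous_mk_zero (F := P) A.continuous_base))

/-- The map `p ↦ [0, p]`. -/
def pushoutInr : P ⟶ pushout c θ :=
  mkHom { app := fun x => AddCommGrpCat.ofHom ((pushoutMk c θ x).comp (AddMonoidHom.inr _ _))
          naturality := fun x y γ => by
            ext a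
            exact congrArg (pushoutMk c θ y) (Prod.ext (map_zero (A.act.map γ).hom).symm rfl) }
    (continuous_pushoutMk c θ (π := Tot.base) (continuous_mk_zero (F := A) P.continuous_base)
      continuous_id)

/-- The map `[a, p] ↦ f(a) + g(p)` out of the pushout. -/
def pushoutDesc {T : GSheaf X} (f : A ⟶ T) (g : P ⟶ T) (h : c ≫ f = θ ≫ g) :
    pushout c θ ⟶ T :=
  mkHom
    { app := fun x => AddCommGrpCat.ofHom (QuotientAddGroup.lift (pushoutRel c θ x)
        ((app f x).coprod (app g x)) (by
          rintro _ ⟨q, rfl⟩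
          have := congrArg (fun φ => app φ x q) h
          simp only [app_comp] at this
          simp [this]))
      naturality := fun x y γ => by
        ext e
        obtain ⟨⟨a, p⟩, rfl⟩ := QuotientAddGroup.mk_surjective e
        have h1 := app_naturality f γ a
        have h2 := app_naturality g γ p
        exact (congrArg₂ _ h1 h2).trans (map_add (T.act.map γ).hom _ _).symm }
    (by
      refine (secTop_continuous_iff (B := pushoutSections c θ)).2 ?_
      rintro b ⟨a, p, ha, hp, hb⟩
      have := continuous_mk_add ((continuous_hom f).comp ha) ((continuous_hom g).comp hp)
      refine this.congr fun z => ?_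
      simp only [LocSec.map, totMap, hb z.1 z.2]
      rfl)

@[simp] lemma pushoutDesc_mk {T : GSheaf X} (f : A ⟶ T) (g : P ⟶ T) (h : c ≫ f = θ ≫ g) (x : X)
    (a : A.stalk x) (p : P.stalk x) :
    app (pushoutDesc c θ f g h) x (pushoutMk c θ x (a, p)) = app f x a + app g x p := rfl

lemma pushout_condition : c ≫ pushoutInl c θ = θ ≫ pushoutInr c θ := by
  refine hom_ext fun x q => ?_
  refine sub_eq_zero.1 ?_
  refine (map_sub (pushoutMk c θ x) _ _).symm.trans ((pushoutMk_eq_zero c θ).2 ⟨q, ?_, ?_⟩)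
  · exact (sub_zero _).symm
  · exact (zero_sub _).symm

end Pushout

end GSheaf

end

/-! ### The bar complex of a small category -/

section

variable {C : Type u} [SmallCategory C]

/-- Composable tuples `(g₀, …, gₙ₋₁)`, `s(gᵢ) = r(gᵢ₊₁)`, with `r(g₀) = x`. -/
inductive Tup (C : Type u) [SmallCategory C] : ℕ → C → Type u
  | nil {x : C} : Tup C 0 x
  | cons {n : ℕ} {x y : C} (g : y ⟶ x) (t : Tup C n y) : Tup C (n + 1) x

/-- `γ · (g₀, g₁, …) = (γg₀, g₁, …)`. -/
def Tup.act {n : ℕ} {x y : C} (γ : x ⟶ y) : Tup C (n + 1) x → Tup C (n + 1) y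
  | .cons g t => .cons (g ≫ γ) t

/-- The `j`-th face of a tuple `(g₀, …, gₙ)`: for `j < n` it is `(g₀, …, gⱼgⱼ₊₁, …, gₙ)`, and
for `j = n` it is `(g₀, …, gₙ₋₁)`. -/
def face : (n : ℕ) → ℕ → {x : C} → Tup C (n + 1) x → Tup C n x
  | 0, _, _, _ => .nil
  | _ + 1, 0, _, .cons g (.cons h p) => .cons (h ≫ g) p
  | n + 1, j + 1, _, .cons g p => .cons g (face n j p)

lemma Tup.act_id {n : ℕ} {x : C} (t : Tup C (n + 1) x) : Tup.act (𝟙 x) t = t := by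
  cases t
  simp [Tup.act]

lemma Tup.act_comp {n : ℕ} {x y z : C} (γ : x ⟶ y) (γ' : y ⟶ z) (t : Tup C (n + 1) x) :
    Tup.act (γ ≫ γ') t = Tup.act γ' (Tup.act γ t) := by
  cases t
  simp [Tup.act]

lemma face_act (n j : ℕ) {x y : C} (γ : x ⟶ y) (t : Tup C (n + 2) x) :
    face (n + 1) j (Tup.act γ t) = Tup.act γ (face (n + 1) j t) := by
  rcases t with _ | ⟨g, _ | ⟨h, p⟩⟩
  cases j <;> simp [Tup.act, face]

variable (C) in
/-- The functor `x ↦ ℤ{(g₀, …, gₙ) : r(g₀) = x}`. -/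
def barObj (n : ℕ) : C ⥤ AddCommGrpCat.{u} where
  obj x := .of (FreeAbelianGroup (Tup C (n + 1) x))
  map γ := AddCommGrpCat.ofHom (FreeAbelianGroup.map (Tup.act γ))
  map_id x := by
    ext e
    simp [Tup.act_id]
  map_comp γ γ' := by
    ext e
    simp [Tup.act_comp]

/-- `∑ⱼ (-1)ʲ [j-th face]`. -/
def bdryFun (n : ℕ) (x : C) :
    FreeAbelianGroup (Tup C (n + 2) x) →+ FreeAbelianGroup (Tup C (n + 1) x) :=
  FreeAbelianGroup.lift fun t =>
    ∑ j ∈ Finset.range (n + 2), (-1 : ℤ) ^ j • FreeAbelianGroup.of (face (n + 1) j t)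

lemma bdryFun_of (n : ℕ) {x : C} (t : Tup C (n + 2) x) :
    bdryFun n x (.of t) = ∑ j ∈ Finset.range (n + 2), (-1 : ℤ) ^ j •
      FreeAbelianGroup.of (face (n + 1) j t) := FreeAbelianGroup.lift_apply_of _ _

lemma bdryFun_map (n : ℕ) {x y : C} (γ : x ⟶ y) (a : FreeAbelianGroup (Tup C (n + 2) x)) :
    bdryFun n y (FreeAbelianGroup.map (Tup.act γ) a) =
      FreeAbelianGroup.map (Tup.act γ) (bdryFun n x a) := by
  refine DFunLike.congr_fun (f := (bdryFun n y).comp (FreeAbelianGroup.map (Tup.act γ)))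
    (g := (FreeAbelianGroup.map (Tup.act γ)).comp (bdryFun n x)) ?_ a
  ext t
  simp [bdryFun_of, map_sum, face_act]

/-- `[t] ↦ 1`. -/
def augFun (x : C) : FreeAbelianGroup (Tup C 1 x) →+ ULift.{u} ℤ :=
  FreeAbelianGroup.lift fun _ => ⟨1⟩

lemma augFun_of {x : C} (t : Tup C 1 x) : augFun x (.of t) = ⟨1⟩ :=
  FreeAbelianGroup.lift_apply_of _ _

/-- The sequence `Z, R 0, R 1, …`. -/
def prev {D : Type*} (Z : D) (R : ℕ → D) : ℕ → D
  | 0 => Z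
  | n + 1 => R n

variable (C) in
/-- The boundary maps of the bar complex, with the augmentation in degree zero. -/
def barD : (n : ℕ) → (barObj C n ⟶
    prev ((Functor.const C).obj (AddCommGrpCat.of (ULift.{u} ℤ))) (barObj C) n)
  | 0 =>
    { app := fun x => AddCommGrpCat.ofHom (augFun x)
      naturality := fun x y γ => by
        refine AddCommGrpCat.hom_ext ?_
        change (augFun y).comp (FreeAbelianGroup.map (Tup.act γ)) = augFun x
        ext t
        simp [augFun_of] }
  | n + 1 =>
    { app := fun x => AddCommGrpCat.ofHom (bdryFun n x)
      naturality := fun x y γ => by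
        refine AddCommGrpCat.hom_ext (AddMonoidHom.ext fun a => bdryFun_map n γ a) }

/-- `t ↦ [(𝟙, t)]`. -/
def barH (n : ℕ) (x : C) : FreeAbelianGroup (Tup C n x) →+ FreeAbelianGroup (Tup C (n + 1) x) :=
  FreeAbelianGroup.map (Tup.cons (𝟙 x))

lemma bdryFun_barH (n : ℕ) {x : C} (a : FreeAbelianGroup (Tup C (n + 2) x)) :
    bdryFun (n + 1) x (barH _ x a) = a - barH _ x (bdryFun n x a) := by
  refine DFunLike.congr_fun (f := (bdryFun (n + 1) x).comp (barH (n + 2) x))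
    (g := .id _ - (barH (n + 1) x).comp (bdryFun n x)) ?_ a
  ext t
  rcases t with _ | ⟨g, p⟩
  simp [bdryFun_of, barH, map_sum, Finset.sum_range_succ' _ (n + 2), face, pow_succ,
    sub_eq_neg_add]

lemma bdryFun_barH_zero {x : C} (a : FreeAbelianGroup (Tup C 1 x)) :
    bdryFun 0 x (barH _ x a) = a - (augFun x a).down • .of (Tup.cons (𝟙 x) .nil) := by
  let e : ULift.{u} ℤ →+ FreeAbelianGroup (Tup C 1 x) :=
    (zmultiplesHom _ (FreeAbelianGroup.of (Tup.cons (𝟙 x) .nil))).comp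
      AddEquiv.ulift.toAddMonoidHom
  refine DFunLike.congr_fun (f := (bdryFun 0 x).comp (barH 1 x))
    (g := .id _ - e.comp (augFun x)) ?_ a
  ext t
  rcases t with _ | ⟨g, _ | _⟩
  simp [bdryFun_of, augFun_of, barH, Finset.sum_range_succ, face, e, sub_eq_add_neg]
  exact (one_zsmul _).symm

lemma bdryFun_ext {n : ℕ} {A : C → Type*} [∀ x, AddCommGroup (A x)]
    (f : ∀ x, FreeAbelianGroup (Tup C (n + 1) x) →+ A x)
    (hf : ∀ {x y : C} (γ : x ⟶ y) (a), f x a = 0 → f y (FreeAbelianGroup.map (Tup.act γ) a) = 0)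
    (h : ∀ x a, f x (barH n x a) = 0) (x : C) (a) : f x a = 0 := by
  refine DFunLike.congr_fun (g := (0 : _ →+ _)) ?_ a
  ext t
  rcases t with _ | ⟨g, p⟩
  have := hf g _ (h _ (.of p))
  simpa [barH, Tup.act] using this

lemma aug_bdryFun (x : C) (a) : augFun x (bdryFun 0 x a) = 0 := by
  refine DFunLike.congr_fun (f := (augFun x).comp (bdryFun 0 x)) (g := 0) ?_ a
  ext t
  simp [bdryFun_of, augFun_of, Finset.sum_range_succ]

lemma bdryFun_bdryFun : ∀ (n : ℕ) (x : C) (a), bdryFun n x (bdryFun (n + 1) x a) = 0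
  | 0 => bdryFun_ext (fun x => (bdryFun 0 x).comp (bdryFun 1 x))
      (fun γ a h => by
        simp only [AddMonoidHom.comp_apply, bdryFun_map] at h ⊢
        rw [h, map_zero]) (fun x a => by
        simp [bdryFun_barH, bdryFun_barH_zero, aug_bdryFun])
  | n + 1 => bdryFun_ext (fun x => (bdryFun (n + 1) x).comp (bdryFun (n + 2) x))
      (fun γ a h => by
        simp only [AddMonoidHom.comp_apply, bdryFun_map] at h ⊢
        rw [h, map_zero]) (fun x a => by
        simp [bdryFun_barH, bdryFun_bdryFun n])

lemma barD_exact : ∀ (n : ℕ) (x : C) (a : (barObj C n).obj x),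
    (barD C n).app x a = 0 ↔ ∃ b : (barObj C (n + 1)).obj x, (barD C (n + 1)).app x b = a
  | 0, x, a => by
    refine ⟨fun h => ⟨barH 1 x a, ?_⟩, fun ⟨b, hb⟩ => hb ▸ aug_bdryFun x b⟩
    refine (bdryFun_barH_zero (C := C) a).trans ?_
    have h' : augFun x a = 0 := h
    rw [h']
    exact (congrArg _ (zero_zsmul _)).trans (sub_zero _)
  | n + 1, x, a => by
    refine ⟨fun h => ⟨barH (n + 2) x a, ?_⟩, fun ⟨b, hb⟩ => hb ▸ bdryFun_bdryFun n x b⟩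
    refine (bdryFun_barH n a).trans ?_
    have h' : bdryFun n x a = 0 := h
    rw [h', map_zero]
    exact sub_zero _

lemma barD_zero_surjective (x : C) : Function.Surjective ((barD C 0).app x) := by
  intro m
  refine ⟨(m.down • FreeAbelianGroup.of (Tup.cons (𝟙 x) .nil) :
    FreeAbelianGroup (Tup C 1 x)), ?_⟩
  refine (map_zsmul (augFun x) _ _).trans ?_
  rw [augFun_of]
  exact ULift.ext _ _ (by simp)

end

/-! ### The resolution of the constant sheaf by spaces of composable tuples -/

section

variable {X : Type u} [EtaleGroupoid X]

lemma continuous_arr_comp {T : Type*} [TopologicalSpace T] {x y z : T → X}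
    {f : ∀ t, x t ⟶ y t} {g : ∀ t, y t ⟶ z t} (hf : Continuous fun t => (⟨f t⟩ : Arr X))
    (hg : Continuous fun t => (⟨g t⟩ : Arr X)) : Continuous fun t => (⟨f t ≫ g t⟩ : Arr X) := by
  let : TopologicalSpace (CompPair X) :=
    .induced (fun p => ((⟨p.fst⟩, ⟨p.snd⟩) : Arr X × Arr X)) inferInstance
  have : Continuous fun t => (⟨f t, g t⟩ : CompPair X) :=
    continuous_induced_rng.2 (hf.prodMk hg)
  exact EtaleGroupoid.continuous_comp.comp this

/-- The first entry of a tuple. -/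
def tupHead {n : ℕ} : Tot (Tup X (n + 1)) → Arr X
  | ⟨_, .cons g _⟩ => ⟨g⟩

/-- The remaining entries of a tuple. -/
def tupTail {n : ℕ} : Tot (Tup X (n + 1)) → Tot (Tup X n)
  | ⟨_, .cons _ p⟩ => ⟨_, p⟩

/-- The set of composable `n`-tuples has the topology of a subspace of `Gⁿ` (and, for `n = 0`,
that of the unit space). -/
instance tupTop : ∀ n : ℕ, TopologicalSpace (Tot (Tup X n))
  | 0 => .induced Tot.base inferInstance
  | n + 1 => @TopologicalSpace.induced _ _ (fun t => (tupHead t, tupTail t))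
      (@instTopologicalSpaceProd _ _ _ (tupTop n))

lemma continuous_tup_rng {n : ℕ} {T : Type*} [TopologicalSpace T] {f : T → Tot (Tup X (n + 1))}
    (h : Continuous fun t => tupHead (f t)) (h' : Continuous fun t => tupTail (f t)) :
    Continuous f :=
  continuous_induced_rng.2 (h.prodMk h')

lemma continuous_tup_pair {n : ℕ} :
    Continuous fun t : Tot (Tup X (n + 1)) => (tupHead t, tupTail t) :=
  continuous_induced_dom

lemma continuous_tupHead {n : ℕ} : Continuous (tupHead : Tot (Tup X (n + 1)) → Arr X) :=
  continuous_fst.comp continuous_tup_pair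

lemma continuous_tupTail {n : ℕ} :
    Continuous (tupTail : Tot (Tup X (n + 1)) → Tot (Tup X n)) :=
  continuous_snd.comp continuous_tup_pair

lemma tup_ext {n : ℕ} {t t' : Tot (Tup X (n + 1))} (h : tupHead t = tupHead t')
    (h' : tupTail t = tupTail t') : t = t' := by
  rcases t with ⟨x, _ | ⟨g, p⟩⟩
  rcases t' with ⟨x', _ | ⟨g', p'⟩⟩
  cases h
  cases h'
  rfl

lemma tupHead_src {n : ℕ} (t : Tot (Tup X (n + 1))) : (tupHead t).src = (tupTail t).base := by
  rcases t with ⟨x, _ | ⟨g, p⟩⟩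
  rfl

lemma tupHead_tgt {n : ℕ} (t : Tot (Tup X (n + 1))) : (tupHead t).tgt = t.base := by
  rcases t with ⟨x, _ | ⟨g, p⟩⟩
  rfl

lemma tup_isLocalHomeomorph : ∀ n : ℕ, IsLocalHomeomorph (Tot.base : Tot (Tup X n) → X)
  | 0 => by
    let e : Tot (Tup X 0) ≃ X :=
      ⟨Tot.base, fun x => ⟨x, .nil⟩, fun ⟨x, t⟩ => by cases t; rfl, fun _ => rfl⟩
    exact (e.toHomeomorphOfIsInducing ⟨rfl⟩).isLocalHomeomorph
  | n + 1 => by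
    have ih := tup_isLocalHomeomorph n
    have h : IsLocalHomeomorph (tupHead : Tot (Tup X (n + 1)) → Arr X) := by
      refine isLocalHomeomorph_of_open continuous_tupHead ?_ ?_
      · intro O hO
        rw [isOpen_iff_mem_nhds]
        rintro _ ⟨t, ht, rfl⟩
        have h1 := hO.mem_nhds ht
        rw [show 𝓝 t = _ from nhds_induced (T := instTopologicalSpaceProd)
          (fun t => (tupHead t, tupTail t)) t, Filter.mem_comap] at h1
        obtain ⟨S, hS, hSO⟩ := h1
        obtain ⟨V, hV, W, hW, hVW⟩ := mem_nhds_prod_iff.1 hS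
        have h2 : Tot.base '' W ∈ 𝓝 (tupHead t).src := by
          rw [tupHead_src]
          exact ih.isOpenMap.image_mem_nhds hW
        filter_upwards [hV, (EtaleGroupoid.isLocalHomeomorph_src (X := X)).continuous.continuousAt
          h2]
        rintro ⟨g⟩ hgV ⟨⟨x, p⟩, hpW, rfl⟩
        exact ⟨⟨_, .cons g p⟩, hSO (hVW ⟨hgV, hpW⟩), rfl⟩
      · intro t
        obtain ⟨U, hU, htU, hi⟩ := ih.isLocallyInjective (tupTail t)
        refine ⟨_, hU.preimage continuous_tupTail, htU, fun a ha b hb hab => ?_⟩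
        refine tup_ext hab (hi ha hb ?_)
        rw [← tupHead_src, ← tupHead_src, hab]
    have h2 := (EtaleGroupoid.isLocalHomeomorph_tgt (X := X)).comp h
    convert h2 using 1
    exact funext fun t => (tupHead_tgt t).symm

lemma continuous_face : ∀ n j : ℕ, Continuous fun t : Tot (Tup X (n + 1)) =>
    (⟨t.base, face n j t.val⟩ : Tot (Tup X n))
  | 0, _ => continuous_induced_rng.2 (tup_isLocalHomeomorph 1).continuous
  | n + 1, 0 => by
    refine continuous_tup_rng ?_ ?_
    · have h := EtaleGroupoid.continuous_comp (X := X)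
      let : TopologicalSpace (CompPair X) :=
        .induced (fun p => ((⟨p.fst⟩, ⟨p.snd⟩) : Arr X × Arr X)) inferInstance
      let f : Tot (Tup X (n + 2)) → CompPair X
        | ⟨_, .cons g (.cons h _)⟩ => ⟨h, g⟩
      have hf : Continuous f := by
        refine continuous_induced_rng.2 (((continuous_tupHead.comp continuous_tupTail).prodMk
          continuous_tupHead).congr ?_)
        rintro ⟨x, _ | ⟨g, _ | ⟨h, p⟩⟩⟩
        rfl
      refine (h.comp hf).congr ?_
      rintro ⟨x, _ | ⟨g, _ | ⟨h, p⟩⟩⟩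
      rfl
    · refine (continuous_tupTail.comp continuous_tupTail).congr ?_
      rintro ⟨x, _ | ⟨g, _ | ⟨h, p⟩⟩⟩
      rfl
  | n + 1, j + 1 => by
    refine continuous_tup_rng (continuous_tupHead.congr ?_)
      (((continuous_face n j).comp continuous_tupTail).congr ?_)
    · rintro ⟨x, _ | ⟨g, p⟩⟩
      rfl
    · rintro ⟨x, _ | ⟨g, p⟩⟩
      rfl

variable (X) in
/-- The sheaf of sets whose total space is the space of composable `(n+1)`-tuples
`(γ₀, …, γₙ)`, with projection `r(γ₀)` and action `γ · (γ₀, γ₁, …) = (γγ₀, γ₁, …)`. -/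
def tupSheaf (n : ℕ) : SetSheaf X where
  stalk := Tup X (n + 1)
  nonempty x := by
    induction n with
    | zero => exact ⟨.cons (𝟙 x) .nil⟩
    | succ n ih => exact ⟨.cons (𝟙 x) ih.some⟩
  act := Tup.act
  act_id := Tup.act_id
  act_comp := Tup.act_comp
  top := tupTop (n + 1)
  isLocalHomeomorph := tup_isLocalHomeomorph (n + 1)
  continuous_act := by
    have hi : Continuous fun p : ActPair (Tup X (n + 1)) =>
        (((⟨p.hom⟩, ⟨p.src, p.val⟩) : Arr X × Tot (Tup X (n + 1)))) :=
      continuous_induced_dom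
    refine continuous_tup_rng ?_ ?_
    · have h := EtaleGroupoid.continuous_comp (X := X)
      let : TopologicalSpace (CompPair X) :=
        .induced (fun p => ((⟨p.fst⟩, ⟨p.snd⟩) : Arr X × Arr X)) inferInstance
      let f : ActPair (Tup X (n + 1)) → CompPair X
        | ⟨γ, .cons g _⟩ => ⟨g, γ⟩
      have hf : Continuous f := by
        refine continuous_induced_rng.2 (((continuous_tupHead.comp
          (continuous_snd.comp hi)).prodMk (continuous_fst.comp hi)).congr ?_)
        rintro ⟨γ, _ | ⟨g, p⟩⟩
        rfl
      refine (h.comp hf).congr ?_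
      rintro ⟨γ, _ | ⟨g, p⟩⟩
      rfl
    · refine (continuous_tupTail.comp (continuous_snd.comp hi)).congr ?_
      rintro ⟨γ, _ | ⟨g, p⟩⟩
      rfl

variable (X) in
/-- The sheaf `ℤ[Y]` for the space `Y` of composable `(n+1)`-tuples. -/
def barSheaf (n : ℕ) : GSheaf X := (tupSheaf X n).free

/-- A homomorphism out of `barSheaf X n` given by its values on tuples. -/
def barHom {n : ℕ} {F : GSheaf X} (η : barObj X n ⟶ F.act)
    (h : Continuous fun p : Tot (Tup X (n + 1)) => (⟨p.base, (η.app p.base).hom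
      (FreeAbelianGroup.of p.val : FreeAbelianGroup (Tup X (n + 1) p.base))⟩ : Tot F.stalk)) :
    barSheaf X n ⟶ F :=
  GSheaf.mkHom (F := barSheaf X n) η
    (SetSheaf.continuous_free (Y := tupSheaf X n) (F := F) (fun x => (η.app x).hom) h)

lemma continuous_bar_of (n : ℕ) : Continuous fun p : Tot (Tup X (n + 1)) =>
    (⟨p.base, FreeAbelianGroup.of p.val⟩ : Tot (barSheaf X n).stalk) :=
  (tupSheaf X n).continuous_of

lemma GSheaf.continuous_mk_zsmul {F : GSheaf X} {T : Type*} [TopologicalSpace T] {π : T → X}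
    {a : ∀ t, F.stalk (π t)} (h : Continuous fun t => (⟨π t, a t⟩ : Tot F.stalk)) (m : ℤ) :
    Continuous fun t => (⟨π t, m • a t⟩ : Tot F.stalk) := by
  induction m using Int.induction_on with
  | zero =>
    simp only [zero_zsmul]
    exact continuous_mk_zero (F.continuous_base.comp h)
  | succ m ih =>
    simp only [add_zsmul, one_zsmul]
    exact continuous_mk_add ih h
  | pred m ih =>
    have e : ∀ t, (-(m : ℤ) - 1) • a t = -(m : ℤ) • a t + -a t := fun t => by
      rw [sub_zsmul, one_zsmul]
    simp only [e]
    exact continuous_mk_add ih (continuous_mk_neg h)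

lemma GSheaf.continuous_mk_sum {F : GSheaf X} {T : Type*} [TopologicalSpace T] {π : T → X}
    (hπ : Continuous π) {ι : Type*} (s : Finset ι) {a : ι → ∀ t, F.stalk (π t)}
    (h : ∀ i, Continuous fun t => (⟨π t, a i t⟩ : Tot F.stalk)) :
    Continuous fun t => (⟨π t, ∑ i ∈ s, a i t⟩ : Tot F.stalk) := by
  classical
  induction s using Finset.induction_on with
  | empty =>
    simp only [Finset.sum_empty]
    exact continuous_mk_zero (F := F) hπ
  | insert i s hi ih =>
    simp only [Finset.sum_insert hi]
    exact continuous_mk_add (h i) ih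

variable (X) in
/-- The boundary maps `∂[γ₀, …, γₙ] = ∑_{j<n} (-1)ʲ [γ₀, …, γⱼγⱼ₊₁, …, γₙ] + (-1)ⁿ [γ₀, …, γₙ₋₁]`
for `n ≥ 1`, and `∂[γ] = 1` for `n = 0`. -/
def barSheafD : (n : ℕ) → (barSheaf X n ⟶ prev (.constZ X) (barSheaf X) n)
  | 0 => barHom (F := .constZ X) (barD X 0) (by
      refine ((GSheaf.continuous_const (.of (ULift.{u} ℤ)) ⟨1⟩).comp
        (tup_isLocalHomeomorph 1).continuous).congr fun p => ?_
      exact congrArg (Tot.mk p.base) (augFun_of p.val).symm)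
  | n + 1 => barHom (F := barSheaf X n) (barD X (n + 1)) (by
      have h : ∀ j : ℕ, Continuous fun p : Tot (Tup X (n + 2)) => (⟨p.base, (-1 : ℤ) ^ j •
          FreeAbelianGroup.of (face (n + 1) j p.val)⟩ : Tot (barSheaf X n).stalk) := fun j =>
        GSheaf.continuous_mk_zsmul (F := barSheaf X n)
          ((continuous_bar_of n).comp (continuous_face (n + 1) j)) _
      refine (GSheaf.continuous_mk_sum (F := barSheaf X n)
        (tup_isLocalHomeomorph (n + 2)).continuous (Finset.range (n + 2)) h).congr fun p => ?_
      exact congrArg (Tot.mk p.base) (bdryFun_of n p.val).symm)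

end

/-! ### Higher-rank graphs, infinite paths and the path groupoid -/

/-- A `k`-graph: a countable small category with a degree functor to `ℕᵏ` having the unique
factorization property. -/
class KGraph (k : outParam ℕ) (Λ : Type u) [SmallCategory Λ] where
  countable_obj : Countable Λ
  countable_hom : ∀ v w : Λ, Countable (v ⟶ w)
  deg : ∀ {v w : Λ}, (v ⟶ w) → Fin k → ℕ
  deg_id : ∀ v : Λ, deg (𝟙 v) = 0
  deg_comp : ∀ {u v w : Λ} (ν : u ⟶ v) (μ : v ⟶ w), deg (ν ≫ μ) = deg μ + deg ν
  factor : ∀ {u w : Λ} (l : u ⟶ w) (m n : Fin k → ℕ), deg l = m + n →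
    ∃! p : Σ v : Λ, (u ⟶ v) × (v ⟶ w), p.2.1 ≫ p.2.2 = l ∧ deg p.2.2 = m ∧ deg p.2.1 = n

section

variable {k : ℕ} (Λ : Type u) [SmallCategory Λ] [KGraph k Λ]

open KGraph

/-- For every vertex `v` and every degree `m` there are finitely many paths of degree `m` with
range `v`. -/
def RowFinite : Prop :=
  ∀ (v : Λ) (m : Fin k → ℕ), {l : Σ u : Λ, u ⟶ v | deg l.2 = m}.Finite

/-- For every vertex `v` and every degree `m` there is a path of degree `m` with range `v`. -/
def NoSources : Prop :=
  ∀ (v : Λ) (m : Fin k → ℕ), {l : Σ u : Λ, u ⟶ v | deg l.2 = m}.Nonempty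

variable {Λ}

lemma arr_comp_congr {u v w u' v' w' : Λ} {h : u ⟶ w} {g : w ⟶ v} {h' : u' ⟶ w'} {g' : w' ⟶ v'}
    (e1 : (⟨h⟩ : Arr Λ) = ⟨h'⟩) (e2 : (⟨g⟩ : Arr Λ) = ⟨g'⟩) :
    (⟨h ≫ g⟩ : Arr Λ) = ⟨h' ≫ g'⟩ := by
  cases e1
  cases e2
  rfl

lemma arr_cancel {u v w u' v' w' : Λ} {h : u ⟶ w} {g : w ⟶ v} {h' : u' ⟶ w'} {g' : w' ⟶ v'}
    (e : (⟨h ≫ g⟩ : Arr Λ) = ⟨h' ≫ g'⟩) (hd : deg g = deg g') :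
    (⟨h⟩ : Arr Λ) = ⟨h'⟩ ∧ (⟨g⟩ : Arr Λ) = ⟨g'⟩ := by
  obtain ⟨rfl, rfl, e⟩ := Arr.mk.inj e
  have e := eq_of_heq e
  have h2 : deg h = deg h' := by
    have := congrArg deg e
    rw [deg_comp, deg_comp, hd] at this
    exact add_left_cancel this
  have := (factor (h ≫ g) _ _ (deg_comp h g)).unique (y₁ := ⟨w, h, g⟩) (y₂ := ⟨w', h', g'⟩)
    ⟨rfl, rfl, rfl⟩ ⟨e.symm, hd.symm, h2.symm⟩
  cases this
  exact ⟨rfl, rfl⟩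

lemma exists_split {u v : Λ} (f : u ⟶ v) {m : Fin k → ℕ} (h : m ≤ deg f) :
    ∃ (w : Λ) (b : u ⟶ w) (a : w ⟶ v), b ≫ a = f ∧ deg a = m ∧ deg b = deg f - m := by
  obtain ⟨⟨w, b, a⟩, hp, -⟩ := factor f m (deg f - m) (add_tsub_cancel_of_le h).symm
  exact ⟨w, b, a, hp⟩

lemma arr_cancel_hom {k : ℕ} {Λ : Type u} [SmallCategory Λ] [KGraph k Λ] {u w v : Λ} {h h' : u ⟶ w} {g : w ⟶ v} (e : h ≫ g = h' ≫ g) : h = h' := by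
  have := (arr_cancel (congrArg Arr.mk e) rfl).1
  cases this
  rfl

lemma arr_id_of_deg {u v : Λ} (f : u ⟶ v) (h : deg f = 0) : (⟨f⟩ : Arr Λ) = ⟨𝟙 v⟩ :=
  (arr_cancel (h := 𝟙 u) (g := f) (h' := f) (g' := 𝟙 v) (by simp)
    (by rw [h, deg_id])).2

variable (k Λ) in
/-- Infinite paths: degree-preserving functors `Ω_k → Λ`.  Here `x.obj m` is the vertex `x(m)`,
and `x.map h` is the path `x(m, n)`, with range `x(m)` and source `x(n)`. -/
structure InfPath : Type u where
  obj : (Fin k → ℕ) → Λ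
  map : ∀ {m n : Fin k → ℕ}, m ≤ n → (obj n ⟶ obj m)
  map_id : ∀ m, map (le_refl m) = 𝟙 (obj m)
  map_comp : ∀ {m n p : Fin k → ℕ} (h : m ≤ n) (h' : n ≤ p), map h' ≫ map h = map (h.trans h')
  deg_map : ∀ {m n : Fin k → ℕ} (h : m ≤ n), deg (map h) = n - m

namespace InfPath

lemma zero_le' (n : Fin k → ℕ) : 0 ≤ n := fun _ => Nat.zero_le _

/-- The arrow `x(m, n)`. -/
def seg (x : InfPath k Λ) {m n : Fin k → ℕ} (h : m ≤ n) : Arr Λ := ⟨x.map h⟩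

/-- The arrow `x(0, n)`. -/
def pre (x : InfPath k Λ) (n : Fin k → ℕ) : Arr Λ := x.seg (zero_le' n)

/-- `σᵖ(x)(m, n) = x(p + m, p + n)`. -/
def shift (p : Fin k → ℕ) (x : InfPath k Λ) : InfPath k Λ where
  obj m := x.obj (p + m)
  map h := x.map (add_le_add_right h p)
  map_id _ := x.map_id _
  map_comp _ _ := x.map_comp _ _
  deg_map _ := (x.deg_map _).trans (add_tsub_add_eq_tsub_left _ _ _)

lemma ext_seg {x y : InfPath k Λ}
    (h : ∀ (m n : Fin k → ℕ) (h : m ≤ n), x.seg h = y.seg h) : x = y := by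
  obtain ⟨xo, xm, _, _, _⟩ := x
  obtain ⟨yo, ym, _, _, _⟩ := y
  have ho : xo = yo := funext fun n => congrArg Arr.tgt (h n n le_rfl)
  subst ho
  have hm : @xm = @ym := by
    funext m n hmn
    exact eq_of_heq (Arr.mk.inj (h m n hmn)).2.2
  subst hm
  rfl

lemma seg_eq {x y : InfPath k Λ} {m n p m' n' p' : Fin k → ℕ} {h : m ≤ n} {h' : n ≤ p}
    {j : m' ≤ n'} {j' : n' ≤ p'} (hd : n - m = n' - m')
    (e : x.seg (h.trans h') = y.seg (j.trans j')) :
    x.seg h' = y.seg j' ∧ x.seg h = y.seg j := by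
  rw [seg, seg, ← x.map_comp h h', ← y.map_comp j j'] at e
  exact arr_cancel e (by rw [x.deg_map, y.deg_map, hd])

lemma seg_comp {x y : InfPath k Λ} {m n p m' n' p' : Fin k → ℕ} {h : m ≤ n} {h' : n ≤ p}
    {j : m' ≤ n'} {j' : n' ≤ p'} (e : x.seg h = y.seg j) (e' : x.seg h' = y.seg j') :
    x.seg (h.trans h') = y.seg (j.trans j') := by
  rw [seg, seg, ← x.map_comp h h', ← y.map_comp j j']
  exact arr_comp_congr e' e

lemma pre_mono {x y : InfPath k Λ} {m n : Fin k → ℕ} (h : m ≤ n) (e : x.pre n = y.pre n) :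
    x.pre m = y.pre m :=
  (seg_eq (h := zero_le' m) (h' := h) (j := zero_le' m) (j' := h) rfl e).2

lemma ext_pre {x y : InfPath k Λ} (h : ∀ n, x.pre n = y.pre n) : x = y :=
  ext_seg fun m n hmn =>
    (seg_eq (h := zero_le' m) (h' := hmn) (j := zero_le' m) (j' := hmn) rfl (h n)).1

/-- An infinite path is determined by an initial segment and the corresponding shift. -/
lemma ext_shift {x y : InfPath k Λ} {m : Fin k → ℕ} (h : x.pre m = y.pre m)
    (h' : shift m x = shift m y) : x = y := by
  refine ext_pre fun n => pre_mono (n := m + n) le_add_self ?_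
  have e : (shift m x).pre n = (shift m y).pre n := by rw [h']
  exact seg_comp (x := x) (y := y) (h := zero_le' m) (j := zero_le' m)
    (h' := le_self_add (a := m) (b := n)) (j' := le_self_add) h e

lemma shift_shift (p q : Fin k → ℕ) (x : InfPath k Λ) :
    shift q (shift p x) = shift (p + q) x := by
  refine ext_seg fun m n h => ?_
  have : ∀ (a b a' b' : Fin k → ℕ) (e : a = a') (e' : b = b') (h : a ≤ b) (h' : a' ≤ b'),
      x.seg h = x.seg h' := by
    rintro a b _ _ rfl rfl _ _
    rfl
  exact this _ _ _ _ (add_assoc _ _ _).symm (add_assoc _ _ _).symm _ _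

lemma shift_zero (x : InfPath k Λ) : shift 0 x = x := by
  refine ext_seg fun m n h => ?_
  have : ∀ (a b a' b' : Fin k → ℕ) (e : a = a') (e' : b = b') (h : a ≤ b) (h' : a' ≤ b'),
      x.seg h = x.seg h' := by
    rintro a b _ _ rfl rfl _ _
    rfl
  exact this _ _ _ _ (zero_add _) (zero_add _) _ _

lemma seg_shift {x y : InfPath k Λ} {p q m : Fin k → ℕ} (h : shift p x = shift q y) :
    x.seg (le_self_add (a := p) (b := m)) = y.seg (le_self_add (a := q) (b := m)) := by
  have : (shift p x).pre m = (shift q y).pre m := by rw [h]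
  exact this

/-- Build an infinite path from its initial segments. -/
lemma exists_of_pre {v : Λ} (w : (Fin k → ℕ) → Λ) (a : ∀ n, w n ⟶ v) (hd : ∀ n, deg (a n) = n)
    (h : ∀ m n, m ≤ n → ∃ c : w n ⟶ w m, c ≫ a m = a n) :
    ∃ x : InfPath k Λ, ∀ n, x.pre n = ⟨a n⟩ := by
  choose c hc using h
  let x : InfPath k Λ :=
    { obj := w
      map := fun {m n} h => c m n h
      map_id := fun m => arr_cancel_hom (g := a m) (by rw [hc, Category.id_comp])
      map_comp := fun {m n p} h h' => arr_cancel_hom (g := a m) (by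
        rw [Category.assoc, hc, hc, hc])
      deg_map := fun {m n} h => by
        have := congrArg deg (hc m n h)
        rw [deg_comp, hd, hd] at this
        exact eq_tsub_of_add_eq (by rw [add_comm, this]) }
  refine ⟨x, fun n => ?_⟩
  have h0 := arr_id_of_deg (a 0) (hd 0)
  have : (⟨c 0 n (zero_le' n) ≫ 𝟙 _⟩ : Arr Λ) = ⟨c 0 n (zero_le' n) ≫ a 0⟩ := by
    refine arr_comp_congr rfl ?_
    have hw : w 0 = v := congrArg Arr.src h0
    rw [h0]
    exact congrArg (fun z : Λ => (⟨𝟙 z⟩ : Arr Λ)) hw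
  rw [Category.comp_id, hc] at this
  exact this

lemma exists_concat {u v : Λ} (l : u ⟶ v) (y : InfPath k Λ) (hy : y.obj 0 = u) :
    ∃ z : InfPath k Λ, z.pre (deg l) = ⟨l⟩ ∧ shift (deg l) z = y := by
  subst hy
  have hs : ∀ n, ∃ (w : Λ) (b : y.obj n ⟶ w) (a : w ⟶ v),
      b ≫ a = y.map (zero_le' n) ≫ l ∧ deg a = n := by
    intro n
    obtain ⟨w, b, a, h, h', -⟩ := exists_split (y.map (zero_le' n) ≫ l) (m := n) (by
      rw [deg_comp, y.deg_map]
      exact le_add_of_le_right (by simp))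
    exact ⟨w, b, a, h, h'⟩
  choose w b a hab hd using hs
  obtain ⟨z, hz⟩ := exists_of_pre w a hd (by
    intro m n hmn
    obtain ⟨w', c, a', h, h', -⟩ := exists_split (a n) (m := m) (by rw [hd]; exact hmn)
    have e : (⟨(b n ≫ c) ≫ a'⟩ : Arr Λ) = ⟨(y.map hmn ≫ b m) ≫ a m⟩ := by
      rw [Category.assoc, Category.assoc, h, hab, hab, ← Category.assoc, y.map_comp]
    have := (arr_cancel e (by rw [h', hd])).2
    cases this
    exact ⟨c, h⟩)
  have key : ∀ n, z.pre (deg l + n) = ⟨y.map (zero_le' n) ≫ l⟩ := by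
    intro n
    rw [hz]
    refine (arr_cancel (h := b (deg l + n)) (h' := y.map (le_add_self (a := n) (b := deg l)))
      ?_ ?_).2
    · rw [hab, ← Category.assoc, y.map_comp]
    · rw [hd, deg_comp, y.deg_map, tsub_zero]
  refine ⟨z, ?_, ext_pre fun n => ?_⟩
  · refine (key 0).trans ?_
    rw [y.map_id, Category.id_comp]
  · have h0 : z.pre (deg l) = ⟨l⟩ := by
      refine (key 0).trans ?_
      rw [y.map_id, Category.id_comp]
    have h1 := key n
    have h2 : z.pre (deg l + n) = ⟨z.map (le_self_add (a := deg l) (b := n)) ≫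
        z.map (zero_le' (deg l))⟩ := by rw [z.map_comp]; rfl
    rw [h2] at h1
    exact (arr_cancel h1 (by rw [z.deg_map, tsub_zero])).1

/-- The infinite path `λy`. -/
def concat {u v : Λ} (l : u ⟶ v) (y : InfPath k Λ) (hy : y.obj 0 = u) : InfPath k Λ :=
  (exists_concat l y hy).choose

lemma pre_concat {u v : Λ} (l : u ⟶ v) (y : InfPath k Λ) (hy : y.obj 0 = u) :
    (concat l y hy).pre (deg l) = ⟨l⟩ := (exists_concat l y hy).choose_spec.1

lemma shift_concat {u v : Λ} (l : u ⟶ v) (y : InfPath k Λ) (hy : y.obj 0 = u) :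
    shift (deg l) (concat l y hy) = y := (exists_concat l y hy).choose_spec.2

lemma concat_obj_zero {u v : Λ} (l : u ⟶ v) (y : InfPath k Λ) (hy : y.obj 0 = u) :
    (concat l y hy).obj 0 = v := congrArg Arr.tgt (pre_concat l y hy)

/-- The set `Z(λ) = {x : x(0, d(λ)) = λ}`. -/
def cyl (l : Arr Λ) : Set (InfPath k Λ) := {x | x.pre (deg l.hom) = l}

instance : TopologicalSpace (InfPath k Λ) := .generateFrom (Set.range cyl)

lemma deg_pre (x : InfPath k Λ) (m : Fin k → ℕ) : deg (x.pre m).hom = m :=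
  (x.deg_map _).trans (tsub_zero _)

lemma mem_cyl_pre {x y : InfPath k Λ} {m : Fin k → ℕ} : y ∈ cyl (x.pre m) ↔ y.pre m = x.pre m := by
  change y.pre _ = _ ↔ _
  rw [deg_pre]

lemma isOpen_cyl (l : Arr Λ) : IsOpen (cyl l : Set (InfPath k Λ)) :=
  TopologicalSpace.isOpen_generateFrom_of_mem ⟨l, rfl⟩

lemma isOpen_iff {O : Set (InfPath k Λ)} :
    IsOpen O ↔ ∀ x ∈ O, ∃ m, ∀ y : InfPath k Λ, y.pre m = x.pre m → y ∈ O := by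
  refine ⟨fun h => ?_, fun h => ?_⟩
  · induction h with
    | basic s hs =>
      obtain ⟨l, rfl⟩ := hs
      exact fun x hx => ⟨deg l.hom, fun y hy => hy.trans hx⟩
    | univ => exact fun _ _ => ⟨0, fun _ _ => trivial⟩
    | inter s t _ _ hs ht =>
      rintro x ⟨hxs, hxt⟩
      obtain ⟨m, hm⟩ := hs x hxs
      obtain ⟨n, hn⟩ := ht x hxt
      exact ⟨m ⊔ n, fun y hy => ⟨hm y (pre_mono le_sup_left hy), hn y (pre_mono le_sup_right hy)⟩⟩
    | sUnion S _ hS =>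
      rintro x ⟨s, hs, hx⟩
      obtain ⟨m, hm⟩ := hS s hs x hx
      exact ⟨m, fun y hy => ⟨s, hs, hm y hy⟩⟩
  · rw [isOpen_iff_mem_nhds]
    intro x hx
    obtain ⟨m, hm⟩ := h x hx
    exact Filter.mem_of_superset ((isOpen_cyl (x.pre m)).mem_nhds (mem_cyl_pre.2 rfl))
      fun y hy => hm y (mem_cyl_pre.1 hy)

end InfPath

end

section

variable {k : ℕ} {Λ : Type u} [SmallCategory Λ] [KGraph k Λ]

open KGraph InfPath

/-- The elements `(x, n, y)` of the path groupoid with given `y` (the source) and `x` (the range):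
integer vectors `n = j - ℓ` with `σʲ(x) = σˡ(y)`. -/
structure GHom (y x : InfPath k Λ) : Type u where
  lag : Fin k → ℤ
  exists_shift : ∃ j l : Fin k → ℕ, (lag = fun i => (j i : ℤ) - l i) ∧ shift j x = shift l y

namespace GHom

/-- `n = j - ℓ` and `σʲ(x) = σˡ(y)`. -/
def IsPair {y x : InfPath k Λ} (g : GHom y x) (j l : Fin k → ℕ) : Prop :=
  (g.lag = fun i => (j i : ℤ) - l i) ∧ shift j x = shift l y

lemma ext' {y x : InfPath k Λ} {g h : GHom y x} (e : g.lag = h.lag) : g = h := by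
  cases g
  cases h
  cases e
  rfl

lemma IsPair.add {y x : InfPath k Λ} {g : GHom y x} {j l : Fin k → ℕ} (h : g.IsPair j l)
    (m : Fin k → ℕ) : g.IsPair (j + m) (l + m) := by
  refine ⟨h.1.trans (funext fun i => ?_), ?_⟩
  · simp
  · rw [← shift_shift, ← shift_shift, h.2]

/-- `(x, n, y)(y, m, z) = (x, n + m, z)`. -/
def comp {z y x : InfPath k Λ} (f : GHom z y) (g : GHom y x) : GHom z x where
  lag := g.lag + f.lag
  exists_shift := by
    obtain ⟨j, q, h⟩ := g.exists_shift
    obtain ⟨q', r, h'⟩ := f.exists_shift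
    refine ⟨j + q', r + q, ?_, ?_⟩
    · rw [h.1, h'.1]
      funext i
      simp
      ring
    · rw [← shift_shift, h.2, shift_shift, add_comm q, ← shift_shift, h'.2, shift_shift]

instance : Groupoid.{u} (InfPath k Λ) where
  Hom := GHom
  id x := ⟨0, 0, 0, by funext; simp, rfl⟩
  comp := comp
  id_comp f := ext' (add_zero f.lag)
  comp_id f := ext' (zero_add f.lag)
  assoc f g h := ext' (add_assoc h.lag g.lag f.lag).symm
  inv {y x} f := ⟨-f.lag, by
    obtain ⟨j, l, h, h'⟩ := f.exists_shift
    exact ⟨l, j, by rw [h]; funext; simp, h'.symm⟩⟩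
  inv_comp f := ext' (add_neg_cancel f.lag)
  comp_inv f := ext' (neg_add_cancel f.lag)

lemma isPair_comp {z y x : InfPath k Λ} {f : z ⟶ y} {g : y ⟶ x} {j q r : Fin k → ℕ}
    (hg : GHom.IsPair g j q) (hf : GHom.IsPair f q r) : GHom.IsPair (f ≫ g) j r := by
  refine ⟨?_, hg.2.trans hf.2⟩
  change g.lag + f.lag = _
  rw [hg.1, hf.1]
  funext i
  simp

lemma isPair_inv {y x : InfPath k Λ} {g : y ⟶ x} {j q : Fin k → ℕ}
    (hg : GHom.IsPair g j q) : GHom.IsPair (Groupoid.inv g) q j := by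
  refine ⟨?_, hg.2.symm⟩
  change -g.lag = _
  rw [hg.1]
  funext i
  simp

lemma inv_inv_hom {y x : InfPath k Λ} (g : y ⟶ x) : Groupoid.inv (Groupoid.inv g) = g :=
  ext' (neg_neg g.lag)

lemma exists_isPair {y x : InfPath k Λ} (g : y ⟶ x) : ∃ j l, GHom.IsPair g j l := g.exists_shift

/-- The set `Z(λ, μ)` of all `(λz, d(λ) - d(μ), μz)`. -/
def cyl (l m : Arr Λ) : Set (Arr (InfPath k Λ)) :=
  {g | g.hom.IsPair (deg l.hom) (deg m.hom) ∧ g.tgt.pre (deg l.hom) = l ∧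
    g.src.pre (deg m.hom) = m}

/-- The topology generated by the sets `Z(λ, μ)` with `s(λ) = s(μ)`. -/
instance topArr : TopologicalSpace (Arr (InfPath k Λ)) :=
  .generateFrom {S | ∃ l m : Arr Λ, l.src = m.src ∧ S = cyl l m}

/-- `Z(x(0, j), y(0, ℓ))` for `g = (x, n, y)`. -/
def nb (j l : Fin k → ℕ) (g : Arr (InfPath k Λ)) : Set (Arr (InfPath k Λ)) :=
  {g' | g'.hom.IsPair j l ∧ g'.tgt.pre j = g.tgt.pre j ∧ g'.src.pre l = g.src.pre l}

lemma nb_eq (j l : Fin k → ℕ) (g : Arr (InfPath k Λ)) :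
    nb j l g = cyl (g.tgt.pre j) (g.src.pre l) := by
  unfold nb cyl
  rw [deg_pre, deg_pre]

lemma nb_mem_nhds {j l : Fin k → ℕ} {g : Arr (InfPath k Λ)} (h : g.hom.IsPair j l) :
    nb j l g ∈ 𝓝 g := by
  refine IsOpen.mem_nhds (TopologicalSpace.isOpen_generateFrom_of_mem
    ⟨_, _, ?_, nb_eq j l g⟩) ⟨h, rfl, rfl⟩
  exact congrArg (fun x : InfPath k Λ => x.obj 0) h.2

lemma nb_anti {j l : Fin k → ℕ} {g : Arr (InfPath k Λ)} (h : g.hom.IsPair j l) (m : Fin k → ℕ) :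
    nb (j + m) (l + m) g ⊆ nb j l g := by
  rintro g' ⟨h1, h2, h3⟩
  refine ⟨⟨h1.1.trans (funext fun i => by simp), ?_⟩, pre_mono le_self_add h2,
    pre_mono le_self_add h3⟩
  refine ext_shift (m := m) ?_ (by rw [shift_shift, shift_shift, h1.2])
  have e1 := (seg_eq (h := zero_le' j) (h' := le_self_add (b := m)) (j := zero_le' j)
    (j' := le_self_add) rfl h2).1
  have e2 := (seg_eq (h := zero_le' l) (h' := le_self_add (b := m)) (j := zero_le' l)
    (j' := le_self_add) rfl h3).1
  exact e1.trans ((seg_shift h.2).trans e2.symm)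

lemma nb_common {j l j' l' : Fin k → ℕ} {g : Arr (InfPath k Λ)} (h : g.hom.IsPair j l)
    (h' : g.hom.IsPair j' l') : nb (j + j') (l + j') g ⊆ nb j' l' g := by
  have : l + j' = l' + j := by
    have := h.1.symm.trans h'.1
    funext i
    have := congrFun this i
    simp only [Pi.add_apply] at this ⊢
    omega
  rw [this, add_comm]
  exact nb_anti h' j

lemma isOpen_iff {O : Set (Arr (InfPath k Λ))} :
    IsOpen O ↔ ∀ g ∈ O, ∃ j l, g.hom.IsPair j l ∧ nb j l g ⊆ O := by
  refine ⟨fun h => ?_, fun h => ?_⟩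
  · induction h with
    | basic s hs =>
      obtain ⟨l, m, -, rfl⟩ := hs
      refine fun g hg => ⟨_, _, hg.1, fun g' hg' => ⟨hg'.1, hg'.2.1.trans hg.2.1,
        hg'.2.2.trans hg.2.2⟩⟩
    | univ =>
      intro g _
      obtain ⟨j, l, h⟩ := exists_isPair g.hom
      exact ⟨j, l, h, fun _ _ => trivial⟩
    | inter s t _ _ hs ht =>
      rintro g ⟨hgs, hgt⟩
      obtain ⟨j, l, h1, h2⟩ := hs g hgs
      obtain ⟨j', l', h1', h2'⟩ := ht g hgt
      exact ⟨_, _, h1.add j', fun g' hg' => ⟨h2 (nb_anti h1 _ hg'), h2' (nb_common h1 h1' hg')⟩⟩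
    | sUnion S _ hS =>
      rintro x ⟨s, hs, hx⟩
      obtain ⟨j, l, h1, h2⟩ := hS s hs x hx
      exact ⟨j, l, h1, fun y hy => ⟨s, hs, h2 hy⟩⟩
  · rw [isOpen_iff_mem_nhds]
    intro x hx
    obtain ⟨j, l, h1, h2⟩ := h x hx
    exact Filter.mem_of_superset (nb_mem_nhds h1) h2

lemma exists_nb {O : Set (Arr (InfPath k Λ))} {g : Arr (InfPath k Λ)} (hO : O ∈ 𝓝 g)
    {j l : Fin k → ℕ} (h : g.hom.IsPair j l) : ∃ m, nb (j + m) (l + m) g ⊆ O := by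
  obtain ⟨U, hU, hUo, hg⟩ := mem_nhds_iff.1 hO
  obtain ⟨j', l', h1, h2⟩ := isOpen_iff.1 hUo g hg
  exact ⟨j', (nb_common h h1).trans (h2.trans hU)⟩

lemma continuous_inv :
    Continuous fun g : Arr (InfPath k Λ) => (⟨Groupoid.inv g.hom⟩ : Arr (InfPath k Λ)) := by
  refine ⟨fun O hO => isOpen_iff.2 fun g hg => ?_⟩
  obtain ⟨j, l, h1, h2⟩ := isOpen_iff.1 hO _ hg
  have h1' := isPair_inv h1
  refine ⟨l, j, ?_, fun g' hg' => h2 ⟨isPair_inv hg'.1, hg'.2.2, hg'.2.1⟩⟩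
  rwa [inv_inv_hom] at h1'

lemma isLocalHomeomorph_tgt :
    IsLocalHomeomorph (Arr.tgt : Arr (InfPath k Λ) → InfPath k Λ) := by
  refine isLocalHomeomorph_of_open ?_ ?_ ?_
  · refine ⟨fun O hO => isOpen_iff.2 fun g hg => ?_⟩
    obtain ⟨m, hm⟩ := InfPath.isOpen_iff.1 hO _ hg
    obtain ⟨j, l, h⟩ := exists_isPair g.hom
    exact ⟨_, _, h.add m, fun g' hg' => hm _ (pre_mono le_add_self hg'.2.1)⟩
  · refine fun O hO => InfPath.isOpen_iff.2 ?_
    rintro _ ⟨g, hg, rfl⟩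
    obtain ⟨j, l, h1, h2⟩ := isOpen_iff.1 hO _ hg
    refine ⟨j, fun x hx => ?_⟩
    have hs : (shift j x).obj 0 = g.src.obj l := by
      refine (congrArg Arr.src hx).trans ?_
      exact congrArg (fun x : InfPath k Λ => x.obj 0) h1.2
    let y := concat (g.src.map (zero_le' l)) (shift j x) hs
    have hd : deg (g.src.map (zero_le' l)) = l := deg_pre g.src l
    have hy : y.pre l = g.src.pre l := by
      have := pre_concat (g.src.map (zero_le' l)) (shift j x) hs
      rw [hd] at this
      exact this
    have hy' : shift l y = shift j x := by
      have := shift_concat (g.src.map (zero_le' l)) (shift j x) hs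
      rw [hd] at this
      exact this
    let g' : y ⟶ x := ⟨fun i => (j i : ℤ) - l i, j, l, rfl, hy'.symm⟩
    exact ⟨⟨g'⟩, h2 ⟨⟨rfl, hy'.symm⟩, hx, hy⟩, rfl⟩
  · intro g
    obtain ⟨j, l, h⟩ := exists_isPair g.hom
    obtain ⟨U, hU, hUo, hg⟩ := mem_nhds_iff.1 (nb_mem_nhds h)
    refine ⟨U, hUo, hg, ?_⟩
    rintro ⟨g1⟩ h1 ⟨g2⟩ h2 (rfl : _ = _)
    obtain ⟨h1, h1', h1''⟩ := hU h1
    obtain ⟨h2, h2', h2''⟩ := hU h2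
    have := ext_shift (h1''.trans h2''.symm) (h1.2.symm.trans h2.2)
    dsimp only at this
    subst this
    have : g1 = g2 := ext' (h1.1.trans h2.1.symm)
    rw [this]

lemma isLocalHomeomorph_src :
    IsLocalHomeomorph (Arr.src : Arr (InfPath k Λ) → InfPath k Λ) := by
  let e : Arr (InfPath k Λ) ≃ₜ Arr (InfPath k Λ) :=
    { toFun := fun g => ⟨Groupoid.inv g.hom⟩
      invFun := fun g => ⟨Groupoid.inv g.hom⟩
      left_inv := fun g => congrArg Arr.mk (inv_inv_hom g.hom)
      right_inv := fun g => congrArg Arr.mk (inv_inv_hom g.hom)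
      continuous_toFun := continuous_inv
      continuous_invFun := continuous_inv }
  exact isLocalHomeomorph_tgt.comp e.isLocalHomeomorph

end GHom

instance : EtaleGroupoid (InfPath k Λ) where
  __ := (inferInstance : TopologicalSpace (InfPath k Λ))
  arrTop := GHom.topArr
  isLocalHomeomorph_src := GHom.isLocalHomeomorph_src
  isLocalHomeomorph_tgt := GHom.isLocalHomeomorph_tgt
  continuous_inv := GHom.continuous_inv
  continuous_comp := by
    let : TopologicalSpace (CompPair (InfPath k Λ)) := .induced (fun p => ((⟨p.fst⟩, ⟨p.snd⟩) :
      Arr (InfPath k Λ) × Arr (InfPath k Λ))) inferInstance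
    rw [continuous_iff_continuousAt]
    rintro ⟨f, g⟩
    obtain ⟨j, q, hg⟩ := GHom.exists_isPair g
    obtain ⟨q', r, hf⟩ := GHom.exists_isPair f
    have hg := hg.add q'
    have hf := hf.add q
    rw [add_comm q' q] at hf
    intro O hO
    obtain ⟨m, hm⟩ := GHom.exists_nb hO (GHom.isPair_comp hg hf)
    rw [Filter.mem_map, nhds_induced, Filter.mem_comap]
    refine ⟨_, prod_mem_nhds (GHom.nb_mem_nhds (g := ⟨f⟩) (hf.add m))
      (GHom.nb_mem_nhds (g := ⟨g⟩) (hg.add m)), ?_⟩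
    rintro ⟨f', g'⟩ ⟨hf', hg'⟩
    exact hm ⟨GHom.isPair_comp hg'.1 hf'.1, hg'.2.1, hf'.2.2⟩

end

/-! ### The sheaf of a module -/

section

variable {k : ℕ} {Λ : Type u} [SmallCategory Λ] [KGraph k Λ]

open KGraph InfPath

/-- The homomorphisms `A(x(p, q)) : A_{x(p)} → A_{x(q)}`. -/
def uSys (A : Λᵒᵖ ⥤ AddCommGrpCat.{u}) (x : InfPath k Λ) (p q : Fin k → ℕ) (h : p ≤ q) :
    A.obj (op (x.obj p)) →+ A.obj (op (x.obj q)) := (A.map (x.map h).op).hom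

instance (A : Λᵒᵖ ⥤ AddCommGrpCat.{u}) (x : InfPath k Λ) :
    DirectedSystem (fun p => (A.obj (op (x.obj p)) : Type u)) fun p q h => uSys A x p q h where
  map_self p a := by
    simp [uSys, x.map_id]
  map_map p q r h h' a := by
    simp only [uSys]
    rw [← x.map_comp h h', op_comp, A.map_comp]
    rfl

/-- The stalk `lim A_{x(p)}` (direct limit). -/
def uStalk (A : Λᵒᵖ ⥤ AddCommGrpCat.{u}) (x : InfPath k Λ) : Type u :=
  AddCommGroup.DirectLimit (fun p => (A.obj (op (x.obj p)) : Type u)) (uSys A x)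

instance (A : Λᵒᵖ ⥤ AddCommGrpCat.{u}) (x : InfPath k Λ) : AddCommGroup (uStalk A x) :=
  inferInstanceAs (AddCommGroup (AddCommGroup.DirectLimit _ (uSys A x)))

/-- The natural map `φˣ_p : A_v → lim A_{x(q)}` for `v = x(p)`. -/
def germ (A : Λᵒᵖ ⥤ AddCommGrpCat.{u}) (x : InfPath k Λ) (p : Fin k → ℕ) {v : Λ}
    (h : x.obj p = v) : A.obj (op v) →+ uStalk A x :=
  match v, h with
  | _, rfl => AddCommGroup.DirectLimit.of _ (uSys A x) p

section

variable {A : Λᵒᵖ ⥤ AddCommGrpCat.{u}} {x y : InfPath k Λ}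

lemma germ_map {p q : Fin k → ℕ} (hpq : p ≤ q) {v w : Λ} (h : x.obj p = v) (h' : x.obj q = w)
    (l : w ⟶ v) (hl : (⟨l⟩ : Arr Λ) = x.seg hpq) (a : A.obj (op v)) :
    germ A x q h' (A.map l.op a) = germ A x p h a := by
  subst h
  subst h'
  obtain rfl : l = x.map hpq := eq_of_heq (Arr.mk.inj hl).2.2
  exact AddCommGroup.DirectLimit.of_f (f := uSys A x) hpq a

lemma germ_map' {p q : Fin k → ℕ} (hpq : p ≤ q) (a : A.obj (op (x.obj p))) :
    germ A x q rfl (A.map (x.map hpq).op a) = germ A x p rfl a :=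
  germ_map hpq rfl rfl _ rfl a

lemma germ_cast {p : Fin k → ℕ} {v w : Λ} (h : x.obj p = w) (e : v = w) (a : A.obj (op v)) :
    germ A x p h (e ▸ a) = germ A x p (h.trans e.symm) a := by
  subst e
  rfl

lemma germ_congr {p q : Fin k → ℕ} (e : p = q) {v : Λ} (h : x.obj p = v) (h' : x.obj q = v)
    (a : A.obj (op v)) : germ A x p h a = germ A x q h' a := by
  subst e
  rfl

lemma germ_surjective (e : uStalk A x) : ∃ p a, germ A x p rfl a = e := by
  induction e using AddCommGroup.DirectLimit.induction_on with
  | ih p a => exact ⟨p, a, rfl⟩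

lemma germ_surjective_ge (e : uStalk A x) (r : Fin k → ℕ) :
    ∃ p, r ≤ p ∧ ∃ a, germ A x p rfl a = e := by
  obtain ⟨p, a, rfl⟩ := germ_surjective e
  exact ⟨p ⊔ r, le_sup_right, _, germ_map' le_sup_left a⟩

lemma germ_eq_zero {p : Fin k → ℕ} {a : A.obj (op (x.obj p))} (h : germ A x p rfl a = 0) :
    ∃ (q : Fin k → ℕ) (hq : p ≤ q), A.map (x.map hq).op a = 0 :=
  AddCommGroup.DirectLimit.of.zero_exact (f := uSys A x) p a h

/-- Homomorphisms out of a stalk. -/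
def uLift {B : Type*} [AddCommGroup B] (f : ∀ p, A.obj (op (x.obj p)) →+ B)
    (hf : ∀ p q (h : p ≤ q) a, f q (A.map (x.map h).op a) = f p a) : uStalk A x →+ B :=
  AddCommGroup.DirectLimit.lift _ (uSys A x) B f hf

lemma uLift_germ {B : Type*} [AddCommGroup B] (f : ∀ p, A.obj (op (x.obj p)) →+ B)
    (hf : ∀ p q (h : p ≤ q) a, f q (A.map (x.map h).op a) = f p a) (p : Fin k → ℕ)
    (a : A.obj (op (x.obj p))) : uLift f hf (germ A x p rfl a) = f p a :=
  AddCommGroup.DirectLimit.lift_of (f := uSys A x) _ _ _ _ _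

lemma seg_shift' {p q m p' q' : Fin k → ℕ} (h : shift p x = shift q y) (hp : p' = p + m)
    (hq : q' = q + m) (h1 : p ≤ p') (h2 : q ≤ q') : x.seg h1 = y.seg h2 := by
  subst hp
  subst hq
  exact seg_shift h

lemma obj_shift {p q : Fin k → ℕ} (h : shift p x = shift q y) (m : Fin k → ℕ) :
    x.obj (p + m) = y.obj (q + m) := congrArg (fun z : InfPath k Λ => z.obj m) h

/-- The action of `(x, n, y)`: it sends `φʸ_q(a)` to `φˣ_p(a)` whenever `n = p - q` and
`σᵖ(x) = σ^q(y)`. -/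
def uAct (A : Λᵒᵖ ⥤ AddCommGrpCat.{u}) (g : y ⟶ x) : uStalk A y →+ uStalk A x :=
  let j := (GHom.exists_isPair g).choose
  let l := (GHom.exists_isPair g).choose_spec.choose
  have h : GHom.IsPair g j l := (GHom.exists_isPair g).choose_spec.choose_spec
  uLift (fun q => (germ A x (j + q) (obj_shift h.2 q)).comp
      (A.map (y.map (le_add_self (a := q) (b := l))).op).hom) (by
    intro p q hpq a
    simp only [AddMonoidHom.comp_apply]
    have hlq : l + p ≤ l + q := add_le_add_right hpq l
    have h1 : A.map (y.map (le_add_self (a := q) (b := l))).op (A.map (y.map hpq).op a) =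
        A.map (y.map hlq).op (A.map (y.map (le_add_self (a := p) (b := l))).op a) := by
      rw [← ConcreteCategory.comp_apply, ← ConcreteCategory.comp_apply, ← A.map_comp,
        ← A.map_comp, ← op_comp, ← op_comp, y.map_comp, y.map_comp]
    refine (congrArg _ h1).trans ?_
    refine germ_map (add_le_add_right hpq j) _ _ _ ?_ _
    exact (congrArg (fun z : InfPath k Λ => z.seg hpq) h.2).symm)

lemma uAct_germ (g : y ⟶ x) {p q : Fin k → ℕ} (h : GHom.IsPair g p q) {v : Λ}
    (hy : y.obj q = v) (hx : x.obj p = v) (a : A.obj (op v)) :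
    uAct A g (germ A y q hy a) = germ A x p hx a := by
  subst hy
  have h0 := (GHom.exists_isPair g).choose_spec.choose_spec
  refine (uLift_germ _ _ _ _).trans ?_
  have e := h0.1.symm.trans h.1
  refine germ_map (A := A) (v := y.obj q) (p := p) ?_ hx _ _ ?_ a
  · intro i
    have := congrFun e i
    simp only [Pi.add_apply] at this ⊢
    omega
  · refine (seg_shift' (m := (GHom.exists_isPair g).choose_spec.choose) h.2 ?_
      (add_comm _ _) _ _).symm
    funext i
    have := congrFun e i
    simp only [Pi.add_apply] at this ⊢
    omega

lemma obj_eq_of_isPair {g : y ⟶ x} {p q : Fin k → ℕ} (h : GHom.IsPair g p q) :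
    x.obj p = y.obj q := congrArg (fun z : InfPath k Λ => z.obj 0) h.2

lemma uAct_germ' (g : y ⟶ x) {p q : Fin k → ℕ} (h : GHom.IsPair g p q)
    (a : A.obj (op (y.obj q))) :
    uAct A g (germ A y q rfl a) = germ A x p (obj_eq_of_isPair h) a :=
  uAct_germ g h _ _ _

lemma exists_hom {p q : Fin k → ℕ} (h : p ≤ q) {v w : Λ} (hv : x.obj p = v) (hw : x.obj q = w) :
    ∃ f : w ⟶ v, (⟨f⟩ : Arr Λ) = x.seg h := by
  subst hv
  subst hw
  exact ⟨_, rfl⟩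

end

/-- The stalks with the action of the path groupoid. -/
def uFunctor (A : Λᵒᵖ ⥤ AddCommGrpCat.{u}) : InfPath k Λ ⥤ AddCommGrpCat.{u} where
  obj x := .of (uStalk A x)
  map g := AddCommGrpCat.ofHom (uAct A g)
  map_id x := by
    ext e
    obtain ⟨p, a, rfl⟩ := germ_surjective e
    refine uAct_germ (A := A) (𝟙 x) (p := p) ⟨?_, rfl⟩ rfl rfl a
    funext i
    exact (sub_self _).symm
  map_comp f g := by
    ext e
    obtain ⟨j, q, hg⟩ := GHom.exists_isPair g
    obtain ⟨q', r, hf⟩ := GHom.exists_isPair f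
    obtain ⟨m, hm, a, rfl⟩ := germ_surjective_ge e r
    obtain ⟨m, rfl⟩ := exists_add_of_le hm
    have hg := hg.add (q' + m)
    have hf := (hf.add m).add q
    rw [show q' + m + q = q + (q' + m) from add_comm _ _] at hf
    have hle : r + m ≤ r + m + q := le_self_add
    obtain ⟨b, hb⟩ : ∃ b, germ A _ (r + m + q) rfl b = germ A _ (r + m) rfl a :=
      ⟨_, germ_map' hle a⟩
    change uAct A (f ≫ g) _ = uAct A g (uAct A f _)
    rw [← hb, uAct_germ' f hf, uAct_germ' (f ≫ g) (GHom.isPair_comp hg hf)]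
    exact (uAct_germ (A := A) g hg _ _ _).symm

/-- The local section `y ↦ φʸ_{d(λ)}(a)` over `Z(λ)`, for `a` in `A_{s(λ)}`. -/
def uSec (A : Λᵒᵖ ⥤ AddCommGrpCat.{u}) (l : Arr Λ) (a : A.obj (op l.src)) :
    LocSec (X := InfPath k Λ) fun x => (uFunctor A).obj x where
  dom := ⟨InfPath.cyl l, isOpen_cyl l⟩
  sec y hy := germ A y (deg l.hom) (congrArg Arr.src hy) a

lemma uSec_pre (A : Λᵒᵖ ⥤ AddCommGrpCat.{u}) (x y : InfPath k Λ) (p : Fin k → ℕ)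
    (a : A.obj (op (x.obj p))) (hy : y ∈ (uSec A (x.pre p) a).dom) :
    (uSec A (x.pre p) a).sec y hy = germ A y p (congrArg Arr.src (mem_cyl_pre.1 hy)) a :=
  germ_congr (deg_pre x p) _ _ _

lemma eventually_pre (x : InfPath k Λ) (p : Fin k → ℕ) : ∀ᶠ z in 𝓝 x, z.pre p = x.pre p :=
  Filter.mem_of_superset ((isOpen_cyl (x.pre p)).mem_nhds (mem_cyl_pre.2 rfl)) fun _ h =>
    mem_cyl_pre.1 h

lemma seg_eq_of_pre {x z : InfPath k Λ} {p q : Fin k → ℕ} (h : z.pre q = x.pre q) (hpq : p ≤ q) :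
    z.seg hpq = x.seg hpq :=
  (seg_eq (h := zero_le' p) (h' := hpq) (j := zero_le' p) (j' := hpq) rfl h).1

lemma germ_zero_near {A : Λᵒᵖ ⥤ AddCommGrpCat.{u}} {x : InfPath k Λ} {p : Fin k → ℕ} {v : Λ}
    {h : x.obj p = v} {a : A.obj (op v)} (h0 : germ A x p h a = 0) :
    ∀ᶠ z in 𝓝 x, ∀ h : z.obj p = v, germ A z p h a = 0 := by
  subst h
  obtain ⟨q, hq, h1⟩ := germ_eq_zero h0
  filter_upwards [eventually_pre x q] with z hz h
  have h2 := seg_eq_of_pre hz hq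
  refine (germ_map hq h (congrArg Arr.src h2 : z.obj q = x.obj q) (x.map hq) h2.symm a).symm.trans
    ((congrArg _ h1).trans (map_zero _))

/-- The sheaf of a `Λ`-module `A`: its stalks are the direct limits of the groups `A_{x(p)}`, and
its topology is determined by the sections `y ↦ φʸ_{d(λ)}(a)` over `Z(λ)`. -/
def uSheaf (A : Λᵒᵖ ⥤ AddCommGrpCat.{u}) : GSheaf (InfPath k Λ) :=
  .ofSections (uFunctor A) {b | ∃ l a, b = uSec A l a}
    (by
      intro x e
      obtain ⟨p, a, rfl⟩ := germ_surjective e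
      exact ⟨_, ⟨x.pre p, a, rfl⟩, mem_cyl_pre.2 rfl, uSec_pre A x x p a _⟩)
    (by
      rintro _ ⟨l, a, rfl⟩ x hx h0
      filter_upwards [germ_zero_near h0] with z hz h
      exact hz _)
    (by
      rintro _ ⟨l, a, rfl⟩ _ ⟨l', a', rfl⟩ x hx hx'
      have key : ∀ (l : Arr Λ) (a : A.obj (op l.src)) (q : Fin k → ℕ), deg l.hom ≤ q →
          x ∈ (uSec A l a).dom → ∃ b : A.obj (op (x.obj q)), ∀ᶠ z in 𝓝 x,
            ∀ (h : z ∈ (uSec A l a).dom) (h' : z.obj q = x.obj q),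
              germ A z q h' b = (uSec A l a).sec z h := by
        intro l a q hq hx
        have hl : x.obj (deg l.hom) = l.src := congrArg Arr.src hx
        obtain ⟨b, hb⟩ := exists_hom hq hl rfl
        refine ⟨A.map b.op a, ?_⟩
        filter_upwards [eventually_pre x q] with z hz h h'
        exact germ_map hq _ h' b (hb.trans (seg_eq_of_pre hz hq).symm) a
      obtain ⟨b, hb⟩ := key l a (deg l.hom ⊔ deg l'.hom) le_sup_left hx
      obtain ⟨b', hb'⟩ := key l' a' (deg l.hom ⊔ deg l'.hom) le_sup_right hx'
      refine ⟨_, ⟨x.pre (deg l.hom ⊔ deg l'.hom), b - b', rfl⟩, mem_cyl_pre.2 rfl, ?_⟩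
      filter_upwards [hb, hb'] with z h1 h2 h3 h4 h5
      refine (uSec_pre _ _ _ _ _ _).trans ((map_sub (germ A z _ _) _ _).trans ?_)
      exact congrArg₂ _ (h1 h3 _) (h2 h4 _))
    (by
      rintro _ ⟨l, a, rfl⟩ ⟨g⟩ (hg : _ ∈ InfPath.cyl l)
      rename_i y x
      obtain ⟨j, q, h⟩ := GHom.exists_isPair g
      have h := h.add (deg l.hom)
      have hq : deg l.hom ≤ q + deg l.hom := le_add_self
      have hl : y.obj (deg l.hom) = l.src := congrArg Arr.src hg
      obtain ⟨b, hb⟩ := exists_hom hq hl (obj_eq_of_isPair h).symm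
      refine ⟨_, ⟨x.pre (j + deg l.hom), A.map b.op a, rfl⟩, mem_cyl_pre.2 rfl, ?_⟩
      filter_upwards [GHom.nb_mem_nhds (g := ⟨g⟩) h] with g' hg' h1 h2
      rw [uSec_pre]
      have h3 : g'.src.obj (q + deg l.hom) = x.obj (j + deg l.hom) :=
        (congrArg Arr.src hg'.2.2).trans (obj_eq_of_isPair h).symm
      have h4 : (uSec A l a).sec g'.src h1 = germ A g'.src (q + deg l.hom) h3 (A.map b.op a) :=
        (germ_map hq _ _ b (hb.trans (seg_eq_of_pre hg'.2.2 hq).symm) a).symm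
      rw [h4]
      exact (uAct_germ g'.hom hg'.1 _ _ _).symm)

lemma continuous_uSec (A : Λᵒᵖ ⥤ AddCommGrpCat.{u}) (l : Arr Λ) (a : A.obj (op l.src)) :
    Continuous (fun z : (uSec A l a).dom =>
      (⟨z.1, (uSec A l a).sec z.1 z.2⟩ : Tot (uSheaf A).stalk)) :=
  secTop_continuous_map (B := {b | ∃ l a, b = uSec A l a}) ⟨l, a, rfl⟩

/-- A family of homomorphisms out of the stalks is continuous if it is so along the sections
`y ↦ φʸ_{d(λ)}(a)`. -/
lemma continuous_uSheaf {A : Λᵒᵖ ⥤ AddCommGrpCat.{u}} {F : GSheaf (InfPath k Λ)}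
    (f : ∀ x, uStalk A x →+ F.stalk x) (h : ∀ (l : Arr Λ) (a : A.obj (op l.src)),
      Continuous fun z : (uSec A l a).dom =>
        (⟨z.1, f z.1 (germ A z.1 (deg l.hom) (congrArg Arr.src z.2) a)⟩ : Tot F.stalk)) :
    Continuous fun p : Tot (uSheaf A).stalk => (⟨p.base, f p.base p.val⟩ : Tot F.stalk) := by
  refine (secTop_continuous_iff (B := {b | ∃ l a, b = uSec A l a})).2 ?_
  rintro _ ⟨l, a, rfl⟩
  exact h l a

/-- The map `φˣ_p`, with values in the stalk of the sheaf. -/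
def germS (A : Λᵒᵖ ⥤ AddCommGrpCat.{u}) (x : InfPath k Λ) (p : Fin k → ℕ) {v : Λ}
    (h : x.obj p = v) : A.obj (op v) →+ (uSheaf A).stalk x := germ A x p h

section

variable {A : Λᵒᵖ ⥤ AddCommGrpCat.{u}}

lemma germS_surjective {x : InfPath k Λ} (e : (uSheaf A).stalk x) (r : Fin k → ℕ) :
    ∃ p, r ≤ p ∧ ∃ a, germS A x p rfl a = e := germ_surjective_ge e r

lemma germS_map {x : InfPath k Λ} {p q : Fin k → ℕ} (hpq : p ≤ q) (a : A.obj (op (x.obj p))) :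
    germS A x q rfl (A.map (x.map hpq).op a) = germS A x p rfl a := germ_map' hpq a

lemma germS_act {x y : InfPath k Λ} (g : y ⟶ x) {p q : Fin k → ℕ} (h : GHom.IsPair g p q)
    {v : Λ} (hy : y.obj q = v) (hx : x.obj p = v) (a : A.obj (op v)) :
    (uSheaf A).act.map g (germS A y q hy a) = germS A x p hx a := uAct_germ g h hy hx a

lemma germS_eq_zero {x : InfPath k Λ} {p : Fin k → ℕ} {a : A.obj (op (x.obj p))}
    (h : germS A x p rfl a = 0) :
    ∃ (q : Fin k → ℕ) (hq : p ≤ q), A.map (x.map hq).op a = 0 := germ_eq_zero h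

lemma continuous_germS (l : Arr Λ) (a : A.obj (op l.src)) :
    Continuous fun z : InfPath.cyl l => (⟨z.1, germS A z.1 (deg l.hom) (congrArg Arr.src z.2) a⟩ :
      Tot (uSheaf A).stalk) := continuous_uSec A l a

end

/-- A morphism out of the sheaf of a module, given by compatible homomorphisms
`A_v → F(x)` for `v = x(p)`. -/
def uHom {A : Λᵒᵖ ⥤ AddCommGrpCat.{u}} {F : GSheaf (InfPath k Λ)}
    (f : ∀ (x : InfPath k Λ) (p : Fin k → ℕ) {v : Λ}, x.obj p = v → (A.obj (op v) →+ F.stalk x))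
    (hf : ∀ x p q (h : p ≤ q) a, f x q rfl (A.map (x.map h).op a) = f x p rfl a)
    (hact : ∀ {y x : InfPath k Λ} (g : y ⟶ x) {p q : Fin k → ℕ}, GHom.IsPair g p q → ∀ {v : Λ}
      (hy : y.obj q = v) (hx : x.obj p = v) (a : A.obj (op v)),
      f x p hx a = F.act.map g (f y q hy a))
    (hcont : ∀ (l : Arr Λ) (a : A.obj (op l.src)), Continuous fun z : InfPath.cyl l =>
      (⟨z.1, f z.1 (deg l.hom) (congrArg Arr.src z.2) a⟩ : Tot F.stalk)) :
    uSheaf A ⟶ F :=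
  have key : ∀ (x : InfPath k Λ) (p : Fin k → ℕ) {v : Λ} (h : x.obj p = v) (a : A.obj (op v)),
      uLift (fun p => f x p rfl) (hf x) (germ A x p h a) = f x p h a := by
    rintro x p _ rfl a
    exact uLift_germ _ _ _ _
  GSheaf.mkHom (F := uSheaf A)
    { app := fun x => AddCommGrpCat.ofHom (uLift (fun p => f x p rfl) (hf x))
      naturality := fun y x g => AddCommGrpCat.hom_ext (AddMonoidHom.ext fun e => by
        obtain ⟨q', p', h⟩ := GHom.exists_isPair g
        obtain ⟨m, hm, a, rfl⟩ := germ_surjective_ge e p'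
        obtain ⟨m, rfl⟩ := exists_add_of_le hm
        have h := h.add m
        refine (congrArg (uLift (fun p => f x p rfl) (hf x)) (uAct_germ' g h a)).trans ?_
        refine (key _ _ _ _).trans ((hact g h rfl _ a).trans ?_)
        exact congrArg _ (key _ _ _ _).symm) }
    (continuous_uSheaf (fun x => uLift (fun p => f x p rfl) (hf x)) fun l a =>
      (hcont l a).congr fun z => congrArg (Tot.mk z.1) (key _ _ _ _).symm)

lemma uHom_germ {A : Λᵒᵖ ⥤ AddCommGrpCat.{u}} {F : GSheaf (InfPath k Λ)}
    (f : ∀ (x : InfPath k Λ) (p : Fin k → ℕ) {v : Λ}, x.obj p = v → (A.obj (op v) →+ F.stalk x))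
    (hf hact hcont) (x : InfPath k Λ) (p : Fin k → ℕ) {v : Λ} (h : x.obj p = v)
    (a : A.obj (op v)) :
    GSheaf.app (uHom f hf hact hcont) x (germS A x p h a) = f x p h a := by
  subst h
  exact uLift_germ _ (hf x) p a

/-- The morphism of sheaves induced by a morphism of modules: `φˣ_p(a) ↦ φˣ_p(α(a))`. -/
def uMap {A A' : Λᵒᵖ ⥤ AddCommGrpCat.{u}} (α : A ⟶ A') :
    (uSheaf A : GSheaf (InfPath k Λ)) ⟶ uSheaf A' :=
  uHom (F := uSheaf A') (fun x p v h => (germS A' x p h).comp (α.app (op v)).hom)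
    (fun x p q h a => (congrArg (germS A' x q rfl)
      (congrArg (fun φ => φ a) (α.naturality (x.map h).op))).trans (germS_map h _))
    (fun {_ _} g {_ _} h {_} hy hx _ => (germS_act g h hy hx _).symm)
    (fun l a => continuous_germS l (α.app (op l.src) a))

lemma uMap_germ {A A' : Λᵒᵖ ⥤ AddCommGrpCat.{u}} (α : A ⟶ A') (x : InfPath k Λ)
    (p : Fin k → ℕ) {v : Λ} (h : x.obj p = v) (a : A.obj (op v)) :
    GSheaf.app (uMap α) x (germS A x p h a) = germS A' x p h (α.app (op v) a) :=
  uHom_germ (F := uSheaf A') (fun x p v h => (germS A' x p h).comp (α.app (op v)).hom) _ _ _ x p h a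

lemma uMap_comp {A A' A'' : Λᵒᵖ ⥤ AddCommGrpCat.{u}} (α : A ⟶ A') (β : A' ⟶ A'') :
    (uMap (α ≫ β) : (uSheaf A : GSheaf (InfPath k Λ)) ⟶ _) = uMap α ≫ uMap β := by
  refine GSheaf.hom_ext fun x e => ?_
  obtain ⟨p, -, a, rfl⟩ := germS_surjective e 0
  rw [GSheaf.app_comp, uMap_germ, uMap_germ, uMap_germ]
  rfl

lemma uMap_add {A A' : Λᵒᵖ ⥤ AddCommGrpCat.{u}} (α β : A ⟶ A') :
    (uMap (α + β) : (uSheaf A : GSheaf (InfPath k Λ)) ⟶ _) = uMap α + uMap β := by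
  refine GSheaf.hom_ext fun x e => ?_
  obtain ⟨p, -, a, rfl⟩ := germS_surjective e 0
  rw [GSheaf.app_add, uMap_germ, uMap_germ, uMap_germ]
  exact map_add (germS A' x p rfl) _ _

/-- The functor from modules to sheaves is exact. -/
lemma uMap_exact {A A' A'' : Λᵒᵖ ⥤ AddCommGrpCat.{u}} {α : A ⟶ A'} {β : A' ⟶ A''}
    (h : ∀ v (a : A'.obj v), β.app v a = 0 ↔ ∃ b, α.app v b = a) (x : InfPath k Λ)
    (e : (uSheaf A' : GSheaf (InfPath k Λ)).stalk x) :
    GSheaf.app (uMap β) x e = 0 ↔ ∃ e', GSheaf.app (uMap α) x e' = e := by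
  constructor
  · intro h0
    obtain ⟨p, -, a, rfl⟩ := germS_surjective e 0
    rw [uMap_germ] at h0
    obtain ⟨q, hq, h1⟩ := germS_eq_zero h0
    have := congrArg (fun φ => φ a) (β.naturality (x.map hq).op)
    obtain ⟨b, hb⟩ := (h _ _).1 (this.trans h1)
    refine ⟨germS A x q rfl b, ?_⟩
    rw [uMap_germ, hb]
    exact germS_map hq a
  · rintro ⟨e, rfl⟩
    obtain ⟨p, -, a, rfl⟩ := germS_surjective e 0
    rw [uMap_germ, uMap_germ, (h _ _).2 ⟨a, rfl⟩]
    exact map_zero (germS A'' x p rfl)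

/-- The isomorphism from the sheaf of a constant module to the constant sheaf. -/
def uConst (M : AddCommGrpCat.{u}) :
    (uSheaf ((Functor.const Λᵒᵖ).obj M) : GSheaf (InfPath k Λ)) ⟶ .const _ M :=
  uHom (F := .const _ M) (fun _ _ _ _ => .id M) (fun _ _ _ _ _ => rfl) (fun {_ _} _ {_ _} _ {_} _ _ _ => rfl)
    (fun _ a => (GSheaf.continuous_const M a).comp continuous_subtype_val)

lemma uConst_germ (M : AddCommGrpCat.{u}) (x : InfPath k Λ) (p : Fin k → ℕ) {v : Λ}
    (h : x.obj p = v) (m : M) :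
    GSheaf.app (uConst M) x (germS ((Functor.const Λᵒᵖ).obj M) x p h m) = m :=
  uHom_germ (A := (Functor.const Λᵒᵖ).obj M) (F := .const _ M) (fun _ _ _ _ => .id M) _ _ _ x p h m

lemma uConst_eq_zero (M : AddCommGrpCat.{u}) (x : InfPath k Λ)
    (e : (uSheaf ((Functor.const Λᵒᵖ).obj M) : GSheaf (InfPath k Λ)).stalk x)
    (h : GSheaf.app (uConst M) x e = 0) : e = 0 := by
  obtain ⟨p, -, a, rfl⟩ := germS_surjective e 0
  rw [uConst_germ] at h
  subst h
  exact map_zero (germS _ x p rfl)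

end

/-! ### Cohomology groups -/

/-- The quotient `Z / B` of a group of cocycles by a group of coboundaries. -/
abbrev SubQuot {G : Type*} [AddCommGroup G] (Z B : AddSubgroup G) : Type _ :=
  Z ⧸ B.addSubgroupOf Z

namespace SubQuot

variable {G G' : Type*} [AddCommGroup G] [AddCommGroup G'] {Z B : AddSubgroup G}
  {Z' B' : AddSubgroup G'}

/-- The class of a cocycle. -/
def mk (c : Z) : SubQuot Z B := QuotientAddGroup.mk c

/-- The homomorphism induced on cohomology classes. -/
def map (f : G →+ G') (hZ : ∀ c ∈ Z, f c ∈ Z') (hB : ∀ c ∈ B, f c ∈ B') :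
    SubQuot Z B →+ SubQuot Z' B' :=
  QuotientAddGroup.map _ _ ((f.comp Z.subtype).codRestrict Z' fun c => hZ c c.2)
    fun c hc => hB c hc

end SubQuot

section

variable {D : Type*} [Category D] [Preadditive D]

/-- The `n`-cocycles `c : Q n ⟶ A`, `c ∘ dₙ₊₁ = 0`, of the complex `Hom(Q, A)`. -/
def homZ (Q : ℕ → D) (d : ∀ n, Q (n + 1) ⟶ Q n) (A : D) (n : ℕ) : AddSubgroup (Q n ⟶ A) where
  carrier := {c | d n ≫ c = 0}
  zero_mem' := Limits.comp_zero
  add_mem' {c c'} hc hc' := by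
    rw [Set.mem_ofPred_eq] at hc hc' ⊢
    rw [Preadditive.comp_add, hc, hc', add_zero]
  neg_mem' {c} hc := by
    rw [Set.mem_ofPred_eq] at hc ⊢
    rw [Preadditive.comp_neg, hc, neg_zero]

/-- The `n`-coboundaries `b ∘ dₙ` of the complex `Hom(Q, A)`; there are none for `n = 0`. -/
def homB (Q : ℕ → D) (d : ∀ n, Q (n + 1) ⟶ Q n) (A : D) : ∀ n, AddSubgroup (Q n ⟶ A)
  | 0 => ⊥
  | n + 1 => (Preadditive.leftComp A (d n)).range

/-- The cohomology of the complex `Hom(Q, A)`. -/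
abbrev HomCoh (Q : ℕ → D) (d : ∀ n, Q (n + 1) ⟶ Q n) (A : D) (n : ℕ) : Type _ :=
  SubQuot (homZ Q d A n) (homB Q d A n)

/-- The map on cohomology induced by a chain map. -/
def HomCoh.precomp {Q Q' : ℕ → D} {d : ∀ n, Q (n + 1) ⟶ Q n} {d' : ∀ n, Q' (n + 1) ⟶ Q' n}
    (ψ : ∀ n, Q n ⟶ Q' n) (hψ : ∀ n, d n ≫ ψ n = ψ (n + 1) ≫ d' n) (A : D) (n : ℕ) :
    HomCoh Q' d' A n →+ HomCoh Q d A n :=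
  SubQuot.map (Preadditive.leftComp A (ψ n))
    (by
      intro c hc
      change d n ≫ ψ n ≫ c = 0
      rw [← Category.assoc, hψ, Category.assoc, show d' n ≫ c = 0 from hc, Limits.comp_zero])
    (by
      cases n with
      | zero =>
        intro c hc
        rw [show c = 0 from hc, map_zero]
        exact zero_mem _
      | succ n =>
        rintro _ ⟨b, rfl⟩
        refine ⟨ψ n ≫ b, ?_⟩
        change d n ≫ ψ n ≫ b = ψ (n + 1) ≫ d' n ≫ b
        rw [← Category.assoc, hψ, Category.assoc])

end

section

variable {X : Type u} [EtaleGroupoid X]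

open GSheaf

/-- The cycles in the complex `⋯ → R 1 → R 0 → Z → 0`. -/
def IsCyc {Z : GSheaf X} {R : ℕ → GSheaf X} (d : ∀ n, R n ⟶ prev Z R n) :
    ∀ (n : ℕ) (x : X), (prev Z R n).stalk x → Prop
  | 0, _, _ => True
  | n + 1, x, a => app (d n) x a = 0

variable (X) in
/-- A resolution `⋯ → Q₁ → Q₀ → ℤ → 0` of the constant sheaf: the sequence is exact on stalks. -/
structure Resolution : Type (u + 1) where
  obj : ℕ → GSheaf X
  d : ∀ n, obj n ⟶ prev (constZ X) obj n
  exact : ∀ n x (a : (prev (constZ X) obj n).stalk x), IsCyc d n x a ↔ ∃ b, app (d n) x b = a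

/-- The maps `Qₙ₊₁ → Qₙ` of a resolution. -/
def Resolution.diff (Q : Resolution X) (n : ℕ) : Q.obj (n + 1) ⟶ Q.obj n := Q.d (n + 1)

/-- The cohomology of the complex `Hom(Q, A)` for a resolution `Q`. -/
abbrev Resolution.Coh (Q : Resolution X) (A : GSheaf X) (n : ℕ) : Type u :=
  HomCoh Q.obj Q.diff A n

/-- An exact sequence `0 → A → Rₘ → Rₘ₋₁ → ⋯ → R₀ → ℤ → 0` of sheaves, where `Rₘ = top` and
`Rᵢ = low i` for `i < m`; the objects `low i` for `i ≥ m` are ignored. -/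
structure NExt (A : GSheaf X) (m : ℕ) : Type (u + 1) where
  low : ℕ → GSheaf X
  d : ∀ n, low n ⟶ prev (constZ X) low n
  top : GSheaf X
  dtop : top ⟶ prev (constZ X) low m
  ι : A ⟶ top
  exact_low : ∀ n < m, ∀ x (a : (prev (constZ X) low n).stalk x),
    IsCyc d n x a ↔ ∃ b, app (d n) x b = a
  exact_dtop : ∀ x (a : (prev (constZ X) low m).stalk x),
    IsCyc d m x a ↔ ∃ b, app dtop x b = a
  exact_top : ∀ x (a : top.stalk x), app dtop x a = 0 ↔ ∃ b, app ι x b = a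
  injective_ι : ∀ x (a : A.stalk x), app ι x a = 0 → a = 0

/-- The identity of `Z`, followed by the given morphisms. -/
def prevMap {Z : GSheaf X} {R R' : ℕ → GSheaf X} (f : ∀ n, R n ⟶ R' n) :
    ∀ n, prev Z R n ⟶ prev Z R' n
  | 0 => 𝟙 Z
  | n + 1 => f n

/-- Morphisms of exact sequences which are the given morphism `α` on the left end and the
identity of `ℤ` on the right end. -/
structure NExt.Hom {A A' : GSheaf X} {m : ℕ} (α : A ⟶ A') (E : NExt A m) (E' : NExt A' m) :
    Type u where
  low : ∀ n, E.low n ⟶ E'.low n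
  top : E.top ⟶ E'.top
  comm_low : ∀ n < m, E.d n ≫ prevMap low n = low n ≫ E'.d n
  comm_dtop : E.dtop ≫ prevMap low m = top ≫ E'.dtop
  comm_ι : E.ι ≫ top = α ≫ E'.ι

/-- The sheaf cohomology `Hⁿ(G, A) = Extⁿ(ℤ, A)`: homomorphisms `ℤ → A` for `n = 0`, and for
`n ≥ 1` classes of `n`-fold exact sequences under the equivalence relation generated by the
morphisms which are the identity on both ends. -/
def SheafCoh (A : GSheaf X) : ℕ → Type (u + 1)
  | 0 => ULift.{u + 1} (constZ X ⟶ A)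
  | m + 1 => Quot fun E E' : NExt A m => Nonempty (NExt.Hom (𝟙 A) E E')

/-- The class `e` is the (Baer) sum of the classes `e₁` and `e₂`: for `n ≥ 1` this means that there
is an exact sequence that begins with `A ⊕ A` and maps to representatives of `e₁`, `e₂` and `e`
over the two projections and over the sum `A ⊕ A → A`. -/
def IsSum {A : GSheaf X} : ∀ n, SheafCoh A n → SheafCoh A n → SheafCoh A n → Prop
  | 0, e₁, e₂, e => e.down = e₁.down + e₂.down
  | m + 1, e₁, e₂, e => ∃ E₁ E₂ E : NExt A m, Quot.mk _ E₁ = e₁ ∧ Quot.mk _ E₂ = e₂ ∧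
      Quot.mk _ E = e ∧ ∃ (D : Limits.BinaryBicone A A) (F : NExt D.pt m),
        Nonempty D.IsBilimit ∧ Nonempty (NExt.Hom D.fst F E₁) ∧ Nonempty (NExt.Hom D.snd F E₂) ∧
        Nonempty (NExt.Hom (D.fst + D.snd) F E)

/-- A morphism that kills the kernel of a surjective morphism factors through it. -/
lemma exists_factor {P Z A : GSheaf X} (θ : P ⟶ Z) (hθ : ∀ x z, ∃ p, app θ x p = z) (c : P ⟶ A)
    (hc : ∀ x p, app θ x p = 0 → app c x p = 0) : ∃ f : Z ⟶ A, θ ≫ f = c := by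
  choose s hs using hθ
  have key : ∀ x p, app c x (s x (app θ x p)) = app c x p := by
    intro x p
    refine sub_eq_zero.1 ((map_sub (app c x) _ _).symm.trans (hc x _ ?_))
    rw [map_sub, hs, sub_self]
  have key' : ∀ x z p, app θ x p = z → app c x (s x z) = app c x p := by
    rintro x _ p rfl
    exact key x p
  let f : ∀ x, Z.stalk x →+ A.stalk x := fun x => AddMonoidHom.mk' (fun z => app c x (s x z)) (by
    intro z z'
    rw [key' x (z + z') (s x z + s x z') (by rw [map_add, hs, hs]), map_add])
  refine ⟨mkHom { app := fun x => AddCommGrpCat.ofHom (f x), naturality := ?_ } ?_, ?_⟩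
  · intro x y γ
    refine AddCommGrpCat.hom_ext (AddMonoidHom.ext fun z => ?_)
    refine (key' y _ (P.act.map γ (s x z)) ?_).trans (app_naturality c γ _)
    refine (app_naturality θ γ _).trans ?_
    rw [hs]
    rfl
  · rw [continuous_iff_continuousAt]
    rintro ⟨x, z⟩
    obtain ⟨b, hb, hx, hbx⟩ := exists_section (E := P.stalk) P.isLocalHomeomorph (s x z)
    let b1 : LocSec Z.stalk := ⟨b.dom, fun y hy => app θ y (b.sec y hy)⟩
    let b2 : LocSec A.stalk := ⟨b.dom, fun y hy => app c y (b.sec y hy)⟩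
    have hb1 : Continuous b1.map := (continuous_hom θ).comp hb
    have hb2 : Continuous b2.map := (continuous_hom c).comp hb
    have hz : b1.sec x hx = z := (congrArg _ hbx).trans (hs x z)
    subst hz
    refine continuousAt_of_section hb2 hx Z.continuous_base.continuousAt ?_
    filter_upwards [eventually_section Z.isLocalHomeomorph hb1 hx] with p hp h2
    exact key' _ _ _ (hp.2).symm
  · exact hom_ext fun x p => key x p

lemma exists_rhoZero (Q : Resolution X) {A : GSheaf X} (c : homZ Q.obj Q.diff A 0) :
    ∃ f : constZ X ⟶ A, Q.d 0 ≫ f = c.1 :=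
  exists_factor (Q.d 0) (fun x z => (Q.exact 0 x z).1 trivial) c.1 (by
    intro x p h
    obtain ⟨b, rfl⟩ := (Q.exact 1 x p).1 h
    exact congrArg (fun φ => app φ x b) c.2)

/-- The (unique) homomorphism `c̃ : ℤ → A` with `c = c̃ ∘ ϑ₀`, for a `0`-cocycle `c`. -/
def rhoZero (Q : Resolution X) {A : GSheaf X} (c : homZ Q.obj Q.diff A 0) : constZ X ⟶ A :=
  (exists_rhoZero Q c).choose

lemma comp_rhoZero (Q : Resolution X) {A : GSheaf X} (c : homZ Q.obj Q.diff A 0) :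
    Q.d 0 ≫ rhoZero Q c = c.1 := (exists_rhoZero Q c).choose_spec

lemma Resolution.diff_comp_d (Q : Resolution X) (m : ℕ) : Q.diff m ≫ Q.d m = 0 :=
  hom_ext fun x a => (Q.exact (m + 1) x _).2 ⟨a, rfl⟩

/-- The exact sequence `0 → A → R_c → Qₘ₋₁ → ⋯ → Q₀ → ℤ → 0` of a cocycle `c : Qₘ₊₁ → A`, where
`R_c` is the pushout of `c` and `Qₘ₊₁ → Qₘ`. -/
def rhoExt (Q : Resolution X) {A : GSheaf X} {m : ℕ} (c : homZ Q.obj Q.diff A (m + 1)) :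
    NExt A m where
  low := Q.obj
  d := Q.d
  top := pushout c.1 (Q.diff m)
  dtop := pushoutDesc c.1 (Q.diff m) 0 (Q.d m) (by
    rw [Limits.comp_zero, Q.diff_comp_d])
  ι := pushoutInl c.1 (Q.diff m)
  exact_low n _ := Q.exact n
  exact_dtop x a := by
    rw [Q.exact]
    constructor
    · rintro ⟨b, rfl⟩
      exact ⟨pushoutMk _ _ x (0, b), (pushoutDesc_mk _ _ _ _ _ _ _ _).trans (zero_add _)⟩
    · rintro ⟨b, rfl⟩
      obtain ⟨⟨b, p⟩, rfl⟩ := pushoutMk_surjective _ _ x b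
      exact ⟨p, ((pushoutDesc_mk _ _ _ _ _ _ _ _).trans (zero_add _)).symm⟩
  exact_top x a := by
    constructor
    · intro h
      obtain ⟨⟨b, p⟩, rfl⟩ := pushoutMk_surjective _ _ x a
      have h0 : app (Q.d m) x p = 0 := (zero_add _).symm.trans
        ((pushoutDesc_mk _ _ _ _ _ x b p).symm.trans h)
      obtain ⟨q, rfl⟩ := (Q.exact (m + 1) x p).1 h0
      refine ⟨b + app c.1 x q, ?_⟩
      refine sub_eq_zero.1 ((map_sub (pushoutMk _ _ x) _ _).symm.trans ?_)
      refine (pushoutMk_eq_zero _ _).2 ⟨q, ?_, ?_⟩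
      · exact (add_sub_cancel_left _ _).symm
      · exact (zero_sub _).symm
    · rintro ⟨b, rfl⟩
      refine (pushoutDesc_mk _ _ _ _ _ x b 0).trans ((zero_add _).trans ?_)
      exact map_zero _
  injective_ι x a h := by
    obtain ⟨q, h1, h2⟩ := (pushoutMk_eq_zero _ _).1 h
    obtain ⟨q', rfl⟩ := (Q.exact (m + 2) x q).1 (neg_eq_zero.1 h2)
    exact h1.symm.trans (congrArg (fun φ => app φ x q') c.2)

lemma rhoExt_sound (Q : Resolution X) {A : GSheaf X} {m : ℕ}
    {c c' : homZ Q.obj Q.diff A (m + 1)} (g : Q.obj m ⟶ A) (h : c'.1 = c.1 - Q.diff m ≫ g) :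
    Nonempty (NExt.Hom (𝟙 A) (rhoExt Q c) (rhoExt Q c')) := by
  have e : c.1 ≫ pushoutInl c'.1 (Q.diff m) =
      Q.diff m ≫ (g ≫ pushoutInl c'.1 (Q.diff m) + pushoutInr c'.1 (Q.diff m)) := by
    have := pushout_condition c'.1 (Q.diff m)
    rw [Preadditive.comp_add, ← this, h, Preadditive.sub_comp, Category.assoc]
    abel
  have hid : ∀ n, prevMap (Z := constZ X) (fun n => 𝟙 (Q.obj n)) n = 𝟙 _ := fun n => by
    cases n <;> rfl
  have e' : Q.diff m ≫ Q.d m = 0 := Q.diff_comp_d m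
  have e1 : pushoutDesc c.1 (Q.diff m) 0 (Q.d m) (by rw [Limits.comp_zero, e']) =
      pushoutDesc c.1 (Q.diff m) _ _ e ≫
        pushoutDesc c'.1 (Q.diff m) 0 (Q.d m) (by rw [Limits.comp_zero, e']) := by
    refine hom_ext fun x e => ?_
    obtain ⟨⟨b, p⟩, rfl⟩ := pushoutMk_surjective _ _ x e
    rw [app_comp, pushoutDesc_mk, pushoutDesc_mk, map_add, app_add, map_add]
    have h1 : ∀ a, app (pushoutDesc c'.1 (Q.diff m) 0 (Q.d m) (by rw [Limits.comp_zero, e'])) x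
        (app (pushoutInl c'.1 (Q.diff m)) x a) = 0 := fun a =>
      (zero_add _).trans (map_zero (app (Q.d m) x))
    have h2 : ∀ a, app (pushoutDesc c'.1 (Q.diff m) 0 (Q.d m) (by rw [Limits.comp_zero, e'])) x
        (app (pushoutInr c'.1 (Q.diff m)) x a) = app (Q.d m) x a := fun a => zero_add _
    rw [h1, h2, app_comp, h1, zero_add]
    rfl
  have e2 : pushoutInl c.1 (Q.diff m) ≫ pushoutDesc c.1 (Q.diff m) _ _ e =
      pushoutInl c'.1 (Q.diff m) := by
    refine hom_ext fun x a => ?_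
    refine (pushoutDesc_mk _ _ _ _ e x a 0).trans ?_
    rw [map_zero, add_zero]
  exact ⟨⟨fun n => 𝟙 _, pushoutDesc c.1 (Q.diff m) _ _ e,
    fun n _ => (congrArg _ (hid n)).trans ((Category.comp_id _).trans (Category.id_comp _).symm),
    (congrArg _ (hid m)).trans ((Category.comp_id _).trans e1),
    e2.trans (Category.id_comp _).symm⟩⟩

/-- The map `ρⁿ` from the cohomology of `Hom(Q, A)` to sheaf cohomology, for a resolution `Q` of
the constant sheaf `ℤ`. -/
def rho (Q : Resolution X) (A : GSheaf X) : ∀ n, Q.Coh A n → SheafCoh A n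
  | 0 => Quotient.lift (fun c => ULift.up (rhoZero Q c)) (by
      intro c c' h
      have : c = c' := by
        have := QuotientAddGroup.leftRel_apply.1 h
        have : -c.1 + c'.1 = 0 := this
        exact Subtype.ext (neg_add_eq_zero.1 this)
      rw [this])
  | m + 1 => Quotient.lift (fun c => Quot.mk _ (rhoExt Q c)) (by
      intro c c' h
      obtain ⟨g, hg⟩ := QuotientAddGroup.leftRel_apply.1 h
      refine Quot.sound (rhoExt_sound Q (-g) ?_)
      have hg : Q.diff m ≫ g = -c.1 + c'.1 := hg
      rw [Preadditive.comp_neg, hg]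
      abel)

end

/-! ### Continuous cocycle cohomology -/

section

variable {X : Type u} [EtaleGroupoid X]

open GSheaf

variable (X) in
/-- The resolution of `ℤ` by the sheaves `ℤ[G⁽ⁿ⁺¹⁾]`. -/
def barRes : Resolution X where
  obj := barSheaf X
  d := barSheafD X
  exact
    | 0, x, a => ⟨fun _ => barD_zero_surjective x a, fun _ => trivial⟩
    | 1, x, a => barD_exact 0 x a
    | n + 2, x, a => barD_exact (n + 1) x a

/-- The group of continuous `n`-cochains `f(γ₁, …, γₙ) ∈ A(r(γ₁))` (for `n = 0`, of continuous
sections over the unit space). -/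
def cochains (A : GSheaf X) (n : ℕ) : AddSubgroup (∀ t : Tot (Tup X n), A.stalk t.base) where
  carrier := {f | Continuous fun t : Tot (Tup X n) => (⟨t.base, f t⟩ : Tot A.stalk)}
  zero_mem' := continuous_mk_zero (F := A) (tup_isLocalHomeomorph n).continuous
  add_mem' := continuous_mk_add
  neg_mem' := continuous_mk_neg

/-- The coboundary
`δf(γ₀, …, γₙ) = γ₀·f(γ₁, …, γₙ) + ∑_{i=1}^n (-1)ⁱ f(…, γᵢ₋₁γᵢ, …) + (-1)ⁿ⁺¹ f(γ₀, …, γₙ₋₁)`, and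
`δf(γ₀) = γ₀·f(s(γ₀)) - f(r(γ₀))` for `n = 0`. -/
def cobdry (A : GSheaf X) (n : ℕ) : (∀ t : Tot (Tup X n), A.stalk t.base) →+
    ∀ t : Tot (Tup X (n + 1)), A.stalk t.base :=
  AddMonoidHom.mk' (fun f t => match t with
    | ⟨x, .cons γ t⟩ => A.act.map γ (f ⟨_, t⟩) + ∑ j ∈ Finset.range (n + 1), (-1 : ℤ) ^ (j + 1) •
        f ⟨x, face n j (.cons γ t)⟩) (by
    intro f g
    funext t
    rcases t with ⟨x, _ | ⟨γ, t⟩⟩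
    simp only [Pi.add_apply, map_add, smul_add, Finset.sum_add_distrib]
    abel)

/-- The continuous `n`-cocycles. -/
def contZ (A : GSheaf X) (n : ℕ) : AddSubgroup (cochains A n) :=
  ((cobdry A n).comp (cochains A n).subtype).ker

/-- The continuous `n`-coboundaries. -/
def contB (A : GSheaf X) : ∀ n, AddSubgroup (cochains A n)
  | 0 => ⊥
  | n + 1 => (((cobdry A n).comp (cochains A n).subtype).range).addSubgroupOf (cochains A (n + 1))

/-- The continuous cocycle cohomology. -/
abbrev ContCoh (A : GSheaf X) (n : ℕ) : Type u := SubQuot (contZ A n) (contB A n)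

/-- The homomorphism `[γ₀, …, γₙ] ↦ γ₀·f(γ₁, …, γₙ)`. -/
def etaFun (A : GSheaf X) {n : ℕ} (f : ∀ t : Tot (Tup X n), A.stalk t.base) (x : X) :
    FreeAbelianGroup (Tup X (n + 1) x) →+ A.stalk x :=
  FreeAbelianGroup.lift fun t => match t with
    | .cons γ t => A.act.map γ (f ⟨_, t⟩)

lemma etaFun_of (A : GSheaf X) {n : ℕ} (f : ∀ t : Tot (Tup X n), A.stalk t.base) {x y : X}
    (γ : y ⟶ x) (t : Tup X n y) : etaFun A f x (.of (.cons γ t)) = A.act.map γ (f ⟨_, t⟩) :=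
  FreeAbelianGroup.lift_apply_of _ _

lemma etaFun_act (A : GSheaf X) {n : ℕ} (f : ∀ t : Tot (Tup X n), A.stalk t.base) {x y : X}
    (γ : x ⟶ y) (a : FreeAbelianGroup (Tup X (n + 1) x)) :
    etaFun A f y (FreeAbelianGroup.map (Tup.act γ) a) = A.act.map γ (etaFun A f x a) := by
  refine DFunLike.congr_fun (f := (etaFun A f y).comp (FreeAbelianGroup.map (Tup.act γ)))
    (g := (A.act.map γ).hom.comp (etaFun A f x)) ?_ a
  ext t
  rcases t with _ | ⟨g, t⟩
  simp [Tup.act, etaFun_of]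

lemma etaFun_cobdry (A : GSheaf X) {n : ℕ} (f : ∀ t : Tot (Tup X n), A.stalk t.base) (x : X)
    (a : FreeAbelianGroup (Tup X (n + 2) x)) :
    etaFun A (cobdry A n f) x a = etaFun A f x (bdryFun n x a) := by
  refine DFunLike.congr_fun (f := etaFun A (cobdry A n f) x)
    (g := (etaFun A f x).comp (bdryFun n x)) ?_ a
  ext t
  rcases t with _ | ⟨g, _ | ⟨h, t⟩⟩
  rw [etaFun_of, AddMonoidHom.comp_apply, bdryFun_of, map_sum, Finset.sum_range_succ']
  simp only [map_zsmul, face, etaFun_of, cobdry, AddMonoidHom.mk'_apply, map_add, map_sum]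
  rw [add_comm]
  simp

lemma continuous_etaFun (A : GSheaf X) {n : ℕ} (f : cochains A n) :
    Continuous fun p : Tot (Tup X (n + 1)) =>
      (⟨p.base, etaFun A f.1 p.base (.of p.val)⟩ : Tot A.stalk) := by
  let γ : Tot (Tup X (n + 1)) → Arr X := tupHead
  let a : ∀ t, A.stalk (γ t).src := fun t => match t with
    | ⟨_, .cons _ t⟩ => f.1 ⟨_, t⟩
  have ha : Continuous fun t => (⟨(γ t).src, a t⟩ : Tot A.stalk) := by
    refine (Continuous.comp (g := fun t : Tot (Tup X n) => (⟨t.base, f.1 t⟩ : Tot A.stalk))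
      f.2 continuous_tupTail).congr ?_
    rintro ⟨x, _ | ⟨g, t⟩⟩
    rfl
  refine (continuous_mk_act continuous_tupHead ha).congr ?_
  rintro ⟨x, _ | ⟨g, t⟩⟩
  exact congrArg (Tot.mk x) (etaFun_of A f.1 g t).symm

/-- The map `ηⁿ`, `(ηf)[γ₀, …, γₙ] = γ₀·f(γ₁, …, γₙ)`, on cochains. -/
def etaHom (A : GSheaf X) (n : ℕ) : cochains A n →+ (barSheaf X n ⟶ A) :=
  AddMonoidHom.mk' (fun f => barHom
    { app := fun x => AddCommGrpCat.ofHom (etaFun A f.1 x)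
      naturality := fun x y γ => AddCommGrpCat.hom_ext
        (AddMonoidHom.ext fun a => etaFun_act A f.1 γ a) } (continuous_etaFun A f)) (by
    intro f g
    refine hom_ext fun x a => ?_
    refine DFunLike.congr_fun (f := etaFun A (f.1 + g.1) x)
      (g := etaFun A f.1 x + etaFun A g.1 x) ?_ a
    ext t
    rcases t with _ | ⟨γ, t⟩
    simp [etaFun_of])

lemma app_etaHom (A : GSheaf X) (n : ℕ) (f : cochains A n) (x : X)
    (a : FreeAbelianGroup (Tup X (n + 1) x)) :
    app (etaHom A n f) x a = etaFun A f.1 x a := rfl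

lemma diff_etaHom (A : GSheaf X) (n : ℕ) (f : cochains A n) (x : X)
    (a : FreeAbelianGroup (Tup X (n + 2) x)) :
    app ((barRes X).diff n ≫ etaHom A n f) x a = etaFun A (cobdry A n f.1) x a :=
  (etaFun_cobdry A f.1 x a).symm

/-- The homomorphism `ηⁿ` from the continuous cocycle cohomology to the cohomology of the complex
`Hom(ℤ[G⁽*⁺¹⁾], A)`. -/
def eta (A : GSheaf X) (n : ℕ) : ContCoh A n →+ (barRes X).Coh A n :=
  SubQuot.map (etaHom A n)
    (by
      intro f hf
      refine hom_ext fun x a => (diff_etaHom A n f x a).trans ?_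
      have hf : cobdry A n f.1 = 0 := hf
      rw [hf]
      refine DFunLike.congr_fun (f := etaFun A 0 x) (g := 0) ?_ a
      ext t
      rcases t with _ | ⟨γ, t⟩
      rw [etaFun_of]
      exact map_zero (A.act.map γ).hom)
    (by
      cases n with
      | zero =>
        intro f hf
        obtain rfl : f = 0 := hf
        exact map_zero (etaHom A 0)
      | succ n =>
        rintro f ⟨b, hb⟩
        refine ⟨etaHom A n b, hom_ext fun x a => (diff_etaHom A n b x a).trans ?_⟩
        have hb : cobdry A n b.1 = f.1 := hb
        rw [hb]
        rfl)

end

/-! ### Cohomology of a category and the resolution given by its bar complex -/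

section

variable {C : Type u} [SmallCategory C]

variable (C) in
/-- The maps `d_n[λ₀, …, λₙ] = [λ₁, …, λₙ] + ∑_{i=1}^n (-1)ⁱ [λ₀, …, λᵢ₋₁λᵢ, …, λₙ]` for `n ≥ 1`,
and `d₀[λ] = 1`.  A tuple `(λ₀, …, λₙ)` with `s(λₙ) = v` is represented by the tuple
`(λₙ, …, λ₀)` of the opposite category, so that `d_n` is, up to the sign `(-1)ⁿ`, the alternating
sum of the faces. -/
def modD : (n : ℕ) → (barObj Cᵒᵖ n ⟶
    prev ((Functor.const Cᵒᵖ).obj (AddCommGrpCat.of (ULift.{u} ℤ))) (barObj Cᵒᵖ) n)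
  | 0 => barD Cᵒᵖ 0
  | n + 1 => (-1 : ℤ) ^ (n + 1) • barD Cᵒᵖ (n + 1)

variable (C) in
/-- The map `d_{n+1}` between the modules of the resolution. -/
def modDiff (n : ℕ) : barObj Cᵒᵖ (n + 1) ⟶ barObj Cᵒᵖ n := modD C (n + 1)

/-- The cohomology `Hⁿ(C, A)` of a small category `C` with coefficients in a module, that is, in a
contravariant functor `A` to abelian groups. -/
abbrev ModCoh (A : Cᵒᵖ ⥤ AddCommGrpCat.{u}) (n : ℕ) : Type u :=
  HomCoh (barObj Cᵒᵖ) (modDiff C) A n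

lemma modDiff_app (n : ℕ) (v : Cᵒᵖ) (a : FreeAbelianGroup (Tup Cᵒᵖ (n + 2) v)) :
    (modDiff C n).app v a = (-1 : ℤ) ^ (n + 1) • bdryFun n v a := rfl

lemma neg_one_zsmul_eq_zero {G : Type*} [AddCommGroup G] (n : ℕ) {a : G} :
    (-1 : ℤ) ^ n • a = 0 ↔ a = 0 := by
  rcases neg_one_pow_eq_or ℤ n with h | h <;> simp [h]

lemma neg_one_zsmul_zsmul {G : Type*} [AddCommGroup G] (n : ℕ) (a : G) :
    (-1 : ℤ) ^ n • (-1 : ℤ) ^ n • a = a := by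
  rcases neg_one_pow_eq_or ℤ n with h | h <;> simp [h]

lemma modDiff_exact (n : ℕ) (v : Cᵒᵖ) (a : (barObj Cᵒᵖ (n + 1)).obj v) :
    (modDiff C n).app v a = 0 ↔ ∃ b, (modDiff C (n + 1)).app v b = a := by
  refine (neg_one_zsmul_eq_zero (n + 1)).trans ((barD_exact (n + 1) v a).trans ?_)
  constructor
  · rintro ⟨b, rfl⟩
    refine ⟨(-1 : ℤ) ^ (n + 2) • b, ?_⟩
    exact (congrArg ((-1 : ℤ) ^ (n + 2) • ·) (map_zsmul (bdryFun (n + 1) v) _ b)).trans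
      (neg_one_zsmul_zsmul _ _)
  · rintro ⟨b, rfl⟩
    exact ⟨(-1 : ℤ) ^ (n + 2) • b, map_zsmul (bdryFun (n + 1) v) _ b⟩

lemma modD_exact_zero (v : Cᵒᵖ) (a : (barObj Cᵒᵖ 0).obj v) :
    (barD Cᵒᵖ 0).app v a = 0 ↔ ∃ b, (modDiff C 0).app v b = a := by
  refine (barD_exact 0 v a).trans ?_
  constructor
  · rintro ⟨b, rfl⟩
    refine ⟨(-1 : ℤ) ^ 1 • b, ?_⟩
    exact (congrArg ((-1 : ℤ) ^ 1 • ·) (map_zsmul (bdryFun 0 v) _ b)).trans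
      (neg_one_zsmul_zsmul _ _)
  · rintro ⟨b, rfl⟩
    exact ⟨(-1 : ℤ) ^ 1 • b, map_zsmul (bdryFun 0 v) _ b⟩

end

section

variable {k : ℕ} {Λ : Type u} [SmallCategory Λ] [KGraph k Λ]

open KGraph InfPath GSheaf

/-- The maps of the complex of sheaves of the modules `Pⁿ`, with values in the constant sheaf `ℤ`
(identified with the sheaf of the constant module `ℤ`) for `n = 0`. -/
def uResD : (n : ℕ) → ((uSheaf (barObj Λᵒᵖ n) : GSheaf (InfPath k Λ)) ⟶
    prev (constZ (InfPath k Λ)) (fun n => uSheaf (barObj Λᵒᵖ n)) n)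
  | 0 => uMap (barD Λᵒᵖ 0) ≫ uConst _
  | n + 1 => uMap (modDiff Λ n)

variable (k Λ) in
/-- The resolution of the constant sheaf `ℤ` by the sheaves of the modules `Pⁿ`. -/
def uRes : Resolution (InfPath k Λ) where
  obj n := uSheaf (barObj Λᵒᵖ n)
  d := uResD
  exact
    | 0, x, a => by
      refine ⟨fun _ => ?_, fun _ => trivial⟩
      change a ∈ Set.range (app (uMap (barD Λᵒᵖ 0) ≫ uConst _) x)
      obtain ⟨b, hb⟩ := barD_zero_surjective (op (x.obj 0)) a
      refine ⟨germS (barObj Λᵒᵖ 0) x 0 rfl b, ?_⟩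
      refine (congrArg (app (uConst _) x) (uMap_germ (barD Λᵒᵖ 0) x 0 rfl b)).trans ?_
      exact (uConst_germ _ x 0 rfl _).trans hb
    | 1, x, a => by
      refine Iff.trans ?_ (uMap_exact (α := modDiff Λ 0) (β := barD Λᵒᵖ 0) modD_exact_zero x a)
      refine ⟨fun h => uConst_eq_zero _ x _ h, fun h => ?_⟩
      exact (congrArg (app (uConst _) x) h).trans (map_zero (app (uConst _) x))
    | n + 2, x, a =>
      uMap_exact (α := modDiff Λ (n + 1)) (β := modDiff Λ n) (modDiff_exact n) x a

/-- The functor from modules to sheaves on homomorphisms out of `Pⁿ`. -/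
def uHomMap (A : Λᵒᵖ ⥤ AddCommGrpCat.{u}) (n : ℕ) :
    (barObj Λᵒᵖ n ⟶ A) →+ ((uRes k Λ).obj n ⟶ uSheaf A) :=
  AddMonoidHom.mk' (fun c => uMap c) uMap_add

lemma diff_uHomMap (A : Λᵒᵖ ⥤ AddCommGrpCat.{u}) (n : ℕ) (c : barObj Λᵒᵖ n ⟶ A) :
    (uRes k Λ).diff n ≫ uHomMap A n c = uHomMap A (n + 1) (modDiff Λ n ≫ c) :=
  (uMap_comp (modDiff Λ n) c).symm

/-- The homomorphism `[c] ↦ [c̲]` induced on cohomology by the functor from modules to sheaves. -/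
def underline (A : Λᵒᵖ ⥤ AddCommGrpCat.{u}) (n : ℕ) :
    ModCoh A n →+ (uRes k Λ).Coh (uSheaf A) n :=
  SubQuot.map (uHomMap A n)
    (by
      intro c hc
      refine (diff_uHomMap A n c).trans ?_
      rw [show modDiff Λ n ≫ c = 0 from hc, map_zero])
    (by
      cases n with
      | zero =>
        intro c hc
        obtain rfl : c = 0 := hc
        exact map_zero (uHomMap A 0)
      | succ n =>
        rintro _ ⟨b, rfl⟩
        exact ⟨uHomMap A n b, diff_uHomMap A n b⟩)

/-! ### The chain map between the two resolutions -/

lemma concat_unique {u v : Λ} {l : u ⟶ v} {y z : InfPath k Λ} {hy : y.obj 0 = u}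
    (h : z.pre (deg l) = ⟨l⟩) (h' : shift (deg l) z = y) : concat l y hy = z :=
  ext_shift ((pre_concat l y hy).trans h.symm) ((shift_concat l y hy).trans h'.symm)

lemma concat_comp {u v w : Λ} (f : u ⟶ v) (l : v ⟶ w) (y : InfPath k Λ) (hy : y.obj 0 = u) :
    concat (f ≫ l) y hy = concat l (concat f y hy) (concat_obj_zero f y hy) := by
  set z := concat l (concat f y hy) (concat_obj_zero f y hy) with hz
  have h1 : z.pre (deg l) = ⟨l⟩ := pre_concat _ _ _
  have h2 : shift (deg l) z = concat f y hy := shift_concat _ _ _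
  have h3 : z.seg (le_self_add (a := deg l) (b := deg f)) = ⟨f⟩ := by
    have : (shift (deg l) z).pre (deg f) = ⟨f⟩ := by rw [h2, pre_concat]
    exact this
  refine concat_unique ?_ ?_
  · rw [deg_comp]
    have : z.pre (deg l + deg f) = ⟨z.map (le_self_add (a := deg l) (b := deg f)) ≫
        z.map (zero_le' (deg l))⟩ := by rw [z.map_comp]; rfl
    rw [this]
    exact arr_comp_congr h3 h1
  · rw [deg_comp, ← shift_shift, h2, shift_concat]

lemma concat_seg (x : InfPath k Λ) {p q : Fin k → ℕ} (h : p ≤ q) :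
    concat (x.map h) (shift q x) rfl = shift p x := by
  obtain ⟨m, rfl⟩ := exists_add_of_le h
  have hd : deg (x.map h) = m := (x.deg_map h).trans (add_tsub_cancel_left p m)
  refine concat_unique ?_ ?_
  · rw [hd]
    rfl
  · rw [hd, shift_shift]

lemma shift_obj_zero {x : InfPath k Λ} {p : Fin k → ℕ} {v : Λ} (h : x.obj p = v) :
    (shift p x).obj 0 = v := h

/-- The arrow `(x, p, σᵖ(x))`. -/
def toShift (p : Fin k → ℕ) (x : InfPath k Λ) : shift p x ⟶ x :=
  (⟨fun i => p i, p, 0, by funext i; simp, (shift_zero _).symm⟩ : GHom _ _)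

lemma isPair_toShift (p : Fin k → ℕ) (x : InfPath k Λ) : GHom.IsPair (toShift p x) p 0 :=
  ⟨by funext i; simp [toShift], (shift_zero _).symm⟩

/-- The arrow `(y, -d(λ), λy)`. -/
def ofConcat {u v : Λ} (l : u ⟶ v) (y : InfPath k Λ) (hy : y.obj 0 = u) : concat l y hy ⟶ y :=
  (⟨fun i => -(deg l i : ℤ), 0, deg l, by funext i; simp,
    (shift_zero y).trans (shift_concat l y hy).symm⟩ : GHom _ _)

lemma isPair_ofConcat {u v : Λ} (l : u ⟶ v) (y : InfPath k Λ) (hy : y.obj 0 = u) :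
    GHom.IsPair (ofConcat l y hy) 0 (deg l) :=
  ⟨by funext i; simp [ofConcat], (shift_zero y).trans (shift_concat l y hy).symm⟩

/-- For composable `(λ₁, …, λₙ)` with `s(λₙ) = y(0)`, the tuple
`((y, -d(λₙ), λₙy), (λₙy, -d(λₙ₋₁), λₙ₋₁λₙy), …)`. -/
def psiTup : ∀ {n : ℕ} {w : Λᵒᵖ}, Tup Λᵒᵖ n w → ∀ y : InfPath k Λ, y.obj 0 = w.unop →
    Tup (InfPath k Λ) n y
  | _, _, .nil, _, _ => .nil
  | _, _, .cons g t, y, hy =>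
    .cons (ofConcat g.unop y hy) (psiTup t (concat g.unop y hy) (concat_obj_zero g.unop y hy))

lemma cons_psiTup_congr {n : ℕ} {w : Λᵒᵖ} (t : Tup Λᵒᵖ n w) {x y y' : InfPath k Λ} (e : y = y')
    (hy : y.obj 0 = w.unop) (hy' : y'.obj 0 = w.unop) (g : y ⟶ x) (g' : y' ⟶ x)
    (hg : GHom.lag g = GHom.lag g') :
    Tup.cons g (psiTup t y hy) = Tup.cons g' (psiTup t y' hy') := by
  subst e
  rw [show g = g' from GHom.ext' hg]

lemma lag_comp {x y z : InfPath k Λ} (f : x ⟶ y) (g : y ⟶ z) :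
    GHom.lag (f ≫ g) = GHom.lag g + GHom.lag f := rfl

lemma psiTup_face : ∀ (n j : ℕ) {w : Λᵒᵖ} (t : Tup Λᵒᵖ (n + 1) w) (y : InfPath k Λ)
    (hy : y.obj 0 = w.unop), psiTup (face n j t) y hy = face n j (psiTup t y hy)
  | 0, _, _, .cons _ _, _, _ => rfl
  | n + 1, 0, _, .cons g (.cons h p), y, hy => by
    refine cons_psiTup_congr p (concat_comp g.unop h.unop y hy) _ _ _ _ ?_
    rw [lag_comp]
    funext i
    change -(deg (g.unop ≫ h.unop) i : ℤ) = -(deg g.unop i : ℤ) + -(deg h.unop i : ℤ)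
    rw [deg_comp, Pi.add_apply]
    push_cast
    ring
  | n + 1, j + 1, _, .cons g p, y, hy =>
    congrArg (Tup.cons _) (psiTup_face n j p _ (concat_obj_zero g.unop y hy))

/-- The sign `(-1)^⌈n/2⌉`. -/
def psiSign (n : ℕ) : ℤ := (-1) ^ ((n + 1) / 2)

lemma psiSign_mul (n : ℕ) : (-1) ^ (n + 1) * psiSign n = psiSign (n + 1) := by
  have h : (n + 1) + (n + 1) / 2 = (n + 1 + 1) / 2 + 2 * ((n + 1) / 2) := by omega
  rw [psiSign, psiSign, ← pow_add, h, pow_add, pow_mul]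
  simp

/-- `[λ₀, …, λₙ] ↦ (x, p - d(λₙ), λₙσᵖ(x)), (λₙσᵖ(x), -d(λₙ₋₁), λₙ₋₁λₙσᵖ(x)), …`. -/
def psiGen (n : ℕ) (x : InfPath k Λ) (p : Fin k → ℕ) {v : Λ} (h : x.obj p = v)
    (t : Tup Λᵒᵖ (n + 1) (op v)) : Tup (InfPath k Λ) (n + 1) x :=
  Tup.act (toShift p x) (psiTup t (shift p x) (shift_obj_zero h))

/-- `ψₙ` on the `p`-th term of the direct system. -/
def psiFun (n : ℕ) (x : InfPath k Λ) (p : Fin k → ℕ) {v : Λ} (h : x.obj p = v) :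
    FreeAbelianGroup (Tup Λᵒᵖ (n + 1) (op v)) →+ FreeAbelianGroup (Tup (InfPath k Λ) (n + 1) x) :=
  psiSign n • FreeAbelianGroup.map (psiGen n x p h)

lemma psiFun_of (n : ℕ) (x : InfPath k Λ) (p : Fin k → ℕ) {v : Λ} (h : x.obj p = v)
    (t : Tup Λᵒᵖ (n + 1) (op v)) :
    psiFun n x p h (.of t) = psiSign n • FreeAbelianGroup.of (psiGen n x p h t) := by
  rw [psiFun, AddMonoidHom.smul_apply, FreeAbelianGroup.map_of_apply]

lemma psiGen_map (n : ℕ) (x : InfPath k Λ) {p q : Fin k → ℕ} (h : p ≤ q)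
    (t : Tup Λᵒᵖ (n + 1) (op (x.obj p))) :
    psiGen n x q rfl (Tup.act (x.map h).op t) = psiGen n x p rfl t := by
  rcases t with _ | ⟨g, t⟩
  refine cons_psiTup_congr t ?_ _ _ _ _ ?_
  · refine (concat_comp (x.map h) g.unop (shift q x) rfl).trans ?_
    have : ∀ z (hz : z.obj 0 = x.obj p), z = shift p x →
        concat g.unop z hz = concat g.unop (shift p x) rfl := by
      rintro _ _ rfl
      rfl
    exact this _ _ (concat_seg x h)
  · rw [lag_comp, lag_comp]
    funext i
    change (q i : ℤ) + -(deg (x.map h ≫ g.unop) i : ℤ) = (p i : ℤ) + -(deg g.unop i : ℤ)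
    rw [deg_comp, Pi.add_apply, x.deg_map, Pi.sub_apply]
    have : p i ≤ q i := h i
    omega

lemma psiGen_act (n : ℕ) {x y : InfPath k Λ} (g : y ⟶ x) {p q : Fin k → ℕ}
    (h : GHom.IsPair g p q) {v : Λ} (hy : y.obj q = v) (hx : x.obj p = v)
    (t : Tup Λᵒᵖ (n + 1) (op v)) :
    psiGen n x p hx t = Tup.act g (psiGen n y q hy t) := by
  rcases t with _ | ⟨l, t⟩
  refine cons_psiTup_congr t ?_ _ _ _ _ ?_
  · have : ∀ z z' (hz : z.obj 0 = v) (hz' : z'.obj 0 = v), z = z' →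
        concat l.unop z hz = concat l.unop z' hz' := by
      rintro _ _ _ _ rfl
      rfl
    exact this _ _ _ _ h.2
  · rw [lag_comp, lag_comp, lag_comp, h.1]
    funext i
    change (p i : ℤ) + -(deg l.unop i : ℤ) = (p i : ℤ) - q i + (q i + -(deg l.unop i : ℤ))
    ring

lemma continuous_shift (p : Fin k → ℕ) : Continuous (shift p : InfPath k Λ → InfPath k Λ) := by
  refine ⟨fun O hO => InfPath.isOpen_iff.2 fun x hx => ?_⟩
  obtain ⟨m, hm⟩ := InfPath.isOpen_iff.1 hO _ hx
  refine ⟨p + m, fun y hy => hm _ ?_⟩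
  exact seg_eq_of_pre hy le_self_add

lemma eventually_pre_eq {T : Type*} [TopologicalSpace T] {y : T → InfPath k Λ} (h : Continuous y)
    (s : T) (m : Fin k → ℕ) : ∀ᶠ s' in 𝓝 s, (y s').pre m = (y s).pre m :=
  h.continuousAt.eventually (eventually_pre (y s) m)

lemma continuous_inf_rng {T : Type*} [TopologicalSpace T] {y : T → InfPath k Λ}
    (h : ∀ s m, ∀ᶠ s' in 𝓝 s, (y s').pre m = (y s).pre m) : Continuous y := by
  refine continuous_iff_continuousAt.2 fun s O hO => ?_
  obtain ⟨U, hU, hUo, hs⟩ := mem_nhds_iff.1 hO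
  obtain ⟨m, hm⟩ := InfPath.isOpen_iff.1 hUo _ hs
  refine Filter.mem_map.2 ?_
  filter_upwards [h s m] with s' h' using hU (hm _ h')

lemma continuous_concat {T : Type*} [TopologicalSpace T] {y : T → InfPath k Λ} (h : Continuous y)
    {u v : Λ} (l : u ⟶ v) (hy : ∀ s, (y s).obj 0 = u) :
    Continuous fun s => concat l (y s) (hy s) := by
  refine continuous_inf_rng fun s m => ?_
  filter_upwards [eventually_pre_eq h s m] with s' h'
  refine pre_mono (n := deg l + m) le_add_self ?_
  refine seg_comp (h := zero_le' (deg l)) (j := zero_le' (deg l)) (h' := le_self_add)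
    (j' := le_self_add) ((pre_concat _ _ _).trans (pre_concat _ _ _).symm) ?_
  have : (shift (deg l) (concat l (y s') (hy s'))).pre m =
      (shift (deg l) (concat l (y s) (hy s))).pre m := by
    rw [shift_concat, shift_concat, h']
  exact this

lemma continuous_arr_of_isPair {T : Type*} [TopologicalSpace T] {γ : T → Arr (InfPath k Λ)}
    {j l : Fin k → ℕ} (h : ∀ s, (γ s).hom.IsPair j l) (hs : Continuous fun s => (γ s).src)
    (ht : Continuous fun s => (γ s).tgt) : Continuous γ := by
  refine continuous_iff_continuousAt.2 fun s O hO => ?_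
  obtain ⟨m, hm⟩ := GHom.exists_nb hO (h s)
  refine Filter.mem_map.2 ?_
  filter_upwards [eventually_pre_eq hs s (l + m), eventually_pre_eq ht s (j + m)] with s' h1 h2
  exact hm ⟨(h s').add m, h2, h1⟩

lemma continuous_psiTup : ∀ {n : ℕ} {w : Λᵒᵖ} (t : Tup Λᵒᵖ n w) {T : Type u} [TopologicalSpace T]
    {y : T → InfPath k Λ} (_ : Continuous y) (hy : ∀ s, (y s).obj 0 = w.unop),
    Continuous fun s => (⟨y s, psiTup t (y s) (hy s)⟩ : Tot (Tup (InfPath k Λ) n))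
  | _, _, .nil, _, _, _, h, _ => continuous_induced_rng.2 h
  | _, _, .cons g t, _, _, _, h, hy => by
    refine continuous_tup_rng ?_ ?_
    · exact continuous_arr_of_isPair (fun s => isPair_ofConcat g.unop _ (hy s))
        (continuous_concat h g.unop hy) h
    · exact continuous_psiTup t (continuous_concat h g.unop hy) fun s =>
        concat_obj_zero g.unop _ (hy s)

lemma continuous_psiGen (n : ℕ) (p : Fin k → ℕ) {v : Λ} (t : Tup Λᵒᵖ (n + 1) (op v)) {T : Type u}
    [TopologicalSpace T] {x : T → InfPath k Λ} (h : Continuous x) (hx : ∀ s, (x s).obj p = v) :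
    Continuous fun s => (⟨x s, psiGen n (x s) p (hx s) t⟩ : Tot (Tup (InfPath k Λ) (n + 1))) := by
  have hs := (continuous_shift p).comp h
  rcases t with _ | ⟨g, t⟩
  refine continuous_tup_rng ?_ ?_
  · refine continuous_arr_comp ?_ ?_
    · exact continuous_arr_of_isPair (fun s => isPair_ofConcat g.unop _ (hx s))
        (continuous_concat hs g.unop hx) hs
    · exact continuous_arr_of_isPair (fun s => isPair_toShift p (x s)) hs h
  · exact continuous_psiTup t (continuous_concat hs g.unop hx) fun s =>
      concat_obj_zero g.unop _ (hx s)

lemma continuous_psiFun (n : ℕ) (p : Fin k → ℕ) {v : Λ}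
    (a : FreeAbelianGroup (Tup Λᵒᵖ (n + 1) (op v))) {T : Type u} [TopologicalSpace T]
    {x : T → InfPath k Λ} (h : Continuous x) (hx : ∀ s, (x s).obj p = v) :
    Continuous fun s =>
      (⟨x s, psiFun n (x s) p (hx s) a⟩ : Tot (barSheaf (InfPath k Λ) n).stalk) := by
  have hof : ∀ t, Continuous fun s => (⟨x s, psiFun n (x s) p (hx s) (.of t)⟩ :
      Tot (barSheaf (InfPath k Λ) n).stalk) := fun t => by
    refine (continuous_mk_zsmul (F := barSheaf (InfPath k Λ) n)
      ((continuous_bar_of n).comp (continuous_psiGen n p t h hx)) (psiSign n)).congr fun s => ?_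
    exact congrArg (Tot.mk (x s)) (psiFun_of n (x s) p (hx s) t).symm
  induction a using FreeAbelianGroup.induction_on with
  | zero =>
    refine (continuous_mk_zero (F := barSheaf (InfPath k Λ) n) h).congr fun s => ?_
    exact congrArg (Tot.mk (x s)) (map_zero (psiFun n (x s) p (hx s))).symm
  | of t => exact hof t
  | neg t _ =>
    refine (continuous_mk_neg (F := barSheaf (InfPath k Λ) n) (hof t)).congr fun s => ?_
    exact congrArg (Tot.mk (x s)) (map_neg (psiFun n (x s) p (hx s)) _).symm
  | add a b ha hb =>
    refine (continuous_mk_add (F := barSheaf (InfPath k Λ) n) ha hb).congr fun s => ?_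
    exact congrArg (Tot.mk (x s)) (map_add (psiFun n (x s) p (hx s)) _ _).symm

variable (k Λ) in
/-- The morphism `ψₙ` from the sheaf of the module `Pⁿ` to `ℤ[G⁽ⁿ⁺¹⁾]`.  Writing
`φˣ_p[λ₀, …, λₙ] = ((x, m, y), (λ₀, …, λₙ₋₁))` with `m = p - d(λₙ)` and `y = λₙσᵖ(x)`, it is given by
`ψₙ((x, m, y), (λ₀, …, λₙ₋₁)) = (-1)^⌈n/2⌉ [(x, m, y), (y, -d(λₙ₋₁), λₙ₋₁y), …]`. -/
def psi (n : ℕ) : (uRes k Λ).obj n ⟶ (barRes (InfPath k Λ)).obj n :=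
  uHom (A := barObj Λᵒᵖ n) (F := barSheaf (InfPath k Λ) n) (fun x p {_} h => psiFun n x p h)
    (fun x p q h a => by
      refine DFunLike.congr_fun
        (f := (psiFun n x q rfl).comp (FreeAbelianGroup.map (Tup.act (x.map h).op)))
        (g := psiFun n x p rfl) ?_ a
      ext t
      rw [AddMonoidHom.comp_apply, FreeAbelianGroup.map_of_apply, psiFun_of, psiFun_of,
        psiGen_map])
    (fun {y x} g {p q} h {v} hy hx a => by
      refine DFunLike.congr_fun (f := psiFun n x p hx)
        (g := (FreeAbelianGroup.map (Tup.act g)).comp (psiFun n y q hy)) ?_ a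
      ext t
      rw [AddMonoidHom.comp_apply, psiFun_of, psiFun_of, map_zsmul,
        FreeAbelianGroup.map_of_apply, psiGen_act n g h hy hx t])
    (fun l a => continuous_psiFun n (deg l.hom) a continuous_subtype_val _)

lemma psi_germ (n : ℕ) (x : InfPath k Λ) (p : Fin k → ℕ) {v : Λ} (h : x.obj p = v)
    (a : FreeAbelianGroup (Tup Λᵒᵖ (n + 1) (op v))) :
    app (psi k Λ n) x (germS (barObj Λᵒᵖ n) x p h a) = psiFun n x p h a :=
  uHom_germ (A := barObj Λᵒᵖ n) (F := barSheaf (InfPath k Λ) n)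
    (fun x p {_} h => psiFun n x p h) _ _ _ x p h a

lemma psiFun_bdry (n : ℕ) (x : InfPath k Λ) (p : Fin k → ℕ) {v : Λ} (h : x.obj p = v)
    (a : FreeAbelianGroup (Tup Λᵒᵖ (n + 2) (op v))) :
    psiFun n x p h ((-1 : ℤ) ^ (n + 1) • bdryFun n (op v) a) =
      bdryFun n x (psiFun (n + 1) x p h a) := by
  refine DFunLike.congr_fun (f := (psiFun n x p h).comp ((-1 : ℤ) ^ (n + 1) • bdryFun n (op v)))
    (g := (bdryFun n x).comp (psiFun (n + 1) x p h)) ?_ a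
  ext t
  rw [AddMonoidHom.comp_apply, AddMonoidHom.comp_apply, psiFun_of, map_zsmul, bdryFun_of,
    AddMonoidHom.smul_apply, map_zsmul, bdryFun_of, map_sum, Finset.smul_sum, Finset.smul_sum]
  refine Finset.sum_congr rfl fun j _ => ?_
  have : psiGen n x p h (face (n + 1) j t) = face (n + 1) j (psiGen (n + 1) x p h t) := by
    rw [psiGen, psiGen, face_act, psiTup_face]
  rw [map_zsmul, psiFun_of, this, smul_comm ((-1 : ℤ) ^ j), smul_smul, psiSign_mul]

lemma psi_comm (n : ℕ) :
    (uRes k Λ).diff n ≫ psi k Λ n = psi k Λ (n + 1) ≫ (barRes (InfPath k Λ)).diff n := by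
  refine hom_ext fun x e => ?_
  obtain ⟨p, -, a, rfl⟩ := germS_surjective (A := barObj Λᵒᵖ (n + 1)) e 0
  refine (congrArg (app (psi k Λ n) x) (uMap_germ (modDiff Λ n) x p rfl a)).trans ?_
  refine (psi_germ n x p rfl _).trans ?_
  refine Eq.trans ?_ (congrArg (bdryFun n x) (psi_germ (n + 1) x p rfl a)).symm
  exact psiFun_bdry n x p rfl a

/-- The map `ψₙ*` induced by `ψ` on cohomology. -/
def psiStar (A : GSheaf (InfPath k Λ)) (n : ℕ) :
    (barRes (InfPath k Λ)).Coh A n →+ (uRes k Λ).Coh A n :=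
  HomCoh.precomp (psi k Λ) psi_comm A n

end

/-! ### The maps of Kumjian, Pask and Sims -/

section

variable {k : ℕ} {Λ : Type u} [SmallCategory Λ] [KGraph k Λ]

open KGraph InfPath GSheaf

/-- The constant module `M^Λ` of an abelian group `M`. -/
abbrev constMod (Λ : Type u) [SmallCategory Λ] (M : AddCommGrpCat.{u}) :
    Λᵒᵖ ⥤ AddCommGrpCat.{u} := (Functor.const Λᵒᵖ).obj M

/-- The element of the stalk at `x` of the sheaf of `M^Λ` that corresponds to `m`. -/
def constVal (M : AddCommGrpCat.{u}) (x : InfPath k Λ) (m : M) :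
    (uSheaf (constMod Λ M)).stalk x := germS (constMod Λ M) x 0 rfl m

section

variable {M : AddCommGrpCat.{u}}

/-- The value `c(λ₁, …, λₙ) = c[λ₁, …, λₙ, s(λₙ)]` of the categorical cochain that corresponds to
`c : Pⁿ → M^Λ` (the tuple is written in reverse order, in the opposite category). -/
def catVal {n : ℕ} (c : barObj Λᵒᵖ n ⟶ constMod Λ M) {v : Λᵒᵖ} (t : Tup Λᵒᵖ n v) : M :=
  c.app v (FreeAbelianGroup.of (Tup.cons (𝟙 v) t) : FreeAbelianGroup (Tup Λᵒᵖ (n + 1) v))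

/-- `c(v)` for a vertex `v`. -/
def catVal₀ (c : barObj Λᵒᵖ 0 ⟶ constMod Λ M) (v : Λ) : M := catVal c (v := op v) .nil

/-- `c(λ)`. -/
def catVal₁ (c : barObj Λᵒᵖ 1 ⟶ constMod Λ M) (l : Arr Λ) : M := catVal c (.cons l.hom.op .nil)

/-- `c(μ, α)`, where `s(μ) = r(α)`. -/
def catVal₂ (c : barObj Λᵒᵖ 2 ⟶ constMod Λ M) {u v w : Λ} (μ : v ⟶ w) (α : u ⟶ v) : M :=
  catVal c (.cons α.op (.cons μ.op .nil))

/-- `s(x) = c(r(x))`. -/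
def IsKPS₀ (c : barObj Λᵒᵖ 0 ⟶ constMod Λ M)
    (s : cochains (uSheaf (constMod Λ M) : GSheaf (InfPath k Λ)) 0) : Prop :=
  ∀ x : InfPath k Λ, s.1 ⟨x, .nil⟩ = constVal M x (catVal₀ c (x.obj 0))

/-- `s(x, j - ℓ, y) = c(x(0, j)) - c(y(0, ℓ))` whenever `σʲ(x) = σˡ(y)`. -/
def IsKPS₁ (c : barObj Λᵒᵖ 1 ⟶ constMod Λ M)
    (s : cochains (uSheaf (constMod Λ M) : GSheaf (InfPath k Λ)) 1) : Prop :=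
  ∀ (x y : InfPath k Λ) (g : y ⟶ x) (j l : Fin k → ℕ), GHom.IsPair g j l →
    s.1 ⟨x, .cons g .nil⟩ = constVal M x (catVal₁ c (x.pre j) - catVal₁ c (y.pre l))

end

/-- A set `P` of pairs `(μ, ν)` with `s(μ) = s(ν)` such that the sets `Z(μ, ν)` form a partition of
the path groupoid. -/
def IsPartition (P : Set (Arr Λ × Arr Λ)) : Prop :=
  (∀ p ∈ P, p.1.src = p.2.src) ∧
    ∀ g : Arr (InfPath k Λ), ∃! p : Arr Λ × Arr Λ, p ∈ P ∧ g ∈ GHom.cyl p.1 p.2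

/-- For composable `g` and `h`: the pairs `(μ_g, ν_g)`, `(μ_h, ν_h)`, `(μ_gh, ν_gh)` in `P` whose
sets `Z(μ, ν)` contain `g`, `h` and `gh`, and paths `α`, `β`, `γ` and an infinite path `ω` with
`ν_g α = μ_h β`, `μ_g α = μ_gh γ`, `ν_h β = ν_gh γ`, such that
`g = (μ_g α ω, d(μ_g) - d(ν_g), ν_g α ω)` and `h = (μ_h β ω, d(μ_h) - d(ν_h), ν_h β ω)`. -/
structure KPSData (P : Set (Arr Λ × Arr Λ)) {x y z : InfPath k Λ} (g : y ⟶ x) (h : z ⟶ y) where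
  {v₁ : Λ}
  {v₂ : Λ}
  {v₃ : Λ}
  {a : Λ}
  {b : Λ}
  {c : Λ}
  {w : Λ}
  μg : a ⟶ v₁
  νg : a ⟶ v₂
  μh : b ⟶ v₂
  νh : b ⟶ v₃
  μgh : c ⟶ v₁
  νgh : c ⟶ v₃
  α : w ⟶ a
  β : w ⟶ b
  γ : w ⟶ c
  ω : InfPath k Λ
  ω_zero : ω.obj 0 = w
  mem_g : ((⟨μg⟩, ⟨νg⟩) : Arr Λ × Arr Λ) ∈ P
  mem_h : ((⟨μh⟩, ⟨νh⟩) : Arr Λ × Arr Λ) ∈ P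
  mem_gh : ((⟨μgh⟩, ⟨νgh⟩) : Arr Λ × Arr Λ) ∈ P
  g_mem : ⟨g⟩ ∈ GHom.cyl ⟨μg⟩ ⟨νg⟩
  h_mem : ⟨h⟩ ∈ GHom.cyl ⟨μh⟩ ⟨νh⟩
  gh_mem : ⟨h ≫ g⟩ ∈ GHom.cyl ⟨μgh⟩ ⟨νgh⟩
  eq₁ : α ≫ νg = β ≫ μh
  eq₂ : α ≫ μg = γ ≫ μgh
  eq₃ : β ≫ νh = γ ≫ νgh
  x_eq : x = concat (α ≫ μg) ω ω_zero
  y_eq : y = concat (α ≫ νg) ω ω_zero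
  z_eq : z = concat (β ≫ νh) ω ω_zero

/-- `s(g, h) = c(μ_g, α) - c(ν_g, α) + c(μ_h, β) - c(ν_h, β) - c(μ_gh, γ) + c(ν_gh, γ)` for all
composable `g`, `h` and all choices of `α`, `β`, `γ`, `ω` (and there is such a choice). -/
def IsKPS₂ (P : Set (Arr Λ × Arr Λ)) {M : AddCommGrpCat.{u}}
    (c : barObj Λᵒᵖ 2 ⟶ constMod Λ M)
    (s : cochains (uSheaf (constMod Λ M) : GSheaf (InfPath k Λ)) 2) : Prop :=
  ∀ (x y z : InfPath k Λ) (g : y ⟶ x) (h : z ⟶ y), Nonempty (KPSData P g h) ∧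
    ∀ D : KPSData P g h, s.1 ⟨x, .cons g (.cons h .nil)⟩ = constVal M x
      (catVal₂ c D.μg D.α - catVal₂ c D.νg D.α + catVal₂ c D.μh D.β - catVal₂ c D.νh D.β
        - catVal₂ c D.μgh D.γ + catVal₂ c D.νgh D.γ)

/-- The homomorphism `κ` on cohomology is induced by the correspondence `R` between cochains: every
cocycle `c` corresponds to some continuous cocycle `s`, and `κ[c] = [s]` for every such `s`. -/
def IsInducedBy {M : AddCommGrpCat.{u}} {n : ℕ}
    (κ : ModCoh (constMod Λ M) n →+
      ContCoh (uSheaf (constMod Λ M) : GSheaf (InfPath k Λ)) n)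
    (R : (barObj Λᵒᵖ n ⟶ constMod Λ M) →
      cochains (uSheaf (constMod Λ M) : GSheaf (InfPath k Λ)) n → Prop) : Prop :=
  ∀ c : homZ (barObj Λᵒᵖ) (modDiff Λ) (constMod Λ M) n,
    (∃ s : contZ (uSheaf (constMod Λ M) : GSheaf (InfPath k Λ)) n, R c.1 s.1) ∧
    ∀ s : contZ (uSheaf (constMod Λ M) : GSheaf (InfPath k Λ)) n, R c.1 s.1 →
      κ (SubQuot.mk c) = SubQuot.mk s

end


end

end KGraphCoh

/-!
The theorem has three ingredients.

**The maps `η` and `ρ`.**  An equivariant morphism out of `ℤ[G⁽ⁿ⁺¹⁾]` is determined by its values on the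
tuples `[r(γ₁), γ₁, …, γₙ]`, and these form an arbitrary continuous cochain, so that `η` is bijective
already on cochains (`etaHom_bijective`).  A chain map over the identity of `ℤ` induces morphisms
between the exact sequences of corresponding cocycles by the universal property of the pushout
(`rhoExt_hom`).  For the chain map `ψ` this gives `ρ ∘ ψ* = ρ` (`rho_psiStar`); for the identity, and
the cocycle `(c₁, c₂)` with values in `A ⊕ A`, whose images under the two projections and under their
sum are `c₁`, `c₂` and `c₁ + c₂`, it gives the additivity of `ρ` with respect to Baer sums
(`rho_isSum`).

**The cocycles of Kumjian, Pask and Sims.**  They are constructed here from a level function: a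
locally constant choice of `j` and `ℓ` with `g = (x, j - ℓ, y)`, `σʲ(x) = σˡ(y)`, for each `g`
(`Level`).  A partition into sets `Z(μ, ν)` yields the level function `(d(μ_g), d(ν_g))`.  Let `c` be a
2-cocycle.  For a second presentation `g = (x, a - b, y)` with `j ≤ a` put
`Δ(g; a, b) = c(x(0, j), x(j, a)) - c(y(0, ℓ), y(ℓ, b))`; the cocycle of `c` takes `(g, h)` to
`Δ(g; a, b) + Δ(h; b, e) - Δ(gh; a, e)`.  The cocycle identity of `c` makes `Δ` additive in towers of
presentations (`levelDiff_trans`), whence this does not depend on `(a, b, e)` (`kpsTriple_eq`), it is a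
cocycle (`kpsFun_cocycle`) and its class does not depend on the level function
(`kpsTwo_sub_mem_contB`).  When `(a, b, e)` is read off from paths `α`, `β` and `γ`, it is the formula
of Kumjian, Pask and Sims (`kpsTwo_level_apply`).

**Comparison with `ψ`.**  The level function that presents `n` by `(n⁺ + N, n⁻ + N)` with the least
possible `N` is locally constant.  It also yields a partition (`exists_isPartition`).  It takes
`(y, -d(λ), λy)` to `(0, d(λ))`, so that the 2-cocycle of this level function on the pairs occurring in
`ψ` is `c(v, v) - c(λ₀, λ₁)` with `v = r(λ₁)` (`kpsTwo_min_apply`).  As `ψ₂` carries the sign `-1`, and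
`c(v, v)` is the value of a coboundary, `ψ* ∘ η ∘ κ` is `[c] ↦ [c̲]`.  In degrees 0 and 1 no correction
is needed.
-/

namespace KGraphCoh

noncomputable section

/-! ### Continuous cochains and morphisms out of the bar resolution -/

lemma SubQuot.mk_eq_zero {G : Type*} [AddCommGroup G] {Z B : AddSubgroup G} {c : Z} :
    (SubQuot.mk c : SubQuot Z B) = 0 ↔ c.1 ∈ B := QuotientAddGroup.eq_zero_iff _

lemma SubQuot.mk_sub {G : Type*} [AddCommGroup G] {Z B : AddSubgroup G} (c c' : Z) :
    (SubQuot.mk (c - c') : SubQuot Z B) = SubQuot.mk c - SubQuot.mk c' := rfl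

/-- A bijective homomorphism under which cocycles and coboundaries correspond to each other induces
a bijection on cohomology. -/
lemma SubQuot.map_bijective {G G' : Type*} [AddCommGroup G] [AddCommGroup G']
    {Z B : AddSubgroup G} {Z' B' : AddSubgroup G'} {f : G →+ G'} (hf : Function.Bijective f)
    (hZ : ∀ c ∈ Z, f c ∈ Z') (hB : ∀ c ∈ B, f c ∈ B')
    (hZ' : ∀ c, f c ∈ Z' → c ∈ Z) (hB' : ∀ c, f c ∈ B' → c ∈ B) :
    Function.Bijective (SubQuot.map f hZ hB : SubQuot Z B →+ SubQuot Z' B') := by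
  constructor
  · refine (injective_iff_map_eq_zero _).2 fun a h => ?_
    obtain ⟨c, rfl⟩ := QuotientAddGroup.mk_surjective a
    exact mk_eq_zero.2 (hB' c.1 (mk_eq_zero.1 h))
  · intro a
    obtain ⟨⟨c, hc⟩, rfl⟩ := QuotientAddGroup.mk_surjective a
    obtain ⟨c, rfl⟩ := hf.2 c
    exact ⟨SubQuot.mk ⟨c, hZ' c hc⟩, rfl⟩

section

variable {X : Type u} [EtaleGroupoid X]

open GSheaf

lemma continuous_id_arr : Continuous fun x : X => (⟨𝟙 x⟩ : Arr X) := by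
  rw [continuous_iff_continuousAt]
  intro x
  have hloc := EtaleGroupoid.isLocalHomeomorph_tgt (X := X)
  -- Near `x` the unit map is `γ ↦ γ⁻¹γ` along a local section `γ` of the range map through `𝟙 x`.
  obtain ⟨φ, hφ, hE⟩ := hloc ⟨𝟙 x⟩
  have hx : φ ⟨𝟙 x⟩ = x := by rw [← hE]
  have hxt : x ∈ φ.target := hx ▸ φ.map_source hφ
  have hs : ContinuousOn φ.symm φ.target := φ.continuousOn_symm
  have hc : Continuous fun z : φ.target => φ.symm z := hs.domRestrict
  have h1 : Continuous fun z : φ.target =>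
      (⟨Groupoid.inv (φ.symm z).hom ≫ (φ.symm z).hom⟩ : Arr X) :=
    continuous_arr_comp (f := fun z : φ.target => Groupoid.inv (φ.symm z).hom)
      (EtaleGroupoid.continuous_inv.comp hc) hc
  have h2 : Continuous fun z : φ.target => (⟨𝟙 z.1⟩ : Arr X) := by
    refine h1.congr fun z => ?_
    have : (φ.symm z).tgt = z.1 := by
      have := φ.right_inv z.2
      rwa [← hE] at this
    rw [Groupoid.inv_comp, this]
  have h3 : ContinuousOn (fun z : X => (⟨𝟙 z⟩ : Arr X)) φ.target :=
    continuousOn_iff_continuous_domRestrict.2 h2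
  exact h3.continuousAt (φ.open_target.mem_nhds hxt)

lemma continuous_cons_id (n : ℕ) : Continuous fun t : Tot (Tup X n) =>
    (⟨t.base, .cons (𝟙 t.base) t.val⟩ : Tot (Tup X (n + 1))) :=
  continuous_tup_rng (continuous_id_arr.comp (tup_isLocalHomeomorph n).continuous) continuous_id

/-- Every morphism `c` out of `ℤ[G⁽ⁿ⁺¹⁾]` comes from the cochain
`f(γ₁, …, γₙ) = c[r(γ₁), γ₁, …, γₙ]`. -/
lemma etaHom_bijective (A : GSheaf X) (n : ℕ) : Function.Bijective (etaHom A n) := by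
  constructor
  · refine (injective_iff_map_eq_zero _).2 fun f h => Subtype.ext (funext fun t => ?_)
    have h1 : etaFun A f.1 t.base (.of (.cons (𝟙 _) t.val)) = 0 :=
      congrArg (fun φ => app φ t.base
        (FreeAbelianGroup.of (Tup.cons (𝟙 t.base) t.val) :
          FreeAbelianGroup (Tup X (n + 1) t.base))) h
    rw [etaFun_of, A.act.map_id] at h1
    exact h1
  · intro c
    refine ⟨⟨fun t => app c t.base (FreeAbelianGroup.of (Tup.cons (𝟙 t.base) t.val) :
      FreeAbelianGroup (Tup X (n + 1) t.base)), ?_⟩, hom_ext fun x a => ?_⟩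
    · exact (continuous_hom c).comp ((continuous_bar_of n).comp (continuous_cons_id n))
    · refine (app_etaHom A n _ x a).trans (DFunLike.congr_fun (g := app c x) ?_ a)
      refine FreeAbelianGroup.lift_ext _ _ fun t => ?_
      rcases t with _ | ⟨γ, t⟩
      rw [etaFun_of]
      refine (app_naturality c γ _).symm.trans (congrArg (app c x) ?_)
      refine (FreeAbelianGroup.map_of_apply (f := Tup.act γ) _).trans ?_
      exact congrArg FreeAbelianGroup.of (congrArg (fun g => Tup.cons g t) (Category.id_comp γ))

lemma diff_etaHom_eq (A : GSheaf X) (n : ℕ) (f : cochains A n) (g : cochains A (n + 1)) :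
    (barRes X).diff n ≫ etaHom A n f = etaHom A (n + 1) g ↔ cobdry A n f.1 = g.1 := by
  refine ⟨fun h => funext fun t => ?_, fun h => hom_ext fun x a =>
    (diff_etaHom A n f x a).trans (by rw [h]; rfl)⟩
  have h1 : etaFun A (cobdry A n f.1) t.base (.of (.cons (𝟙 _) t.val)) =
      etaFun A g.1 t.base (.of (.cons (𝟙 _) t.val)) :=
    (diff_etaHom A n f t.base _).symm.trans (congrArg (fun φ => app φ t.base
        (FreeAbelianGroup.of (Tup.cons (𝟙 t.base) t.val) :
          FreeAbelianGroup (Tup X (n + 2) t.base))) h)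
  rw [etaFun_of, etaFun_of, A.act.map_id] at h1
  exact h1

lemma eta_bijective (A : GSheaf X) (n : ℕ) : Function.Bijective (eta A n) := by
  refine SubQuot.map_bijective (etaHom_bijective A n) _ _ (fun f hf => ?_) ?_
  · refine (diff_etaHom_eq A n f 0).1 ?_
    rw [map_zero]
    exact hf
  · cases n with
    | zero =>
      intro f hf
      exact (map_eq_zero_iff _ (etaHom_bijective A 0).1).1 hf
    | succ n =>
      rintro f ⟨b, hb⟩
      obtain ⟨b, rfl⟩ := (etaHom_bijective A n).2 b
      exact ⟨b, (diff_etaHom_eq A n b f).1 hb⟩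

/-! ### The maps `ρ` -/

lemma exists_app_d_zero (Q : Resolution X) (x : X) (z : (constZ X).stalk x) :
    ∃ p, app (Q.d 0) x p = z := (Q.exact 0 x z).1 trivial

lemma rhoZero_eq (Q : Resolution X) {A : GSheaf X} (c : homZ Q.obj Q.diff A 0) {f : constZ X ⟶ A}
    (h : Q.d 0 ≫ f = c.1) : rhoZero Q c = f := by
  refine hom_ext fun x z => ?_
  obtain ⟨p, rfl⟩ := exists_app_d_zero Q x z
  exact congrArg (fun φ => app φ x p) ((comp_rhoZero Q c).trans h.symm)

lemma pushout_hom_ext {Q A P T : GSheaf X} {c : Q ⟶ A} {θ : Q ⟶ P} {f g : pushout c θ ⟶ T}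
    (h : pushoutInl c θ ≫ f = pushoutInl c θ ≫ g) (h' : pushoutInr c θ ≫ f = pushoutInr c θ ≫ g) :
    f = g := by
  refine hom_ext fun x e => ?_
  obtain ⟨⟨a, p⟩, rfl⟩ := pushoutMk_surjective c θ x e
  have e1 : pushoutMk c θ x (a, p) = app (pushoutInl c θ) x a + app (pushoutInr c θ) x p := by
    refine Eq.trans ?_ (map_add (pushoutMk c θ x) (a, 0) (0, p))
    rw [Prod.mk_add_mk, add_zero, zero_add]
  rw [e1, map_add, map_add]
  exact congrArg₂ (· + ·) (congrArg (fun φ => app φ x a) h) (congrArg (fun φ => app φ x p) h')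

lemma pushoutInl_desc {Q A P T : GSheaf X} (c : Q ⟶ A) (θ : Q ⟶ P) (f : A ⟶ T) (g : P ⟶ T)
    (h : c ≫ f = θ ≫ g) : pushoutInl c θ ≫ pushoutDesc c θ f g h = f :=
  hom_ext fun x a => (pushoutDesc_mk c θ f g h x a 0).trans
    ((congrArg _ (map_zero (app g x))).trans (add_zero _))

lemma pushoutInr_desc {Q A P T : GSheaf X} (c : Q ⟶ A) (θ : Q ⟶ P) (f : A ⟶ T) (g : P ⟶ T)
    (h : c ≫ f = θ ≫ g) : pushoutInr c θ ≫ pushoutDesc c θ f g h = g :=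
  hom_ext fun x a => (pushoutDesc_mk c θ f g h x 0 a).trans
    ((congrArg (· + app g x a) (map_zero (app f x))).trans (zero_add _))

/-- A chain map over the identity of `ℤ` together with a morphism of coefficients induces a morphism
between the exact sequences of corresponding cocycles. -/
lemma rhoExt_hom {Q Q' : Resolution X} (ψ : ∀ n, Q.obj n ⟶ Q'.obj n)
    (h0 : ψ 0 ≫ Q'.d 0 = Q.d 0) (hψ : ∀ n, Q.diff n ≫ ψ n = ψ (n + 1) ≫ Q'.diff n)
    {A A' : GSheaf X} (α : A ⟶ A') {m : ℕ} (c : homZ Q.obj Q.diff A (m + 1))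
    (c' : homZ Q'.obj Q'.diff A' (m + 1)) (h : ψ (m + 1) ≫ c'.1 = c.1 ≫ α) :
    Nonempty (NExt.Hom α (rhoExt Q c) (rhoExt Q' c')) := by
  have hd : ∀ n, Q.d n ≫ prevMap ψ n = ψ n ≫ Q'.d n := fun n => match n with
    | 0 => (Category.comp_id _).trans h0.symm
    | n + 1 => hψ n
  have e : c.1 ≫ α ≫ pushoutInl c'.1 (Q'.diff m) =
      Q.diff m ≫ ψ m ≫ pushoutInr c'.1 (Q'.diff m) := by
    rw [← Category.assoc, ← h, Category.assoc, pushout_condition, ← Category.assoc, ← hψ,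
      Category.assoc]
  refine ⟨⟨ψ, pushoutDesc c.1 (Q.diff m) _ _ e, fun n _ => hd n, ?_, pushoutInl_desc _ _ _ _ _⟩⟩
  have z : c.1 ≫ 0 = Q.diff m ≫ Q.d m := by rw [Limits.comp_zero, Q.diff_comp_d]
  have z' : c'.1 ≫ 0 = Q'.diff m ≫ Q'.d m := by rw [Limits.comp_zero, Q'.diff_comp_d]
  change pushoutDesc c.1 (Q.diff m) 0 (Q.d m) z ≫ prevMap ψ m =
    pushoutDesc c.1 (Q.diff m) _ _ e ≫ pushoutDesc c'.1 (Q'.diff m) 0 (Q'.d m) z'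
  refine pushout_hom_ext ?_ ?_
  · rw [← Category.assoc, ← Category.assoc, pushoutInl_desc, pushoutInl_desc, Category.assoc,
      pushoutInl_desc, Limits.zero_comp, Limits.comp_zero]
  · rw [← Category.assoc, ← Category.assoc, pushoutInr_desc, pushoutInr_desc, Category.assoc,
      pushoutInr_desc, hd]

lemma rhoExt_postcomp (Q : Resolution X) {A A' : GSheaf X} (α : A ⟶ A') {m : ℕ}
    (c : homZ Q.obj Q.diff A (m + 1)) (c' : homZ Q.obj Q.diff A' (m + 1)) (h : c'.1 = c.1 ≫ α) :
    Nonempty (NExt.Hom α (rhoExt Q c) (rhoExt Q c')) :=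
  rhoExt_hom (fun _ => 𝟙 _) (Category.id_comp _)
    (fun _ => (Category.comp_id _).trans (Category.id_comp _).symm) α c c'
    ((Category.id_comp _).trans h)

/-- The direct sum `A ⊕ A`, realized as the pushout of two zero maps. -/
def biconeSelf (A : GSheaf X) : Limits.BinaryBicone A A where
  pt := pushout (0 : A ⟶ A) (0 : A ⟶ A)
  fst := pushoutDesc 0 0 (𝟙 A) 0 (by simp)
  snd := pushoutDesc 0 0 0 (𝟙 A) (by simp)
  inl := pushoutInl 0 0
  inr := pushoutInr 0 0
  inl_fst := pushoutInl_desc _ _ _ _ _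
  inl_snd := pushoutInl_desc _ _ _ _ _
  inr_fst := pushoutInr_desc _ _ _ _ _
  inr_snd := pushoutInr_desc _ _ _ _ _

lemma biconeSelf_isBilimit (A : GSheaf X) : Nonempty (biconeSelf A).IsBilimit := by
  refine ⟨Limits.isBinaryBilimitOfTotal _ (pushout_hom_ext (c := (0 : A ⟶ A)) (θ := 0) ?_ ?_)⟩
  · change (biconeSelf A).inl ≫ _ = (biconeSelf A).inl ≫ _
    simp
  · change (biconeSelf A).inr ≫ _ = (biconeSelf A).inr ≫ _
    simp

/-- The classes of `c₁`, `c₂` and `c₁ + c₂` are images of the class of `(c₁, c₂)`, a cocycle with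
values in `A ⊕ A`. -/
lemma rho_isSum (Q : Resolution X) (A : GSheaf X) (n : ℕ) (a b : Q.Coh A n) :
    IsSum n (rho Q A n a) (rho Q A n b) (rho Q A n (a + b)) := by
  obtain ⟨c, rfl⟩ := QuotientAddGroup.mk_surjective a
  obtain ⟨c', rfl⟩ := QuotientAddGroup.mk_surjective b
  cases n with
  | zero =>
    refine rhoZero_eq Q (c + c') ?_
    refine (Preadditive.comp_add _ _ _ _ _ _).trans ?_
    exact congrArg₂ (· + ·) (comp_rhoZero Q c) (comp_rhoZero Q c')
  | succ m =>
    let D := biconeSelf A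
    let e : homZ Q.obj Q.diff D.pt (m + 1) := ⟨c.1 ≫ D.inl + c'.1 ≫ D.inr, by
      change Q.diff (m + 1) ≫ _ = 0
      rw [Preadditive.comp_add, ← Category.assoc, ← Category.assoc,
        show Q.diff (m + 1) ≫ c.1 = 0 from c.2, show Q.diff (m + 1) ≫ c'.1 = 0 from c'.2]
      simp⟩
    refine ⟨rhoExt Q c, rhoExt Q c', rhoExt Q (c + c'), rfl, rfl, rfl, D, rhoExt Q e,
      biconeSelf_isBilimit A, rhoExt_postcomp Q _ _ _ ?_, rhoExt_postcomp Q _ _ _ ?_,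
      rhoExt_postcomp Q _ _ _ ?_⟩
    · simp [e]
    · simp [e]
    · simp [e]

lemma rho_precomp {Q Q' : Resolution X} (ψ : ∀ n, Q.obj n ⟶ Q'.obj n)
    (h0 : ψ 0 ≫ Q'.d 0 = Q.d 0) (hψ : ∀ n, Q.diff n ≫ ψ n = ψ (n + 1) ≫ Q'.diff n)
    (A : GSheaf X) (n : ℕ) (a : Q'.Coh A n) :
    rho Q A n (HomCoh.precomp ψ hψ A n a) = rho Q' A n a := by
  obtain ⟨c, rfl⟩ := QuotientAddGroup.mk_surjective a
  cases n with
  | zero =>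
    refine congrArg ULift.up (rhoZero_eq Q _ ?_)
    exact (congrArg (· ≫ rhoZero Q' c) h0.symm).trans
      ((Category.assoc _ _ _).trans (congrArg (ψ 0 ≫ ·) (comp_rhoZero Q' c)))
  | succ m => exact Quot.sound (rhoExt_hom ψ h0 hψ (𝟙 A) _ c (Category.comp_id _).symm)

end

section

variable {k : ℕ} {Λ : Type u} [SmallCategory Λ] [KGraph k Λ]

open KGraph InfPath GSheaf

lemma psi_zero_comp_d : psi k Λ 0 ≫ (barRes (InfPath k Λ)).d 0 = (uRes k Λ).d 0 := by
  refine hom_ext fun x e => ?_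
  obtain ⟨p, -, a, rfl⟩ := germS_surjective (A := barObj Λᵒᵖ 0) e 0
  refine (congrArg (augFun x) (psi_germ 0 x p rfl a)).trans ?_
  refine Eq.symm ((congrArg (app (uConst _) x) (uMap_germ (barD Λᵒᵖ 0) x p rfl a)).trans ?_)
  refine (uConst_germ _ x p rfl _).trans ?_
  refine DFunLike.congr_fun (f := augFun (op (x.obj p)))
    (g := (augFun x).comp (psiFun 0 x p rfl)) ?_ a
  refine FreeAbelianGroup.lift_ext _ _ fun t => ?_
  rw [AddMonoidHom.comp_apply, psiFun_of, map_zsmul, augFun_of, augFun_of]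
  exact (one_zsmul _).symm

lemma rho_psiStar (A : GSheaf (InfPath k Λ)) (n : ℕ) (a : (barRes (InfPath k Λ)).Coh A n) :
    rho (uRes k Λ) A n (psiStar A n a) = rho (barRes (InfPath k Λ)) A n a :=
  rho_precomp (psi k Λ) psi_zero_comp_d psi_comm A n a

end

/-! ### Level functions on the path groupoid and partitions into cylinder sets -/

section

variable {k : ℕ} {Λ : Type u} [SmallCategory Λ] [KGraph k Λ]

open KGraph InfPath GSheaf

variable (k Λ) in
/-- A locally constant choice of a presentation `g = (x, j - ℓ, y)`, `σʲ(x) = σˡ(y)`, of the elements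
of the path groupoid. -/
structure Level : Type u where
  j : Arr (InfPath k Λ) → Fin k → ℕ
  l : Arr (InfPath k Λ) → Fin k → ℕ
  isPair : ∀ g : Arr (InfPath k Λ), g.hom.IsPair (j g) (l g)
  locConst_j : IsLocallyConstant j
  locConst_l : IsLocallyConstant l

namespace GHom

lemma IsPair.exists_add {y x : InfPath k Λ} {g : GHom y x} {j l j' l' : Fin k → ℕ}
    (h : g.IsPair j l) (h' : g.IsPair j' l') (hj : j ≤ j') : ∃ m, j' = j + m ∧ l' = l + m := by
  obtain ⟨m, rfl⟩ := exists_add_of_le hj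
  refine ⟨m, rfl, funext fun i => ?_⟩
  have h1 := congrFun (h.1.symm.trans h'.1) i
  simp only [Pi.add_apply] at h1 ⊢
  omega

lemma nb_symm {j l : Fin k → ℕ} {g g' : Arr (InfPath k Λ)} (h : g.hom.IsPair j l)
    (hg : g' ∈ nb j l g) : g ∈ nb j l g' := ⟨h, hg.2.1.symm, hg.2.2.symm⟩

/-- The pair `(n⁺ + N, n⁻ + N)` for `g = (x, n, y)`. -/
def diag {y x : InfPath k Λ} (g : GHom y x) (N : ℕ) : (Fin k → ℕ) × (Fin k → ℕ) :=
  (fun i => (g.lag i).toNat + N, fun i => (-g.lag i).toNat + N)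

lemma diag_add {y x : InfPath k Λ} (g : GHom y x) (N N' : ℕ) :
    g.diag (N + N') = ((g.diag N).1 + fun _ => N', (g.diag N).2 + fun _ => N') :=
  Prod.ext (funext fun _ => (add_assoc _ _ _).symm) (funext fun _ => (add_assoc _ _ _).symm)

lemma exists_diag {y x : InfPath k Λ} (g : GHom y x) :
    ∃ N, g.IsPair (g.diag N).1 (g.diag N).2 := by
  obtain ⟨j, l, h⟩ := exists_isPair g
  refine ⟨∑ i, j i, ?_⟩
  have key : ∀ i, (g.lag i = (j i : ℤ) - l i) ∧ j i ≤ ∑ i, j i := fun i =>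
    ⟨congrFun h.1 i, Finset.single_le_sum (f := j) (fun _ _ => Nat.zero_le _) (Finset.mem_univ i)⟩
  have := IsPair.add h fun i => (g.lag i).toNat + ∑ i, j i - j i
  convert this using 1 <;>
  · funext i
    obtain ⟨h1, h2⟩ := key i
    simp only [diag, Pi.add_apply]
    omega

open Classical in
/-- The least `N` such that `σᵃ(x) = σᵇ(y)` for `(a, b) = (n⁺ + N, n⁻ + N)`, `g = (x, n, y)`. -/
def minDiag {y x : InfPath k Λ} (g : GHom y x) : ℕ := Nat.find g.exists_diag

lemma isPair_minDiag {y x : InfPath k Λ} (g : GHom y x) :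
    g.IsPair (g.diag g.minDiag).1 (g.diag g.minDiag).2 := by
  classical
  exact Nat.find_spec g.exists_diag

lemma minDiag_le {y x : InfPath k Λ} (g : GHom y x) {N : ℕ}
    (h : g.IsPair (g.diag N).1 (g.diag N).2) : g.minDiag ≤ N := by
  classical
  exact Nat.find_min' g.exists_diag h

lemma diag_eq_of_nb {g g' : Arr (InfPath k Λ)}
    (h : g' ∈ nb (g.hom.diag g.hom.minDiag).1 (g.hom.diag g.hom.minDiag).2 g) :
    g'.hom.diag g'.hom.minDiag = g.hom.diag g.hom.minDiag := by
  have hg := isPair_minDiag g.hom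
  have hlag : g'.hom.lag = g.hom.lag := h.1.1.trans hg.1.symm
  have hd : ∀ N, g'.hom.diag N = g.hom.diag N := fun N => by rw [diag, diag, hlag]
  rw [hd]
  congr 1
  have h1 : g'.hom.minDiag ≤ g.hom.minDiag := g'.hom.minDiag_le (by rw [hd]; exact h.1)
  refine le_antisymm h1 (g.hom.minDiag_le ?_)
  obtain ⟨m, hm⟩ := exists_add_of_le h1
  have h2 := nb_symm hg h
  rw [hm, diag_add, ← hd] at h2
  rw [← hd]
  exact (nb_anti (isPair_minDiag g'.hom) _ h2).1

end GHom

lemma isLocallyConstant_minDiag : IsLocallyConstant fun g : Arr (InfPath k Λ) =>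
    g.hom.diag g.hom.minDiag := by
  rw [IsLocallyConstant.iff_eventually_eq]
  intro g
  filter_upwards [GHom.nb_mem_nhds (GHom.isPair_minDiag g.hom)] with g' h
  exact GHom.diag_eq_of_nb h

variable (k Λ) in
/-- The level function that takes `(x, n, y)` to `(n⁺ + N, n⁻ + N)` with the least possible `N`. -/
def Level.min : Level k Λ where
  j g := (g.hom.diag g.hom.minDiag).1
  l g := (g.hom.diag g.hom.minDiag).2
  isPair g := GHom.isPair_minDiag g.hom
  locConst_j := isLocallyConstant_minDiag.comp Prod.fst
  locConst_l := isLocallyConstant_minDiag.comp Prod.snd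

/-- For `(y, -d, λy)`, `d = d(λ)`, the minimal level is `(0, d)`. -/
lemma Level.min_of_isPair_zero {g : Arr (InfPath k Λ)} {d : Fin k → ℕ} (h : g.hom.IsPair 0 d) :
    (Level.min k Λ).j g = 0 ∧ (Level.min k Λ).l g = d := by
  have hl : ∀ i, g.hom.lag i = -(d i : ℤ) := fun i => by rw [h.1]; simp
  have hd : g.hom.diag 0 = (0, d) := by
    refine Prod.ext (funext fun i => ?_) (funext fun i => ?_)
    · simp [GHom.diag, hl]
    · simp [GHom.diag, hl]
  have h0 : g.hom.minDiag = 0 := Nat.le_zero.1 (g.hom.minDiag_le (by rw [hd]; exact h))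
  have := congrArg g.hom.diag h0
  rw [hd] at this
  exact ⟨congrArg Prod.fst this, congrArg Prod.snd this⟩

/-- The sets `Z(x(0, j), y(0, ℓ))`, where `(j, ℓ)` is the minimal level of `(x, n, y)`, form a
partition since the minimal level is constant on each of them. -/
lemma exists_isPartition : ∃ P : Set (Arr Λ × Arr Λ), IsPartition P := by
  let L := Level.min k Λ
  refine ⟨Set.range fun g : Arr (InfPath k Λ) => (g.tgt.pre (L.j g), g.src.pre (L.l g)), ?_,
    fun g => ?_⟩
  · rintro _ ⟨g, rfl⟩
    exact congrArg (fun x : InfPath k Λ => x.obj 0) (L.isPair g).2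
  · refine ⟨(g.tgt.pre (L.j g), g.src.pre (L.l g)), ⟨⟨g, rfl⟩, ?_⟩, ?_⟩
    · dsimp only
      rw [← GHom.nb_eq]
      exact ⟨L.isPair g, rfl, rfl⟩
    · rintro _ ⟨⟨g', rfl⟩, h⟩
      dsimp only at h
      rw [← GHom.nb_eq] at h
      have e := GHom.diag_eq_of_nb h
      have e1 : L.j g = L.j g' := congrArg Prod.fst e
      have e2 : L.l g = L.l g' := congrArg Prod.snd e
      rw [e1, e2]
      exact Prod.ext h.2.1.symm h.2.2.symm

/-- The pair of `P` whose cylinder set contains `g`. -/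
def IsPartition.pair {P : Set (Arr Λ × Arr Λ)} (hP : IsPartition (k := k) P)
    (g : Arr (InfPath k Λ)) : Arr Λ × Arr Λ := (hP.2 g).choose

namespace IsPartition

variable {P : Set (Arr Λ × Arr Λ)} (hP : IsPartition (k := k) P)

lemma pair_mem (g : Arr (InfPath k Λ)) : hP.pair g ∈ P := (hP.2 g).choose_spec.1.1

lemma mem_cyl_pair (g : Arr (InfPath k Λ)) : g ∈ GHom.cyl (hP.pair g).1 (hP.pair g).2 :=
  (hP.2 g).choose_spec.1.2

lemma pair_eq {g : Arr (InfPath k Λ)} {p : Arr Λ × Arr Λ} (hp : p ∈ P)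
    (hg : g ∈ GHom.cyl p.1 p.2) : hP.pair g = p :=
  ((hP.2 g).choose_spec.2 p ⟨hp, hg⟩).symm

lemma isLocallyConstant_pair : IsLocallyConstant hP.pair := by
  rw [IsLocallyConstant.iff_eventually_eq]
  intro g
  have : IsOpen (GHom.cyl (hP.pair g).1 (hP.pair g).2 : Set (Arr (InfPath k Λ))) :=
    TopologicalSpace.isOpen_generateFrom_of_mem ⟨_, _, hP.1 _ (hP.pair_mem g), rfl⟩
  filter_upwards [this.mem_nhds (hP.mem_cyl_pair g)] with g' h
  exact hP.pair_eq (hP.pair_mem g) h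

/-- The level function `g ↦ (d(μ_g), d(ν_g))` of a partition. -/
def level : Level k Λ where
  j g := deg (hP.pair g).1.hom
  l g := deg (hP.pair g).2.hom
  isPair g := (hP.mem_cyl_pair g).1
  locConst_j := hP.isLocallyConstant_pair.comp fun p => deg p.1.hom
  locConst_l := hP.isLocallyConstant_pair.comp fun p => deg p.2.hom

end IsPartition

/-- For composable `g` and `h`, triples `(a, b, e)` with `g = (x, a - b, y)` and `h = (y, b - e, z)`
above the levels of `g`, `h` and `gh`. -/
structure Level.IsTriple (L : Level k Λ) {x y z : InfPath k Λ} (g : y ⟶ x) (h : z ⟶ y)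
    (a b e : Fin k → ℕ) : Prop where
  fst : GHom.IsPair g a b
  snd : GHom.IsPair h b e
  le_fst : L.j ⟨g⟩ ≤ a
  le_snd : L.j ⟨h⟩ ≤ b
  le_comp : L.j ⟨h ≫ g⟩ ≤ a

lemma Level.IsTriple.add {L : Level k Λ} {x y z : InfPath k Λ} {g : y ⟶ x} {h : z ⟶ y}
    {a b e : Fin k → ℕ} (H : L.IsTriple g h a b e) (m : Fin k → ℕ) :
    L.IsTriple g h (a + m) (b + m) (e + m) :=
  ⟨H.fst.add m, H.snd.add m, H.le_fst.trans le_self_add, H.le_snd.trans le_self_add,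
    H.le_comp.trans le_self_add⟩

lemma Level.isTriple (L : Level k Λ) {x y z : InfPath k Λ} (g : y ⟶ x) (h : z ⟶ y) :
    L.IsTriple g h (L.j ⟨g⟩ + (L.j ⟨h⟩ + L.j ⟨h ≫ g⟩)) (L.l ⟨g⟩ + (L.j ⟨h⟩ + L.j ⟨h ≫ g⟩))
      (L.l ⟨h⟩ + (L.l ⟨g⟩ + L.j ⟨h ≫ g⟩)) where
  fst := (L.isPair ⟨g⟩).add _
  snd := by
    rw [add_left_comm]
    exact (L.isPair ⟨h⟩).add _
  le_fst := le_self_add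
  le_snd := le_self_add.trans le_add_self
  le_comp := le_add_self.trans le_add_self

end

section

variable {k : ℕ} {Λ : Type u} [SmallCategory Λ] [KGraph k Λ]

open KGraph InfPath GSheaf

/-! ### Categorical cocycles with constant coefficients -/

section

variable {M : AddCommGrpCat.{u}}

lemma app_of_cons {n : ℕ} (c : barObj Λᵒᵖ n ⟶ constMod Λ M) {v w : Λᵒᵖ} (g : w ⟶ v)
    (t : Tup Λᵒᵖ n w) :
    c.app v (FreeAbelianGroup.of (Tup.cons g t) : FreeAbelianGroup (Tup Λᵒᵖ (n + 1) v)) =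
      catVal c t := by
  have h := congrArg (fun φ => φ (FreeAbelianGroup.of (Tup.cons (𝟙 w) t) :
    FreeAbelianGroup (Tup Λᵒᵖ (n + 1) w))) (c.naturality g)
  refine Eq.trans (congrArg (c.app v) ?_) h
  refine Eq.symm ((FreeAbelianGroup.map_of_apply (f := Tup.act g) _).trans ?_)
  exact congrArg FreeAbelianGroup.of (congrArg (fun g => Tup.cons g t) (Category.id_comp g))

lemma catVal_modDiff {n : ℕ} (c : barObj Λᵒᵖ n ⟶ constMod Λ M) {v : Λᵒᵖ}
    (t : Tup Λᵒᵖ (n + 1) v) :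
    catVal (modDiff Λ n ≫ c) t = (-1 : ℤ) ^ (n + 1) • ∑ j ∈ Finset.range (n + 2), (-1 : ℤ) ^ j •
      c.app v (FreeAbelianGroup.of (face (n + 1) j (Tup.cons (𝟙 v) t)) :
        FreeAbelianGroup (Tup Λᵒᵖ (n + 1) v)) := by
  change (c.app v).hom ((-1 : ℤ) ^ (n + 1) • bdryFun n v (.of (Tup.cons (𝟙 v) t))) = _
  rw [bdryFun_of]
  refine (map_zsmul (c.app v).hom _ _).trans (congrArg _ ((map_sum (c.app v).hom _ _).trans ?_))
  exact Finset.sum_congr rfl fun j _ => map_zsmul (c.app v).hom _ _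

lemma catVal_modDiff_zero (b : barObj Λᵒᵖ 0 ⟶ constMod Λ M) {u v : Λ} (l : u ⟶ v) :
    catVal₁ (modDiff Λ 0 ≫ b) ⟨l⟩ = catVal₀ b u - catVal₀ b v := by
  refine (catVal_modDiff b _).trans ?_
  simp only [Finset.sum_range_succ, Finset.sum_range_zero, face, app_of_cons]
  simp [catVal₀, sub_eq_add_neg, add_comm]

lemma catVal_modDiff_one (b : barObj Λᵒᵖ 1 ⟶ constMod Λ M) {u v w : Λ} (μ : v ⟶ w) (α : u ⟶ v) :
    catVal₂ (modDiff Λ 1 ≫ b) μ α = catVal₁ b ⟨μ⟩ - catVal₁ b ⟨α ≫ μ⟩ + catVal₁ b ⟨α⟩ := by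
  refine (catVal_modDiff b _).trans ?_
  simp only [Finset.sum_range_succ, Finset.sum_range_zero, face, app_of_cons, ← op_comp]
  simp [catVal₁, sub_eq_add_neg]

lemma catVal_modDiff_two (b : barObj Λᵒᵖ 2 ⟶ constMod Λ M) {u v w z : Λ} (ν : w ⟶ z) (μ : v ⟶ w)
    (α : u ⟶ v) : catVal (modDiff Λ 2 ≫ b) (.cons α.op (.cons μ.op (.cons ν.op .nil))) =
      -(catVal₂ b ν μ - catVal₂ b ν (α ≫ μ) + catVal₂ b (μ ≫ ν) α - catVal₂ b μ α) := by
  refine (catVal_modDiff b _).trans ?_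
  simp only [Finset.sum_range_succ, Finset.sum_range_zero, face, app_of_cons, ← op_comp]
  simp [catVal₂, sub_eq_add_neg, pow_succ]
  abel

lemma catVal₀_cocycle (c : homZ (barObj Λᵒᵖ) (modDiff Λ) (constMod Λ M) 0) {u v : Λ} (l : u ⟶ v) :
    catVal₀ c.1 u = catVal₀ c.1 v := by
  have := catVal_modDiff_zero c.1 l
  rw [show modDiff Λ 0 ≫ c.1 = 0 from c.2] at this
  exact sub_eq_zero.1 this.symm

lemma catVal₁_cocycle (c : homZ (barObj Λᵒᵖ) (modDiff Λ) (constMod Λ M) 1) {u v w : Λ} (μ : v ⟶ w)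
    (α : u ⟶ v) : catVal₁ c.1 ⟨α ≫ μ⟩ = catVal₁ c.1 ⟨μ⟩ + catVal₁ c.1 ⟨α⟩ := by
  have := catVal_modDiff_one c.1 μ α
  rw [show modDiff Λ 1 ≫ c.1 = 0 from c.2] at this
  have h : (0 : M) = _ := this
  rw [sub_add_eq_add_sub] at h
  exact (sub_eq_zero.1 h.symm).symm

lemma catVal₁_id (c : homZ (barObj Λᵒᵖ) (modDiff Λ) (constMod Λ M) 1) (v : Λ) :
    catVal₁ c.1 ⟨𝟙 v⟩ = 0 := by
  have := catVal₁_cocycle c (𝟙 v) (𝟙 v)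
  rw [Category.comp_id] at this
  exact left_eq_add.1 this

lemma catVal₂_cocycle (c : homZ (barObj Λᵒᵖ) (modDiff Λ) (constMod Λ M) 2) {u v w z : Λ}
    (ν : w ⟶ z) (μ : v ⟶ w) (α : u ⟶ v) :
    catVal₂ c.1 ν (α ≫ μ) = catVal₂ c.1 ν μ + catVal₂ c.1 (μ ≫ ν) α - catVal₂ c.1 μ α := by
  have := catVal_modDiff_two c.1 ν μ α
  rw [show modDiff Λ 2 ≫ c.1 = 0 from c.2] at this
  have h := neg_eq_zero.1 this.symm
  rw [← sub_eq_zero, ← neg_eq_zero, ← h]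
  abel

/-- A 2-cocycle need not be normalized: its value `c(v, λ)` is `c(v, v)`. -/
lemma catVal₂_id (c : homZ (barObj Λᵒᵖ) (modDiff Λ) (constMod Λ M) 2) {u v : Λ} (l : u ⟶ v) :
    catVal₂ c.1 (𝟙 v) l = catVal₂ c.1 (𝟙 v) (𝟙 v) := by
  have := catVal₂_cocycle c (𝟙 v) (𝟙 v) l
  rw [Category.comp_id, Category.comp_id, add_sub_cancel_right] at this
  exact this

lemma catVal₂_congr (c : barObj Λᵒᵖ 2 ⟶ constMod Λ M) {u v w u' v' w' : Λ} {μ : v ⟶ w} {α : u ⟶ v}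
    {μ' : v' ⟶ w'} {α' : u' ⟶ v'} (h : (⟨μ⟩ : Arr Λ) = ⟨μ'⟩) (h' : (⟨α⟩ : Arr Λ) = ⟨α'⟩) :
    catVal₂ c μ α = catVal₂ c μ' α' := by
  cases h
  cases h'
  rfl

end

/-! ### Locally constant cochains -/

lemma constVal_eq (M : AddCommGrpCat.{u}) (x : InfPath k Λ) (p : Fin k → ℕ) {v : Λ}
    (h : x.obj p = v) (m : M) : germS (constMod Λ M) x p h m = constVal M x m := by
  subst h
  exact germS_map (A := constMod Λ M) (zero_le' p) m

lemma constVal_add (M : AddCommGrpCat.{u}) (x : InfPath k Λ) (m m' : M) :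
    constVal M x (m + m') = constVal M x m + constVal M x m' :=
  map_add (germS (constMod Λ M) x 0 rfl) m m'

lemma constVal_zero (M : AddCommGrpCat.{u}) (x : InfPath k Λ) : constVal M x (0 : M) = 0 :=
  map_zero (germS (constMod Λ M) x 0 rfl)

lemma constVal_neg (M : AddCommGrpCat.{u}) (x : InfPath k Λ) (m : M) :
    constVal M x (-m) = -constVal M x m :=
  map_neg (germS (constMod Λ M) x 0 rfl) m

lemma act_constVal (M : AddCommGrpCat.{u}) {x y : InfPath k Λ} (g : y ⟶ x) (m : M) :
    (uSheaf (constMod Λ M)).act.map g (constVal M y m) = constVal M x m := by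
  obtain ⟨p, q, h⟩ := GHom.exists_isPair g
  rw [← constVal_eq M y q (obj_eq_of_isPair h).symm m, ← constVal_eq M x p rfl m]
  exact germS_act (A := constMod Λ M) g h _ _ m

lemma continuous_constVal (M : AddCommGrpCat.{u}) (m : M) : Continuous fun x : InfPath k Λ =>
    (⟨x, constVal M x m⟩ : Tot (uSheaf (constMod Λ M)).stalk) := by
  rw [continuous_iff_continuousAt]
  intro x
  have h := continuous_germS (A := constMod Λ M) (x.pre 0) m
  refine ContinuousOn.continuousAt (s := InfPath.cyl (x.pre 0)) ?_
    ((isOpen_cyl _).mem_nhds (mem_cyl_pre.2 rfl))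
  rw [continuousOn_iff_continuous_domRestrict]
  exact h.congr fun z => congrArg (Tot.mk z.1) (constVal_eq M z.1 _ _ m)

lemma continuous_mk_constVal {M : AddCommGrpCat.{u}} {T : Type*} [TopologicalSpace T]
    {π : T → InfPath k Λ} (hπ : Continuous π) {m : T → M} (hm : IsLocallyConstant m) :
    Continuous fun t => (⟨π t, constVal M (π t) (m t)⟩ :
      Tot (uSheaf (constMod Λ M)).stalk) := by
  rw [continuous_iff_continuousAt]
  intro t
  refine ((continuous_constVal M (m t)).comp hπ).continuousAt.congr ?_
  filter_upwards [(IsLocallyConstant.iff_eventually_eq m).1 hm t] with t' h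
  rw [h]
  rfl

/-- The continuous cochain with values in the sheaf of `M^Λ` that is given by a locally constant
function with values in `M`. -/
def constCochain {M : AddCommGrpCat.{u}} {n : ℕ} (m : Tot (Tup (InfPath k Λ) n) → M)
    (hm : IsLocallyConstant m) :
    cochains (uSheaf (constMod Λ M) : GSheaf (InfPath k Λ)) n :=
  ⟨fun t => constVal M t.base (m t), continuous_mk_constVal (tup_isLocalHomeomorph n).continuous hm⟩

lemma cobdry_constCochain {M : AddCommGrpCat.{u}} {n : ℕ} (m : Tot (Tup (InfPath k Λ) n) → M)
    (hm : IsLocallyConstant m) {x y : InfPath k Λ} (g : y ⟶ x) (t : Tup (InfPath k Λ) n y) :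
    cobdry _ n (constCochain m hm).1 ⟨x, .cons g t⟩ = constVal M x (m ⟨y, t⟩ +
      ∑ j ∈ Finset.range (n + 1), (-1 : ℤ) ^ (j + 1) • m ⟨x, face n j (.cons g t)⟩) := by
  rw [constVal_add, ← act_constVal M g]
  refine congrArg ((uSheaf (constMod Λ M)).act.map g (constVal M y (m ⟨y, t⟩)) + ·) ?_
  refine Eq.symm ((map_sum (germS (constMod Λ M) x 0 rfl) _ _).trans ?_)
  exact Finset.sum_congr rfl fun j _ => map_zsmul (germS (constMod Λ M) x 0 rfl) _ _

lemma cobdry_cobdry {X : Type u} [EtaleGroupoid X] (A : GSheaf X) {n : ℕ}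
    (f : ∀ t : Tot (Tup X n), A.stalk t.base) : cobdry A (n + 1) (cobdry A n f) = 0 := by
  funext t
  have h : etaFun A (cobdry A (n + 1) (cobdry A n f)) t.base (.of (.cons (𝟙 _) t.val)) = 0 := by
    rw [etaFun_cobdry, etaFun_cobdry, bdryFun_bdryFun, map_zero]
  rw [etaFun_of, A.act.map_id] at h
  exact h

lemma contB_le {X : Type u} [EtaleGroupoid X] (A : GSheaf X) : ∀ n, contB A n ≤ contZ A n
  | 0 => bot_le
  | n + 1 => by
    rintro f ⟨b, hb⟩
    have hb : cobdry A n b.1 = f.1 := hb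
    change cobdry A (n + 1) f.1 = 0
    rw [← hb, cobdry_cobdry]

/-- The cochain `ηs` agrees with `c̲` along `ψ` if `s` agrees with `c` on the tuples
`((y, -d(λₙ), λₙy), (λₙy, -d(λₙ₋₁), λₙ₋₁λₙy), …)`. -/
lemma psi_comp_etaHom {M : AddCommGrpCat.{u}} {n : ℕ} (c : barObj Λᵒᵖ n ⟶ constMod Λ M)
    (s : cochains (uSheaf (constMod Λ M) : GSheaf (InfPath k Λ)) n)
    (h : ∀ {w : Λᵒᵖ} (t : Tup Λᵒᵖ n w) (y : InfPath k Λ) (hy : y.obj 0 = w.unop),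
      psiSign n • s.1 ⟨y, psiTup t y hy⟩ = constVal M y (catVal c t)) :
    psi k Λ n ≫ etaHom _ n s = uHomMap _ n c := by
  refine hom_ext fun x e => ?_
  obtain ⟨p, -, a, rfl⟩ := germS_surjective (A := barObj Λᵒᵖ n) e 0
  refine (congrArg (app (etaHom _ n s) x) (psi_germ n x p rfl a)).trans ?_
  refine Eq.trans ?_ (uMap_germ c x p rfl a).symm
  refine DFunLike.congr_fun (f := (etaFun _ s.1 x).comp (psiFun n x p rfl))
    (g := (germS (constMod Λ M) x p rfl).comp (c.app (op (x.obj p))).hom) ?_ a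
  refine FreeAbelianGroup.lift_ext _ _ fun t => ?_
  rcases t with _ | ⟨g, t⟩
  refine (congrArg (etaFun _ s.1 x) (psiFun_of n x p rfl (.cons g t))).trans ?_
  rw [map_zsmul, psiGen, psiTup, Tup.act, etaFun_of]
  refine Eq.trans ?_ (congrArg (germS (constMod Λ M) x p rfl) (app_of_cons c g t)).symm
  rw [constVal_eq, ← act_constVal M (ofConcat g.unop (shift p x) rfl ≫ toShift p x)]
  exact (map_zsmul ((uSheaf (constMod Λ M)).act.map _).hom _ _).symm.trans
    (congrArg _ (h t _ (concat_obj_zero _ _ _)))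

/-- A homomorphism from cocycles to continuous cocycles which preserves coboundaries and whose values
represent, up to coboundaries, the cocycles that correspond under `R` induces a homomorphism on
cohomology.  If `ψ` pulls these values back to the classes of `c̲`, so does the homomorphism. -/
lemma exists_isInducedBy {M : AddCommGrpCat.{u}} {n : ℕ}
    (S : homZ (barObj Λᵒᵖ) (modDiff Λ) (constMod Λ M) n →+
      contZ (uSheaf (constMod Λ M) : GSheaf (InfPath k Λ)) n)
    (hB : ∀ c, c.1 ∈ homB (barObj Λᵒᵖ) (modDiff Λ) (constMod Λ M) n → (S c).1 ∈ contB _ n)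
    (hψ : ∀ c, ∃ b : contB (uSheaf (constMod Λ M) : GSheaf (InfPath k Λ)) n,
      psi k Λ n ≫ etaHom _ n ((S c).1 - b.1) = uHomMap _ n c.1) :
    ∃ κ : ModCoh (constMod Λ M) n →+ ContCoh (uSheaf (constMod Λ M) : GSheaf (InfPath k Λ)) n,
      (∀ R : (barObj Λᵒᵖ n ⟶ constMod Λ M) →
          cochains (uSheaf (constMod Λ M) : GSheaf (InfPath k Λ)) n → Prop,
        (∀ c : homZ (barObj Λᵒᵖ) (modDiff Λ) (constMod Λ M) n,
          (∃ s : contZ (uSheaf (constMod Λ M) : GSheaf (InfPath k Λ)) n, R c.1 s.1) ∧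
          ∀ s : contZ (uSheaf (constMod Λ M) : GSheaf (InfPath k Λ)) n, R c.1 s.1 →
            s.1 - (S c).1 ∈ contB _ n) → IsInducedBy κ R) ∧
      ∀ a, psiStar _ n (eta _ n (κ a)) = underline _ n a := by
  refine ⟨QuotientAddGroup.map _ _ S hB, fun R hR c => ⟨(hR c).1, fun s hs => ?_⟩, fun a => ?_⟩
  · have h : SubQuot.mk (s - S c) = (0 : ContCoh _ n) := SubQuot.mk_eq_zero.2 ((hR c).2 s hs)
    rw [SubQuot.mk_sub] at h
    exact (sub_eq_zero.1 h).symm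
  · obtain ⟨c, rfl⟩ := QuotientAddGroup.mk_surjective a
    obtain ⟨⟨b, hb⟩, he⟩ := hψ c
    let b' : contZ (uSheaf (constMod Λ M) : GSheaf (InfPath k Λ)) n := ⟨b, contB_le _ n hb⟩
    have h1 : SubQuot.mk (S c) = (SubQuot.mk (S c - b') :
        ContCoh (uSheaf (constMod Λ M) : GSheaf (InfPath k Λ)) n) := by
      have hz : (SubQuot.mk b' : ContCoh _ n) = 0 := SubQuot.mk_eq_zero.2 hb
      rw [SubQuot.mk_sub, hz, sub_zero]
    change psiStar _ n (eta _ n (SubQuot.mk (S c))) = _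
    rw [h1]
    exact congrArg SubQuot.mk (Subtype.ext he)

end

section

variable {k : ℕ} {Λ : Type u} [SmallCategory Λ] [KGraph k Λ] {M : AddCommGrpCat.{u}}

open KGraph InfPath GSheaf

/-- The homomorphism from cocycles to continuous cocycles given by locally constant functions. -/
def constCocycleHom {n : ℕ}
    (m : homZ (barObj Λᵒᵖ) (modDiff Λ) (constMod Λ M) n →+ (Tot (Tup (InfPath k Λ) n) → M))
    (hm : ∀ c, IsLocallyConstant (m c))
    (hδ : ∀ c {x y : InfPath k Λ} (g : y ⟶ x) (t : Tup (InfPath k Λ) n y), m c ⟨y, t⟩ +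
      ∑ j ∈ Finset.range (n + 1), (-1 : ℤ) ^ (j + 1) • m c ⟨x, face n j (.cons g t)⟩ = 0) :
    homZ (barObj Λᵒᵖ) (modDiff Λ) (constMod Λ M) n →+
      contZ (uSheaf (constMod Λ M) : GSheaf (InfPath k Λ)) n :=
  AddMonoidHom.mk' (fun c => ⟨constCochain (m c) (hm c), by
    change cobdry _ n (constCochain (m c) (hm c)).1 = 0
    funext t
    rcases t with ⟨x, _ | ⟨g, t⟩⟩
    rw [cobdry_constCochain, hδ, constVal_zero]
    rfl⟩) (by
    intro c c'
    refine Subtype.ext (Subtype.ext (funext fun t => ?_))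
    change constVal M t.base (m (c + c') t) = _
    rw [map_add]
    exact constVal_add M t.base _ _)

lemma mem_contB_of_constVal {n : ℕ}
    {s : cochains (uSheaf (constMod Λ M) : GSheaf (InfPath k Λ)) (n + 1)}
    {m : Tot (Tup (InfPath k Λ) (n + 1)) → M} (hs : ∀ t, s.1 t = constVal M t.base (m t))
    {m' : Tot (Tup (InfPath k Λ) n) → M} (hm' : IsLocallyConstant m')
    (h : ∀ {x y : InfPath k Λ} (g : y ⟶ x) (t : Tup (InfPath k Λ) n y), m ⟨x, .cons g t⟩ =
      m' ⟨y, t⟩ +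
        ∑ j ∈ Finset.range (n + 1), (-1 : ℤ) ^ (j + 1) • m' ⟨x, face n j (.cons g t)⟩) :
    s ∈ contB (uSheaf (constMod Λ M) : GSheaf (InfPath k Λ)) (n + 1) := by
  have key : cobdry _ n (constCochain m' hm').1 = s.1 := by
    funext t
    rcases t with ⟨x, _ | ⟨g, t⟩⟩
    rw [cobdry_constCochain, hs, h]
  exact ⟨constCochain m' hm', key⟩

lemma isLocallyConstant_obj_zero {S : Type*} (f : Λ → S) :
    IsLocallyConstant fun x : InfPath k Λ => f (x.obj 0) := by
  rw [IsLocallyConstant.iff_eventually_eq]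
  intro x
  filter_upwards [eventually_pre x 0] with z h
  exact congrArg (fun l : Arr Λ => f l.tgt) h

lemma isLocallyConstant_pre {S T : Type*} [TopologicalSpace T] {x : T → InfPath k Λ}
    (hx : Continuous x) {a : T → Fin k → ℕ} (ha : IsLocallyConstant a) (f : Arr Λ → S) :
    IsLocallyConstant fun t => f ((x t).pre (a t)) := by
  rw [IsLocallyConstant.iff_eventually_eq]
  intro t
  filter_upwards [eventually_pre_eq hx t (a t), (IsLocallyConstant.iff_eventually_eq a).1 ha t]
    with t' h h'
  rw [h', h]

lemma continuous_src : Continuous (Arr.src : Arr (InfPath k Λ) → InfPath k Λ) :=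
  EtaleGroupoid.isLocalHomeomorph_src.continuous

lemma continuous_tgt : Continuous (Arr.tgt : Arr (InfPath k Λ) → InfPath k Λ) :=
  EtaleGroupoid.isLocalHomeomorph_tgt.continuous

lemma pre_eq_comp {x : InfPath k Λ} {a b : Fin k → ℕ} (hab : a ≤ b) {u v w : Λ} {μ : v ⟶ w}
    {α : u ⟶ v} (hμ : x.pre a = ⟨μ⟩) (hα : x.seg hab = ⟨α⟩) : x.pre b = ⟨α ≫ μ⟩ := by
  have : x.pre b = ⟨x.map hab ≫ x.map (zero_le' a)⟩ := by
    rw [x.map_comp]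
    rfl
  exact this.trans (arr_comp_congr hα hμ)

lemma pre_seg_of_pre {x : InfPath k Λ} {u v w : Λ} {μ : v ⟶ w} {α : u ⟶ v} {a b : Fin k → ℕ}
    (hab : a ≤ b) (ha : deg μ = a) (h : x.pre b = ⟨α ≫ μ⟩) :
    x.pre a = ⟨μ⟩ ∧ x.seg hab = ⟨α⟩ := by
  have : x.pre b = ⟨x.map hab ≫ x.map (zero_le' a)⟩ := by
    rw [x.map_comp]
    rfl
  exact (arr_cancel (this.symm.trans h) ((deg_pre x a).trans ha.symm)).symm

/-! ### The map `κ⁰` -/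

variable (k Λ M) in
/-- The map `c ↦ (x ↦ c(r(x)))`. -/
def kpsZero : homZ (barObj Λᵒᵖ) (modDiff Λ) (constMod Λ M) 0 →+
    contZ (uSheaf (constMod Λ M) : GSheaf (InfPath k Λ)) 0 :=
  constCocycleHom (AddMonoidHom.mk' (fun c t => catVal₀ c.1 (t.base.obj 0)) fun _ _ => rfl)
    (fun c => (isLocallyConstant_obj_zero (catVal₀ c.1)).comp_continuous
      (tup_isLocalHomeomorph 0).continuous) (by
    intro c x y g t
    obtain ⟨j, l, h⟩ := GHom.exists_isPair g
    have h1 := catVal₀_cocycle c (x.map (zero_le' j))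
    have h2 := catVal₀_cocycle c (y.map (zero_le' l))
    rw [obj_eq_of_isPair h] at h1
    refine Eq.trans ?_ (sub_eq_zero.2 (h2.symm.trans h1))
    simp only [Finset.sum_range_succ, Finset.sum_range_zero, zero_add, pow_one, neg_one_zsmul]
    exact (sub_eq_add_neg _ _).symm)

lemma exists_kps_zero (M : AddCommGrpCat.{u}) :
    ∃ κ : ModCoh (constMod Λ M) 0 →+ ContCoh (uSheaf (constMod Λ M) : GSheaf (InfPath k Λ)) 0,
      IsInducedBy κ IsKPS₀ ∧ ∀ a, psiStar _ 0 (eta _ 0 (κ a)) = underline _ 0 a := by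
  obtain ⟨κ, h1, h2⟩ := exists_isInducedBy (kpsZero k Λ M) (fun c hc => by
      obtain rfl : c = 0 := Subtype.ext hc
      rw [map_zero]
      exact zero_mem _) (fun c => ⟨0, by
      change _ ≫ etaHom _ 0 (_ - 0) = _
      rw [sub_zero]
      refine psi_comp_etaHom c.1 _ fun t y hy => ?_
      rcases t with _ | _
      refine (one_zsmul _).trans ?_
      exact congrArg (fun v => constVal M y (catVal₀ c.1 v)) hy⟩)
  refine ⟨κ, h1 _ fun c => ⟨⟨kpsZero k Λ M c, fun x => rfl⟩, fun s hs => ?_⟩, h2⟩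
  have : s = kpsZero k Λ M c := by
    refine Subtype.ext (Subtype.ext (funext fun t => ?_))
    rcases t with ⟨x, _ | _⟩
    exact hs x
  rw [this, sub_self]
  exact zero_mem _

/-! ### The map `κ¹` -/

/-- `c(x(0, j)) - c(y(0, ℓ))`. -/
def preDiff (c : barObj Λᵒᵖ 1 ⟶ constMod Λ M) (g : Arr (InfPath k Λ)) (j l : Fin k → ℕ) : M :=
  catVal₁ c (g.tgt.pre j) - catVal₁ c (g.src.pre l)

lemma preDiff_add (c : homZ (barObj Λᵒᵖ) (modDiff Λ) (constMod Λ M) 1) {x y : InfPath k Λ}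
    {g : y ⟶ x} {j l : Fin k → ℕ} (h : GHom.IsPair g j l) (m : Fin k → ℕ) :
    preDiff c.1 ⟨g⟩ (j + m) (l + m) = preDiff c.1 ⟨g⟩ j l := by
  have key : ∀ (z : InfPath k Λ) (a : Fin k → ℕ), catVal₁ c.1 (z.pre (a + m)) =
      catVal₁ c.1 (z.pre a) + catVal₁ c.1 (z.seg (le_self_add (a := a) (b := m))) := fun z a => by
    rw [pre_eq_comp (le_self_add (a := a) (b := m)) (μ := z.map (zero_le' a)) rfl rfl]
    exact catVal₁_cocycle c _ _
  rw [preDiff, preDiff, key, key, seg_shift h.2, add_sub_add_right_eq_sub]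

lemma preDiff_eq (c : homZ (barObj Λᵒᵖ) (modDiff Λ) (constMod Λ M) 1) {x y : InfPath k Λ}
    {g : y ⟶ x} {j l j' l' : Fin k → ℕ} (h : GHom.IsPair g j l) (h' : GHom.IsPair g j' l') :
    preDiff c.1 ⟨g⟩ j l = preDiff c.1 ⟨g⟩ j' l' := by
  obtain ⟨m, h1, h2⟩ := h.exists_add (h'.add j) le_add_self
  rw [← preDiff_add c h m, ← h1, ← h2, preDiff_add c h' j]

variable (k Λ M) in
/-- The map `c ↦ ((x, j - ℓ, y) ↦ c(x(0, j)) - c(y(0, ℓ)))`. -/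
def kpsOne : homZ (barObj Λᵒᵖ) (modDiff Λ) (constMod Λ M) 1 →+
    contZ (uSheaf (constMod Λ M) : GSheaf (InfPath k Λ)) 1 :=
  constCocycleHom (AddMonoidHom.mk' (fun c t => preDiff c.1 (tupHead t)
      ((Level.min k Λ).j (tupHead t)) ((Level.min k Λ).l (tupHead t)))
      fun _ _ => funext fun _ => add_sub_add_comm _ _ _ _)
    (fun c => by
      have h : Continuous (tupHead : Tot (Tup (InfPath k Λ) 1) → _) := continuous_tupHead
      exact (isLocallyConstant_pre (continuous_tgt.comp h)
        ((Level.min k Λ).locConst_j.comp_continuous h) (catVal₁ c.1)).sub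
        (isLocallyConstant_pre (continuous_src.comp h)
        ((Level.min k Λ).locConst_l.comp_continuous h) (catVal₁ c.1))) (by
    intro c x y g t
    rcases t with _ | ⟨h, _ | _⟩
    rename_i z
    -- A common middle degree for presentations of `g`, `h` and `gh`.
    obtain ⟨a, b, hg⟩ := GHom.exists_isPair g
    obtain ⟨b', e, hh⟩ := GHom.exists_isPair h
    have hg := hg.add b'
    have hh := hh.add b
    rw [add_comm b' b] at hh
    simp only [Finset.sum_range_succ, Finset.sum_range_zero, face, tupHead,
      AddMonoidHom.mk'_apply]
    rw [preDiff_eq c ((Level.min k Λ).isPair ⟨g⟩) hg, preDiff_eq c ((Level.min k Λ).isPair ⟨h⟩) hh,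
      preDiff_eq c ((Level.min k Λ).isPair ⟨h ≫ g⟩) (GHom.isPair_comp hg hh)]
    simp [preDiff])

lemma kpsOne_apply (c : homZ (barObj Λᵒᵖ) (modDiff Λ) (constMod Λ M) 1) {x y : InfPath k Λ}
    (g : y ⟶ x) {j l : Fin k → ℕ} (h : GHom.IsPair g j l) :
    (kpsOne k Λ M c).1.1 ⟨x, .cons g .nil⟩ = constVal M x (preDiff c.1 ⟨g⟩ j l) :=
  congrArg (constVal M x) (preDiff_eq c ((Level.min k Λ).isPair ⟨g⟩) h)

lemma exists_kps_one (M : AddCommGrpCat.{u}) :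
    ∃ κ : ModCoh (constMod Λ M) 1 →+ ContCoh (uSheaf (constMod Λ M) : GSheaf (InfPath k Λ)) 1,
      IsInducedBy κ IsKPS₁ ∧ ∀ a, psiStar _ 1 (eta _ 1 (κ a)) = underline _ 1 a := by
  obtain ⟨κ, h1, h2⟩ := exists_isInducedBy (kpsOne k Λ M) (fun c hc => by
      obtain ⟨b, hb⟩ := hc
      have hc : c.1 = modDiff Λ 0 ≫ b := hb.symm
      refine mem_contB_of_constVal (fun _ => rfl) (m' := fun t => catVal₀ b (t.base.obj 0))
        ((isLocallyConstant_obj_zero (catVal₀ b)).comp_continuous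
          (tup_isLocalHomeomorph 0).continuous) ?_
      intro x y g t
      rcases t with _ | _
      have h := (Level.min k Λ).isPair ⟨g⟩
      refine (congrArg₂ (· - ·) ((congrArg (catVal₁ · _) hc).trans (catVal_modDiff_zero b _))
        ((congrArg (catVal₁ · _) hc).trans (catVal_modDiff_zero b _))).trans ?_
      have h3 : x.obj ((Level.min k Λ).j ⟨g⟩) = y.obj ((Level.min k Λ).l ⟨g⟩) := obj_eq_of_isPair h
      change catVal₀ b (x.obj ((Level.min k Λ).j ⟨g⟩)) - catVal₀ b (x.obj 0) -
        (catVal₀ b (y.obj ((Level.min k Λ).l ⟨g⟩)) - catVal₀ b (y.obj 0)) = _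
      rw [h3]
      simp
      abel) (fun c => ⟨0, by
      change _ ≫ etaHom _ 1 (_ - 0) = _
      rw [sub_zero]
      refine psi_comp_etaHom c.1 _ fun t y hy => ?_
      rcases t with _ | ⟨g, _ | _⟩
      have hv : catVal₁ c.1 (y.pre 0) = 0 := by
        have : y.pre 0 = ⟨𝟙 _⟩ := arr_id_of_deg _ (deg_pre y 0)
        rw [this]
        exact catVal₁_id c _
      have h3 := kpsOne_apply c (ofConcat g.unop y hy) (isPair_ofConcat g.unop y hy)
      have h4 : preDiff c.1 ⟨ofConcat g.unop y hy⟩ 0 (deg g.unop) = -catVal₁ c.1 ⟨g.unop⟩ := by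
        refine (congrArg₂ (· - ·) hv (congrArg (catVal₁ c.1) (pre_concat g.unop y hy))).trans ?_
        exact zero_sub _
      rw [h4, constVal_neg] at h3
      refine (congrArg (psiSign 1 • ·) h3).trans ?_
      exact (neg_one_zsmul _).trans (neg_neg _)⟩)
  refine ⟨κ, h1 _ fun c => ⟨⟨kpsOne k Λ M c, fun x y g j l h => kpsOne_apply c g h⟩,
    fun s hs => ?_⟩, h2⟩
  have : s = kpsOne k Λ M c := by
    refine Subtype.ext (Subtype.ext (funext fun t => ?_))
    rcases t with ⟨x, _ | ⟨g, _ | _⟩⟩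
    have h := (Level.min k Λ).isPair ⟨g⟩
    exact (hs x _ g _ _ h).trans (kpsOne_apply c g h).symm
  rw [this, sub_self]
  exact zero_mem _

/-! ### The map `κ²` -/

/-- The value `c(x(0, a), x(a, b))` for `a ≤ b` (for arbitrary `a` and `b`, the upper bound `a ⊔ b`
takes the place of `b`). -/
def preVal (c : barObj Λᵒᵖ 2 ⟶ constMod Λ M) (x : InfPath k Λ) (a b : Fin k → ℕ) : M :=
  catVal₂ c (x.map (zero_le' a)) (x.map (le_sup_left : a ≤ a ⊔ b))

lemma preVal_eq (c : barObj Λᵒᵖ 2 ⟶ constMod Λ M) {x : InfPath k Λ} {a b : Fin k → ℕ} (hab : a ≤ b)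
    {u v w : Λ} {μ : v ⟶ w} {α : u ⟶ v} (hμ : x.pre a = ⟨μ⟩) (hα : x.seg hab = ⟨α⟩) :
    preVal c x a b = catVal₂ c μ α := by
  refine catVal₂_congr c hμ (Eq.trans ?_ hα)
  have : ∀ (b' : Fin k → ℕ) (h : a ≤ b'), b' = b → x.seg h = x.seg hab := by
    rintro _ _ rfl
    rfl
  exact this _ _ (sup_eq_right.2 hab)

lemma preVal_congr (c : barObj Λᵒᵖ 2 ⟶ constMod Λ M) {x y : InfPath k Λ} {a b : Fin k → ℕ}
    (h : y.pre (a ⊔ b) = x.pre (a ⊔ b)) : preVal c y a b = preVal c x a b :=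
  catVal₂_congr c (pre_mono le_sup_left h) (seg_eq_of_pre h le_sup_left)

lemma isLocallyConstant_preVal (c : barObj Λᵒᵖ 2 ⟶ constMod Λ M) {T : Type*} [TopologicalSpace T]
    {x : T → InfPath k Λ} (hx : Continuous x) {a b : T → Fin k → ℕ} (ha : IsLocallyConstant a)
    (hb : IsLocallyConstant b) : IsLocallyConstant fun t => preVal c (x t) (a t) (b t) := by
  rw [IsLocallyConstant.iff_eventually_eq]
  intro t
  filter_upwards [eventually_pre_eq hx t (a t ⊔ b t), (IsLocallyConstant.iff_eventually_eq a).1 ha t,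
    (IsLocallyConstant.iff_eventually_eq b).1 hb t] with t' h h' h''
  rw [h', h'', preVal_congr c h]

lemma preVal_trans (c : homZ (barObj Λᵒᵖ) (modDiff Λ) (constMod Λ M) 2) (x : InfPath k Λ)
    {a b e : Fin k → ℕ} (hab : a ≤ b) (hbe : b ≤ e) : preVal c.1 x a e =
      preVal c.1 x a b + preVal c.1 x b e - catVal₂ c.1 (x.map hab) (x.map hbe) := by
  rw [preVal_eq c.1 (hab.trans hbe) (μ := x.map (zero_le' a)) rfl
      (congrArg Arr.mk (x.map_comp hab hbe).symm), preVal_eq c.1 hab rfl rfl,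
    preVal_eq c.1 hbe (pre_eq_comp hab (μ := x.map (zero_le' a)) rfl rfl) rfl]
  exact catVal₂_cocycle c _ _ _

/-- `c(x(0, j), x(j, a)) - c(y(0, ℓ), y(ℓ, b))` for `g = (x, n, y)`: the difference between the
presentations `n = j - ℓ` and `n = a - b` of `g` in the extension of the path groupoid by `M` that is
determined by `c`. -/
def levelDiff (c : barObj Λᵒᵖ 2 ⟶ constMod Λ M) (g : Arr (InfPath k Λ)) (j l a b : Fin k → ℕ) : M :=
  preVal c g.tgt j a - preVal c g.src l b

lemma levelDiff_trans (c : homZ (barObj Λᵒᵖ) (modDiff Λ) (constMod Λ M) 2) {x y : InfPath k Λ}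
    {g : y ⟶ x} {j l a b : Fin k → ℕ} (h : GHom.IsPair g j l) (h' : GHom.IsPair g a b) (hj : j ≤ a)
    (m : Fin k → ℕ) : levelDiff c.1 ⟨g⟩ j l (a + m) (b + m) =
      levelDiff c.1 ⟨g⟩ j l a b + levelDiff c.1 ⟨g⟩ a b (a + m) (b + m) := by
  obtain ⟨r, rfl, rfl⟩ := h.exists_add h' hj
  have e : catVal₂ c.1 (x.map (le_self_add (a := j) (b := r)))
      (x.map (le_self_add (a := j + r) (b := m))) = catVal₂ c.1
      (y.map (le_self_add (a := l) (b := r))) (y.map (le_self_add (a := l + r) (b := m))) :=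
    catVal₂_congr c.1 (seg_shift h.2) (seg_shift h'.2)
  simp only [levelDiff]
  rw [preVal_trans c x (le_self_add (a := j) (b := r)) (le_self_add (a := j + r) (b := m)),
    preVal_trans c y (le_self_add (a := l) (b := r)) (le_self_add (a := l + r) (b := m)), e]
  abel

/-- The value at `(g, h)` of the 2-cochain of a level function, computed in degrees `(a, b, e)`. -/
def kpsTriple (c : barObj Λᵒᵖ 2 ⟶ constMod Λ M) (L : Level k Λ) (g h gh : Arr (InfPath k Λ))
    (a b e : Fin k → ℕ) : M :=
  levelDiff c g (L.j g) (L.l g) a b + levelDiff c h (L.j h) (L.l h) b e -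
    levelDiff c gh (L.j gh) (L.l gh) a e

lemma kpsTriple_add (c : homZ (barObj Λᵒᵖ) (modDiff Λ) (constMod Λ M) 2) {L : Level k Λ}
    {x y z : InfPath k Λ} {g : y ⟶ x} {h : z ⟶ y} {a b e : Fin k → ℕ} (H : L.IsTriple g h a b e)
    (m : Fin k → ℕ) : kpsTriple c.1 L ⟨g⟩ ⟨h⟩ ⟨h ≫ g⟩ (a + m) (b + m) (e + m) =
      kpsTriple c.1 L ⟨g⟩ ⟨h⟩ ⟨h ≫ g⟩ a b e := by
  rw [kpsTriple, levelDiff_trans c (L.isPair ⟨g⟩) H.fst H.le_fst,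
    levelDiff_trans c (L.isPair ⟨h⟩) H.snd H.le_snd,
    levelDiff_trans c (L.isPair ⟨h ≫ g⟩) (GHom.isPair_comp H.fst H.snd) H.le_comp, kpsTriple]
  simp only [levelDiff]
  abel

lemma Level.IsTriple.exists_add {L L' : Level k Λ} {x y z : InfPath k Λ} {g : y ⟶ x} {h : z ⟶ y}
    {a b e a' b' e' : Fin k → ℕ} (H : L.IsTriple g h a b e) (H' : L'.IsTriple g h a' b' e') :
    ∃ m, a' + a = a + m ∧ b' + a = b + m ∧ e' + a = e + m := by
  obtain ⟨m, h1, h2⟩ := H.fst.exists_add (H'.fst.add a) le_add_self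
  obtain ⟨m', h3, h4⟩ := H.snd.exists_add (H'.snd.add a) (h2 ▸ le_self_add)
  obtain rfl : m = m' := add_left_cancel (h2.symm.trans h3)
  exact ⟨m, h1, h2, h4⟩

lemma kpsTriple_eq (c : homZ (barObj Λᵒᵖ) (modDiff Λ) (constMod Λ M) 2) {L : Level k Λ}
    {x y z : InfPath k Λ} {g : y ⟶ x} {h : z ⟶ y} {a b e a' b' e' : Fin k → ℕ}
    (H : L.IsTriple g h a b e) (H' : L.IsTriple g h a' b' e') :
    kpsTriple c.1 L ⟨g⟩ ⟨h⟩ ⟨h ≫ g⟩ a b e = kpsTriple c.1 L ⟨g⟩ ⟨h⟩ ⟨h ≫ g⟩ a' b' e' := by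
  obtain ⟨m, h1, h2, h3⟩ := H.exists_add H'
  rw [← kpsTriple_add c H m, ← h1, ← h2, ← h3, kpsTriple_add c H']

/-- The product of the entries of a pair. -/
def tupProd (t : Tot (Tup (InfPath k Λ) 2)) : Arr (InfPath k Λ) :=
  tupHead (⟨t.base, face 1 0 t.val⟩ : Tot (Tup (InfPath k Λ) 1))

lemma continuous_tupProd : Continuous (tupProd : Tot (Tup (InfPath k Λ) 2) → Arr (InfPath k Λ)) :=
  continuous_tupHead.comp (continuous_face 1 0)

/-- The 2-cochain of a level function, with an explicit choice of degrees. -/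
def kpsFun (c : barObj Λᵒᵖ 2 ⟶ constMod Λ M) (L : Level k Λ) (t : Tot (Tup (InfPath k Λ) 2)) : M :=
  kpsTriple c L (tupHead t) (tupHead (tupTail t)) (tupProd t)
    (L.j (tupHead t) + (L.j (tupHead (tupTail t)) + L.j (tupProd t)))
    (L.l (tupHead t) + (L.j (tupHead (tupTail t)) + L.j (tupProd t)))
    (L.l (tupHead (tupTail t)) + (L.l (tupHead t) + L.j (tupProd t)))

lemma kpsFun_eq (c : homZ (barObj Λᵒᵖ) (modDiff Λ) (constMod Λ M) 2) {L : Level k Λ}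
    {x y z : InfPath k Λ} {g : y ⟶ x} {h : z ⟶ y} {a b e : Fin k → ℕ} (H : L.IsTriple g h a b e) :
    kpsFun c.1 L ⟨x, .cons g (.cons h .nil)⟩ = kpsTriple c.1 L ⟨g⟩ ⟨h⟩ ⟨h ≫ g⟩ a b e :=
  kpsTriple_eq c (L.isTriple g h) H

lemma isLocallyConstant_levelDiff (c : barObj Λᵒᵖ 2 ⟶ constMod Λ M) {T : Type*} [TopologicalSpace T]
    {g : T → Arr (InfPath k Λ)} (hg : Continuous g) {j l a b : T → Fin k → ℕ}
    (hj : IsLocallyConstant j) (hl : IsLocallyConstant l) (ha : IsLocallyConstant a)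
    (hb : IsLocallyConstant b) :
    IsLocallyConstant fun t => levelDiff c (g t) (j t) (l t) (a t) (b t) :=
  (isLocallyConstant_preVal c (continuous_tgt.comp hg) hj ha).sub
    (isLocallyConstant_preVal c (continuous_src.comp hg) hl hb)

lemma isLocallyConstant_kpsFun (c : barObj Λᵒᵖ 2 ⟶ constMod Λ M) (L : Level k Λ) :
    IsLocallyConstant (kpsFun c L) := by
  have h1 : Continuous (tupHead : Tot (Tup (InfPath k Λ) 2) → _) := continuous_tupHead
  have h2 : Continuous fun t : Tot (Tup (InfPath k Λ) 2) => tupHead (tupTail t) :=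
    continuous_tupHead.comp continuous_tupTail
  have h3 := continuous_tupProd (k := k) (Λ := Λ)
  have j1 := L.locConst_j.comp_continuous h1
  have j2 := L.locConst_j.comp_continuous h2
  have j3 := L.locConst_j.comp_continuous h3
  have l1 := L.locConst_l.comp_continuous h1
  have l2 := L.locConst_l.comp_continuous h2
  have l3 := L.locConst_l.comp_continuous h3
  have a := j1.add (j2.add j3)
  have b := l1.add (j2.add j3)
  have e := l2.add (l1.add j3)
  exact ((isLocallyConstant_levelDiff c h1 j1 l1 a b).add
    (isLocallyConstant_levelDiff c h2 j2 l2 b e)).sub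
    (isLocallyConstant_levelDiff c h3 j3 l3 a e)

/-- In degrees `(a, b, e, f)` which present all the products of `g`, `h` and `i`, the cochain of `L`
is the coboundary of `g ↦ levelDiff c g (L.j g) (L.l g)`. -/
lemma kpsFun_cocycle (c : homZ (barObj Λᵒᵖ) (modDiff Λ) (constMod Λ M) 2) (L : Level k Λ)
    {x y z w : InfPath k Λ} (g : y ⟶ x) (h : z ⟶ y) (i : w ⟶ z) :
    kpsFun c.1 L ⟨y, .cons h (.cons i .nil)⟩ - kpsFun c.1 L ⟨x, .cons (h ≫ g) (.cons i .nil)⟩ +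
      kpsFun c.1 L ⟨x, .cons g (.cons (i ≫ h) .nil)⟩ - kpsFun c.1 L ⟨x, .cons g (.cons h .nil)⟩ =
      0 := by
  have H := L.isTriple g h
  have H' := L.isTriple h i
  generalize L.j ⟨g⟩ + (L.j ⟨h⟩ + L.j ⟨h ≫ g⟩) = a at H
  generalize L.l ⟨g⟩ + (L.j ⟨h⟩ + L.j ⟨h ≫ g⟩) = b at H
  generalize L.l ⟨h⟩ + (L.l ⟨g⟩ + L.j ⟨h ≫ g⟩) = e at H
  generalize L.j ⟨h⟩ + (L.j ⟨i⟩ + L.j ⟨i ≫ h⟩) = b' at H'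
  generalize L.l ⟨h⟩ + (L.j ⟨i⟩ + L.j ⟨i ≫ h⟩) = e' at H'
  generalize L.l ⟨i⟩ + (L.l ⟨h⟩ + L.j ⟨i ≫ h⟩) = f at H'
  obtain ⟨m, h1, h2⟩ := H.snd.exists_add (H'.fst.add b) le_add_self
  have T := (H.add m).add (L.j ⟨i ≫ h ≫ g⟩)
  have T' := (H'.add b).add (L.j ⟨i ≫ h ≫ g⟩)
  rw [h1, h2] at T'
  have T1 : L.IsTriple (h ≫ g) i (a + m + L.j ⟨i ≫ h ≫ g⟩) _ _ :=
    ⟨GHom.isPair_comp T.fst T.snd, T'.snd, T.le_comp, T'.le_snd, le_add_self⟩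
  have T2 : L.IsTriple g (i ≫ h) (a + m + L.j ⟨i ≫ h ≫ g⟩) _ _ :=
    ⟨T.fst, GHom.isPair_comp T'.fst T'.snd, T.le_fst, T'.le_comp, by
      rw [Category.assoc]
      exact le_add_self⟩
  rw [kpsFun_eq c T, kpsFun_eq c T', kpsFun_eq c T1, kpsFun_eq c T2]
  simp only [kpsTriple, Category.assoc]
  abel

lemma catVal₂_add (c c' : barObj Λᵒᵖ 2 ⟶ constMod Λ M) {u v w : Λ} (μ : v ⟶ w) (α : u ⟶ v) :
    catVal₂ (c + c') μ α = catVal₂ c μ α + catVal₂ c' μ α := rfl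

/-- The continuous 2-cocycles of a level function. -/
def kpsTwo (M : AddCommGrpCat.{u}) (L : Level k Λ) :
    homZ (barObj Λᵒᵖ) (modDiff Λ) (constMod Λ M) 2 →+
      contZ (uSheaf (constMod Λ M) : GSheaf (InfPath k Λ)) 2 :=
  constCocycleHom (AddMonoidHom.mk' (fun c => kpsFun c.1 L) fun c c' => funext fun t => by
      change kpsFun (c.1 + c'.1) L t = kpsFun c.1 L t + kpsFun c'.1 L t
      simp only [kpsFun, kpsTriple, levelDiff, preVal, catVal₂_add]
      abel)
    (fun c => isLocallyConstant_kpsFun c.1 L) (by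
    intro c x y g t
    rcases t with _ | ⟨h, _ | ⟨i, _ | _⟩⟩
    refine Eq.trans ?_ (kpsFun_cocycle c L g h i)
    simp only [Finset.sum_range_succ, Finset.sum_range_zero, face, AddMonoidHom.mk'_apply]
    simp [pow_succ, sub_eq_add_neg, add_assoc])

lemma kpsTwo_apply (L : Level k Λ) (c : homZ (barObj Λᵒᵖ) (modDiff Λ) (constMod Λ M) 2)
    {x y z : InfPath k Λ} {g : y ⟶ x} {h : z ⟶ y} {a b e : Fin k → ℕ} (H : L.IsTriple g h a b e) :
    (kpsTwo M L c).1.1 ⟨x, .cons g (.cons h .nil)⟩ =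
      constVal M x (kpsTriple c.1 L ⟨g⟩ ⟨h⟩ ⟨h ≫ g⟩ a b e) :=
  congrArg (constVal M x) (kpsFun_eq c H)

/-- A 2-cochain `m(g, h) = m'(h) - m'(gh) + m'(g)` is a coboundary. -/
lemma mem_contB_two {s : cochains (uSheaf (constMod Λ M) : GSheaf (InfPath k Λ)) 2}
    {m : Tot (Tup (InfPath k Λ) 2) → M} (hs : ∀ t, s.1 t = constVal M t.base (m t))
    {m' : Arr (InfPath k Λ) → M} (hm' : IsLocallyConstant m')
    (h : ∀ {x y z : InfPath k Λ} (g : y ⟶ x) (h : z ⟶ y),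
      m ⟨x, .cons g (.cons h .nil)⟩ = m' ⟨h⟩ - m' ⟨h ≫ g⟩ + m' ⟨g⟩) :
    s ∈ contB (uSheaf (constMod Λ M) : GSheaf (InfPath k Λ)) 2 := by
  refine mem_contB_of_constVal hs (m' := fun t => m' (tupHead t))
    (hm'.comp_continuous continuous_tupHead) ?_
  intro x y g t
  rcases t with _ | ⟨i, _ | _⟩
  refine (h g i).trans ?_
  simp only [Finset.sum_range_succ, Finset.sum_range_zero, face, tupHead]
  simp [pow_succ, sub_eq_add_neg, add_assoc]

/-- The class of `kpsTwo M L c` does not depend on `L`: the two cocycles differ by the coboundary of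
the difference between the two presentations of `g`. -/
lemma kpsTwo_sub_mem_contB (L L' : Level k Λ)
    (c : homZ (barObj Λᵒᵖ) (modDiff Λ) (constMod Λ M) 2) :
    (kpsTwo M L c).1 - (kpsTwo M L' c).1 ∈ contB _ 2 := by
  let m' : Arr (InfPath k Λ) → M := fun g =>
    levelDiff c.1 g (L.j g) (L.l g) (L.j g + L'.j g) (L.l g + L'.j g) -
      levelDiff c.1 g (L'.j g) (L'.l g) (L.j g + L'.j g) (L.l g + L'.j g)
  have key : ∀ {x y : InfPath k Λ} (g : y ⟶ x) {a b : Fin k → ℕ}, GHom.IsPair g a b → L.j ⟨g⟩ ≤ a →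
      L'.j ⟨g⟩ ≤ a → m' ⟨g⟩ = levelDiff c.1 ⟨g⟩ (L.j ⟨g⟩) (L.l ⟨g⟩) a b -
        levelDiff c.1 ⟨g⟩ (L'.j ⟨g⟩) (L'.l ⟨g⟩) a b := by
    intro x y g a b hab h h'
    have h0 := (L.isPair ⟨g⟩).add (L'.j ⟨g⟩)
    obtain ⟨m, h1, h2⟩ := h0.exists_add (hab.add (L.j ⟨g⟩ + L'.j ⟨g⟩)) le_add_self
    have e1 := levelDiff_trans c (L.isPair ⟨g⟩) h0 le_self_add m
    have e2 := levelDiff_trans c (L'.isPair ⟨g⟩) h0 le_add_self m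
    rw [← h1, ← h2, levelDiff_trans c (L.isPair ⟨g⟩) hab h] at e1
    rw [← h1, ← h2, levelDiff_trans c (L'.isPair ⟨g⟩) hab h'] at e2
    have e3 := congrArg₂ (· - ·) e1 e2
    simp only [add_sub_add_right_eq_sub] at e3
    exact e3.symm
  refine mem_contB_two (m := fun t => kpsFun c.1 L t - kpsFun c.1 L' t) (m' := m') (fun t => ?_) ?_
    fun {x y z} g h => ?_
  · refine Eq.symm ?_
    rw [sub_eq_add_neg, constVal_add, constVal_neg, ← sub_eq_add_neg]
    rfl
  · have hj := L.locConst_j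
    have hl := L.locConst_l
    have hj' := L'.locConst_j
    have hl' := L'.locConst_l
    exact (isLocallyConstant_levelDiff c.1 continuous_id hj hl (hj.add hj') (hl.add hj')).sub
      (isLocallyConstant_levelDiff c.1 continuous_id hj' hl' (hj.add hj') (hl.add hj'))
  · have H := L.isTriple g h
    have H' := L'.isTriple g h
    obtain ⟨m, h1, h2, h3⟩ := H.exists_add H'
    have H := H.add m
    have H' := H'.add (L.j ⟨g⟩ + (L.j ⟨h⟩ + L.j ⟨h ≫ g⟩))
    rw [h1, h2, h3] at H'
    rw [kpsFun_eq c H, kpsFun_eq c H', key g H.fst H.le_fst H'.le_fst,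
      key h H.snd H.le_snd H'.le_snd,
      key (h ≫ g) (GHom.isPair_comp H.fst H.snd) H.le_comp H'.le_comp]
    simp only [kpsTriple]
    abel

lemma preVal_coboundary (b : barObj Λᵒᵖ 1 ⟶ constMod Λ M) (x : InfPath k Λ) {a e : Fin k → ℕ}
    (h : a ≤ e) : preVal (modDiff Λ 1 ≫ b) x a e =
      catVal₁ b (x.pre a) - catVal₁ b (x.pre e) + catVal₁ b (x.seg h) := by
  rw [preVal_eq _ h (μ := x.map (zero_le' a)) (α := x.map h) rfl rfl, catVal_modDiff_one,
    pre_eq_comp h (μ := x.map (zero_le' a)) (α := x.map h) rfl rfl]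
  rfl

lemma levelDiff_coboundary (b : barObj Λᵒᵖ 1 ⟶ constMod Λ M) {x y : InfPath k Λ} {g : y ⟶ x}
    {j l a e : Fin k → ℕ} (h : GHom.IsPair g j l) (h' : GHom.IsPair g a e) (hj : j ≤ a) :
    levelDiff (modDiff Λ 1 ≫ b) ⟨g⟩ j l a e = preDiff b ⟨g⟩ j l - preDiff b ⟨g⟩ a e := by
  obtain ⟨m, rfl, rfl⟩ := h.exists_add h' hj
  simp only [levelDiff, preDiff]
  rw [preVal_coboundary b x (le_self_add (a := j) (b := m)),
    preVal_coboundary b y (le_self_add (a := l) (b := m)), seg_shift h.2]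
  abel

lemma kpsTwo_coboundary (L : Level k Λ) (c : homZ (barObj Λᵒᵖ) (modDiff Λ) (constMod Λ M) 2)
    (hc : c.1 ∈ homB (barObj Λᵒᵖ) (modDiff Λ) (constMod Λ M) 2) :
    (kpsTwo M L c).1 ∈ contB _ 2 := by
  obtain ⟨b, hb⟩ := hc
  have hc : c.1 = modDiff Λ 1 ≫ b := hb.symm
  refine mem_contB_two (m := kpsFun c.1 L) (fun _ => rfl)
    (m' := fun g => preDiff b g (L.j g) (L.l g)) ?_ fun {x y z} g h => ?_
  · exact (isLocallyConstant_pre continuous_tgt L.locConst_j (catVal₁ b)).sub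
      (isLocallyConstant_pre continuous_src L.locConst_l (catVal₁ b))
  · have H := L.isTriple g h
    rw [kpsFun_eq c H, kpsTriple, hc, levelDiff_coboundary b (L.isPair ⟨g⟩) H.fst H.le_fst,
      levelDiff_coboundary b (L.isPair ⟨h⟩) H.snd H.le_snd,
      levelDiff_coboundary b (L.isPair ⟨h ≫ g⟩) (GHom.isPair_comp H.fst H.snd) H.le_comp]
    simp only [preDiff]
    abel

/-! ### The map `κ²` and the chain map `ψ` -/

lemma catVal₂_id_right (c : homZ (barObj Λᵒᵖ) (modDiff Λ) (constMod Λ M) 2) {u v : Λ} (l : u ⟶ v) :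
    catVal₂ c.1 l (𝟙 u) = catVal₂ c.1 (𝟙 u) (𝟙 u) := by
  have h := catVal₂_cocycle c l (𝟙 u) (𝟙 u)
  rw [Category.id_comp, Category.id_comp, add_sub_assoc] at h
  exact sub_eq_zero.1 (left_eq_add.1 h)

/-- The value `c(v, v)`. -/
def unitVal (c : barObj Λᵒᵖ 2 ⟶ constMod Λ M) (v : Λ) : M := catVal₂ c (𝟙 v) (𝟙 v)

lemma levelDiff_self (c : homZ (barObj Λᵒᵖ) (modDiff Λ) (constMod Λ M) 2) {x y : InfPath k Λ}
    {g : y ⟶ x} {j l : Fin k → ℕ} (h : GHom.IsPair g j l) : levelDiff c.1 ⟨g⟩ j l j l = 0 := by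
  have key : ∀ (z : InfPath k Λ) (a : Fin k → ℕ), preVal c.1 z a a = unitVal c.1 (z.obj a) :=
    fun z a => (preVal_eq c.1 le_rfl (μ := z.map (zero_le' a)) rfl
      (congrArg Arr.mk (z.map_id a))).trans (catVal₂_id_right c _)
  rw [levelDiff, key, key]
  exact sub_eq_zero.2 (congrArg (unitVal c.1) (obj_eq_of_isPair h))

/-- On the pair `((y, -d(λ₁), λ₁y), (λ₁y, -d(λ₀), λ₀λ₁y))` the cocycle of the minimal level function
is `c(v, v) - c(λ₀, λ₁)`, where `v = r(λ₁)`. -/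
lemma kpsTwo_min_apply (c : homZ (barObj Λᵒᵖ) (modDiff Λ) (constMod Λ M) 2) {u v w : Λ}
    (l : v ⟶ w) (f : u ⟶ v) (y : InfPath k Λ) (hy : y.obj 0 = u) :
    (kpsTwo M (Level.min k Λ) c).1.1 ⟨y, .cons (ofConcat f y hy)
      (.cons (ofConcat l (concat f y hy) (concat_obj_zero f y hy)) .nil)⟩ =
    constVal M y (unitVal c.1 v - catVal₂ c.1 l f) := by
  have hz := concat_obj_zero f y hy
  have h1 := isPair_ofConcat f y hy
  have h2 := isPair_ofConcat l (concat f y hy) hz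
  have h2' := h2.add (deg f)
  rw [zero_add] at h2'
  have h3 := GHom.isPair_comp h1 h2'
  obtain ⟨j1, l1⟩ := Level.min_of_isPair_zero (g := ⟨ofConcat f y hy⟩) h1
  obtain ⟨j2, l2⟩ := Level.min_of_isPair_zero (g := ⟨ofConcat l (concat f y hy) hz⟩) h2
  obtain ⟨j3, l3⟩ := Level.min_of_isPair_zero 
    (g := ⟨ofConcat l (concat f y hy) hz ≫ ofConcat f y hy⟩) h3
  rw [kpsTwo_apply _ c ⟨h1, h2', j1.le, j2.le.trans (zero_le' _), j3.le⟩, kpsTriple, j1, l1, j2, l2,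
    j3, l3, levelDiff_self c h1, levelDiff_self c h3, zero_add, sub_zero]
  refine congrArg (constVal M y) (congrArg₂ (· - ·) ?_ ?_)
  · refine (preVal_eq c.1 (zero_le' (deg f)) (μ := 𝟙 v) ?_ (pre_concat f y hy)).trans
      (catVal₂_id c f)
    exact (arr_id_of_deg _ (deg_pre _ 0)).trans
      (congrArg (fun v : Λ => (⟨𝟙 v⟩ : Arr Λ)) hz)
  · refine preVal_eq c.1 le_self_add (pre_concat l _ hz) ?_
    have : (shift (deg l) (concat l (concat f y hy) hz)).pre (deg f) = ⟨f⟩ := by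
      rw [shift_concat, pre_concat]
    exact this

/-! ### The map `κ²` and partitions -/

/-- The value of the cocycle of a partition in terms of the paths `α`, `β` and `γ`. -/
lemma kpsTwo_level_apply {P : Set (Arr Λ × Arr Λ)} (hP : IsPartition (k := k) P)
    (c : homZ (barObj Λᵒᵖ) (modDiff Λ) (constMod Λ M) 2) {x y z : InfPath k Λ} {g : y ⟶ x}
    {h : z ⟶ y} (D : KPSData P g h) :
    (kpsTwo M hP.level c).1.1 ⟨x, .cons g (.cons h .nil)⟩ = constVal M x
      (catVal₂ c.1 D.μg D.α - catVal₂ c.1 D.νg D.α + catVal₂ c.1 D.μh D.β - catVal₂ c.1 D.νh D.β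
        - catVal₂ c.1 D.μgh D.γ + catVal₂ c.1 D.νgh D.γ) := by
  obtain ⟨μg, νg, μh, νh, μgh, νgh, α, β, γ, ω, ω_zero, mem_g, mem_h, mem_gh, g_mem, h_mem, gh_mem,
    eq₁, eq₂, eq₃, x_eq, y_eq, z_eq⟩ := D
  dsimp only
  have pg := hP.pair_eq mem_g g_mem
  have ph := hP.pair_eq mem_h h_mem
  have pgh := hP.pair_eq mem_gh gh_mem
  have jg : hP.level.j ⟨g⟩ = deg μg := congrArg (fun p : Arr Λ × Arr Λ => deg p.1.hom) pg
  have lg : hP.level.l ⟨g⟩ = deg νg := congrArg (fun p : Arr Λ × Arr Λ => deg p.2.hom) pg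
  have jh : hP.level.j ⟨h⟩ = deg μh := congrArg (fun p : Arr Λ × Arr Λ => deg p.1.hom) ph
  have lh : hP.level.l ⟨h⟩ = deg νh := congrArg (fun p : Arr Λ × Arr Λ => deg p.2.hom) ph
  have jgh : hP.level.j ⟨h ≫ g⟩ = deg μgh := congrArg (fun p : Arr Λ × Arr Λ => deg p.1.hom) pgh
  have lgh : hP.level.l ⟨h ≫ g⟩ = deg νgh := congrArg (fun p : Arr Λ × Arr Λ => deg p.2.hom) pgh
  have hx : x.pre (deg (α ≫ μg)) = ⟨α ≫ μg⟩ := by rw [x_eq, pre_concat]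
  have hy : y.pre (deg (α ≫ νg)) = ⟨α ≫ νg⟩ := by rw [y_eq, pre_concat]
  have hz : z.pre (deg (β ≫ νh)) = ⟨β ≫ νh⟩ := by rw [z_eq, pre_concat]
  have hx' : x.pre (deg (α ≫ μg)) = ⟨γ ≫ μgh⟩ := by rw [hx, eq₂]
  have hy' : y.pre (deg (α ≫ νg)) = ⟨β ≫ μh⟩ := by rw [hy, eq₁]
  have hz' : z.pre (deg (β ≫ νh)) = ⟨γ ≫ νgh⟩ := by rw [hz, eq₃]
  have d1 : deg (α ≫ μg) = deg μg + deg α := deg_comp _ _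
  have d2 : deg (α ≫ νg) = deg νg + deg α := deg_comp _ _
  have d2' : deg (α ≫ νg) = deg μh + deg β := by rw [eq₁, deg_comp]
  have d3 : deg (β ≫ νh) = deg νh + deg β := deg_comp _ _
  have lx : deg μg ≤ deg (α ≫ μg) := d1 ▸ le_self_add
  have ly : deg νg ≤ deg (α ≫ νg) := d2 ▸ le_self_add
  have ly' : deg μh ≤ deg (α ≫ νg) := d2' ▸ le_self_add
  have lz : deg νh ≤ deg (β ≫ νh) := d3 ▸ le_self_add
  have lx' : deg μgh ≤ deg (α ≫ μg) := by rw [eq₂, deg_comp]; exact le_self_add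
  have lz' : deg νgh ≤ deg (β ≫ νh) := by rw [eq₃, deg_comp]; exact le_self_add
  have H : hP.level.IsTriple g h (deg (α ≫ μg)) (deg (α ≫ νg)) (deg (β ≫ νh)) :=
    { fst := by rw [d1, d2]; exact g_mem.1.add _
      snd := by rw [d2', d3]; exact h_mem.1.add _
      le_fst := jg.trans_le lx
      le_snd := jh.trans_le ly'
      le_comp := jgh.trans_le lx' }
  have key : ∀ {p : InfPath k Λ} {a : Fin k → ℕ} {u v w : Λ} {μ : v ⟶ w} {α : u ⟶ v}
      (_ : deg μ ≤ a) (_ : p.pre a = ⟨α ≫ μ⟩), preVal c.1 p (deg μ) a = catVal₂ c.1 μ α :=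
    fun hd hp => preVal_eq c.1 hd (pre_seg_of_pre hd rfl hp).1 (pre_seg_of_pre hd rfl hp).2
  rw [kpsTwo_apply _ c H, kpsTriple, jg, lg, jh, lh, jgh, lgh]
  simp only [levelDiff]
  rw [key lx hx, key ly hy, key ly' hy', key lz hz, key lx' hx', key lz' hz']
  congr 1
  abel

lemma exists_kpsData {P : Set (Arr Λ × Arr Λ)} (hP : IsPartition (k := k) P) {x y z : InfPath k Λ}
    (g : y ⟶ x) (h : z ⟶ y) : Nonempty (KPSData P g h) := by
  have H := hP.level.isTriple g h
  generalize hP.level.j ⟨g⟩ + (hP.level.j ⟨h⟩ + hP.level.j ⟨h ≫ g⟩) = a at H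
  generalize hP.level.l ⟨g⟩ + (hP.level.j ⟨h⟩ + hP.level.j ⟨h ≫ g⟩) = b at H
  generalize hP.level.l ⟨h⟩ + (hP.level.l ⟨g⟩ + hP.level.j ⟨h ≫ g⟩) = e at H
  -- A pair `(μ, ν)` of `P` with `f ∈ Z(μ, ν)`, and the path `δ` such that
  -- `x(0, a) = μδ` and `y(0, b) = νδ`.
  have key : ∀ {x y : InfPath k Λ} (f : y ⟶ x) {a b : Fin k → ℕ} {v w r : Λ},
      GHom.IsPair f a b → hP.level.j ⟨f⟩ ≤ a → x.obj 0 = v → y.obj 0 = w → x.obj a = r →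
      ∃ (s : Λ) (μ : s ⟶ v) (ν : s ⟶ w) (δ : r ⟶ s), ((⟨μ⟩, ⟨ν⟩) : Arr Λ × Arr Λ) ∈ P ∧
        ⟨f⟩ ∈ GHom.cyl (⟨μ⟩ : Arr Λ) ⟨ν⟩ ∧ x.pre a = ⟨δ ≫ μ⟩ ∧ y.pre b = ⟨δ ≫ ν⟩ := by
    rintro x y f a b _ _ _ hf hj rfl rfl rfl
    have hm := hP.pair_mem ⟨f⟩
    have hc := hP.mem_cyl_pair ⟨f⟩
    change deg (hP.pair ⟨f⟩).1.hom ≤ a at hj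
    have hs := hP.1 _ hm
    generalize hP.pair ⟨f⟩ = p at hm hc hj hs
    obtain ⟨⟨μ⟩, ⟨ν⟩⟩ := p
    obtain ⟨hf', hμ, hν⟩ := hc
    dsimp only at hs hμ hν hj hf'
    obtain rfl : x.obj 0 = _ := congrArg Arr.tgt hμ
    obtain rfl : y.obj 0 = _ := congrArg Arr.tgt hν
    obtain rfl := hs
    obtain ⟨m, ha, hb⟩ := hf'.exists_add hf hj
    have hl : deg ν ≤ b := hb ▸ le_self_add
    obtain ⟨δ, hδ⟩ := exists_hom (x := x) hj (congrArg Arr.src hμ) rfl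
    exact ⟨_, μ, ν, δ, hm, ⟨hf', hμ, hν⟩, pre_eq_comp hj hμ hδ.symm,
      pre_eq_comp hl hν ((seg_shift' hf'.2 ha hb hj hl).symm.trans hδ.symm)⟩
  have hxy : shift a x = shift b y := H.fst.2
  have hyz : shift b y = shift e z := H.snd.2
  have hy : y.obj b = x.obj a := (congrArg (fun w : InfPath k Λ => w.obj 0) hxy).symm
  obtain ⟨_, μg, νg, α, mg, cg, g1, g2⟩ := key g H.fst H.le_fst rfl rfl rfl
  obtain ⟨_, μh, νh, β, mh, ch, h1, h2⟩ := key h H.snd H.le_snd rfl rfl hy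
  obtain ⟨_, μgh, νgh, γ, mgh, cgh, f1, f2⟩ :=
    key (h ≫ g) (GHom.isPair_comp H.fst H.snd) H.le_comp rfl rfl rfl
  have hom_eq : ∀ {u v : Λ} {f f' : u ⟶ v}, (⟨f⟩ : Arr Λ) = ⟨f'⟩ → f = f' := fun h => by
    cases h
    rfl
  have hconcat : ∀ {p : InfPath k Λ} {d : Fin k → ℕ} {r s v : Λ} {δ : r ⟶ s} {μ : s ⟶ v}
      (_ : p.pre d = ⟨δ ≫ μ⟩) (_ : shift d p = shift a x) (h0 : (shift a x).obj 0 = r),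
      p = concat (δ ≫ μ) (shift a x) h0 := by
    intro p d r s v δ μ hp hd h0
    obtain rfl : deg (δ ≫ μ) = d := (congrArg (fun l : Arr Λ => deg l.hom) hp).symm.trans
      (deg_pre p d)
    exact (concat_unique hp hd).symm
  exact ⟨{
    μg, νg, μh, νh, μgh, νgh, α, β, γ
    ω := shift a x
    ω_zero := rfl
    mem_g := mg
    mem_h := mh
    mem_gh := mgh
    g_mem := cg
    h_mem := ch
    gh_mem := cgh
    eq₁ := hom_eq (g2.symm.trans h1)
    eq₂ := hom_eq (g1.symm.trans f1)
    eq₃ := hom_eq (h2.symm.trans f2)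
    x_eq := hconcat g1 rfl _
    y_eq := hconcat g2 hxy.symm _
    z_eq := hconcat h2 (hxy.trans hyz).symm _ }⟩

lemma exists_kps_two (M : AddCommGrpCat.{u}) :
    ∃ κ : ModCoh (constMod Λ M) 2 →+ ContCoh (uSheaf (constMod Λ M) : GSheaf (InfPath k Λ)) 2,
      (∀ P : Set (Arr Λ × Arr Λ), IsPartition P → IsInducedBy κ (IsKPS₂ P)) ∧
      ∀ a, psiStar _ 2 (eta _ 2 (κ a)) = underline _ 2 a := by
  obtain ⟨κ, h1, h2⟩ := exists_isInducedBy (kpsTwo M (Level.min k Λ))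
    (kpsTwo_coboundary (Level.min k Λ)) (fun c => by
      -- The coboundary of `g ↦ c(s(g), s(g))` is `(g, h) ↦ c(s(g), s(g))`.
      have hm : IsLocallyConstant fun g : Arr (InfPath k Λ) => unitVal c.1 (g.src.obj 0) :=
        (isLocallyConstant_obj_zero (unitVal c.1)).comp_continuous continuous_src
      let b : cochains (uSheaf (constMod Λ M) : GSheaf (InfPath k Λ)) 2 :=
        constCochain (fun t => unitVal c.1 ((tupHead t).src.obj 0))
          (hm.comp_continuous continuous_tupHead)
      have hb : b ∈ contB _ 2 := mem_contB_two (fun _ => rfl) hm fun {x y z} g h => by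
        rw [sub_self, zero_add]
        rfl
      refine ⟨⟨b, hb⟩, psi_comp_etaHom c.1 _ fun t y hy => ?_⟩
      rcases t with _ | ⟨f, _ | ⟨l, _ | _⟩⟩
      have hv : b.1 ⟨y, psiTup (.cons f (.cons l .nil)) y hy⟩ = constVal M y (unitVal c.1 _) :=
        congrArg (fun v => constVal M y (unitVal c.1 v)) (concat_obj_zero f.unop y hy)
      have e := (congrArg₂ (· - ·) (kpsTwo_min_apply c l.unop f.unop y hy) hv).trans
        (map_sub (germS (constMod Λ M) y 0 rfl) _ _).symm
      rw [sub_sub_cancel_left] at e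
      refine (congrArg (psiSign 2 • ·) (e.trans (constVal_neg M y _))).trans ?_
      exact (neg_one_zsmul _).trans (neg_neg _))
  refine ⟨κ, fun P hP => h1 _ fun c => ⟨⟨kpsTwo M hP.level c, fun x y z g h =>
    ⟨exists_kpsData hP g h, kpsTwo_level_apply hP c⟩⟩, fun s hs => ?_⟩, h2⟩
  have : s = kpsTwo M hP.level c := by
    refine Subtype.ext (Subtype.ext (funext fun t => ?_))
    rcases t with ⟨x, _ | ⟨g, _ | ⟨h, _ | _⟩⟩⟩
    obtain ⟨⟨D⟩, hD⟩ := hs x _ _ g h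
    exact (hD D).trans (kpsTwo_level_apply hP c D).symm
  rw [this]
  exact kpsTwo_sub_mem_contB _ _ c

end

end

end KGraphCoh

open KGraphCoh in
theorem theorem4p1 {k : ℕ} {Λ : Type u} [SmallCategory Λ] [KGraph k Λ]
    (hrf : RowFinite Λ) (hns : NoSources Λ) :
    -- `η` is an isomorphism, the maps `ρ` are additive, and the right-hand triangle commutes
    (∀ (A : Λᵒᵖ ⥤ AddCommGrpCat.{u}) (n : ℕ),
      Function.Bijective (eta (uSheaf A : GSheaf (InfPath k Λ)) n) ∧
      (∀ a b, IsSum n (rho (uRes k Λ) (uSheaf A) n a) (rho (uRes k Λ) (uSheaf A) n b)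
        (rho (uRes k Λ) (uSheaf A) n (a + b))) ∧
      (∀ a b, IsSum n (rho (barRes (InfPath k Λ)) (uSheaf A) n a)
        (rho (barRes (InfPath k Λ)) (uSheaf A) n b)
        (rho (barRes (InfPath k Λ)) (uSheaf A) n (a + b))) ∧
      ∀ a, rho (uRes k Λ) (uSheaf A) n (psiStar (uSheaf A) n a) =
        rho (barRes (InfPath k Λ)) (uSheaf A) n a) ∧
    -- the left-hand square commutes for the maps `κ` of Kumjian, Pask and Sims
    (∃ P : Set (Arr Λ × Arr Λ), IsPartition P) ∧
    (∀ M : AddCommGrpCat.{u},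
      (∃ κ : ModCoh (constMod Λ M) 0 →+ ContCoh (uSheaf (constMod Λ M) : GSheaf (InfPath k Λ)) 0,
        IsInducedBy κ IsKPS₀ ∧ ∀ a, psiStar _ 0 (eta _ 0 (κ a)) = underline _ 0 a) ∧
      (∃ κ : ModCoh (constMod Λ M) 1 →+ ContCoh (uSheaf (constMod Λ M) : GSheaf (InfPath k Λ)) 1,
        IsInducedBy κ IsKPS₁ ∧ ∀ a, psiStar _ 1 (eta _ 1 (κ a)) = underline _ 1 a) ∧
      (∃ κ : ModCoh (constMod Λ M) 2 →+ ContCoh (uSheaf (constMod Λ M) : GSheaf (InfPath k Λ)) 2,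
        (∀ P : Set (Arr Λ × Arr Λ), IsPartition P → IsInducedBy κ (IsKPS₂ P)) ∧
        ∀ a, psiStar _ 2 (eta _ 2 (κ a)) = underline _ 2 a)) :=
  ⟨fun _ n => ⟨eta_bijective _ n, rho_isSum _ _ n, rho_isSum _ _ n, rho_psiStar _ n⟩,
    exists_isPartition, fun M => ⟨exists_kps_zero M, exists_kps_one M, exists_kps_two M⟩⟩
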